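/- **Setting.** The incidence graph $G$ of a CNF formula is the bipartite graph on its variables and clauses, with an edge of polarity $\star\in\{+,-\}$ between $x$ and $c$ if the literal $x_\star$ is in $c$; no clause contains a complementary pair, and every variable occurs in a clause. $|G|$ is the number of vertices. $\mathscr C_d$ is the class of incidence graphs in which every clause is adjacent to at most $d$ variables (so $\mathscr C_0$ is the class of edgeless graphs and $\mathscr C_{-1}$ that of graphs without clauses). $G[x_\star]$ is the incidence graph of the formula obtained by deleting all clauses containing $x_\star$ and removing the opposite literal of $x$ from the others; it is an induced subgraph of $G$. A *strong recursive backdoor* of $G$ to a class $\mathscr C$ is a rooted tree with root labeled $G$, in which: an inner node labeled with a connected graph $H$ has one child, labeled with a variable $x$ of $H$, which has two children labeled $H[x_+]$ and $H[x_-]$; an inner node labeled with a disconnected graph has one child for each connected component, labeled with it; every leaf is labeled with a graph in $\mathscr C$. Its *depth* is the maximal number of variable nodes on a path from the root to a leaf, and $\mathrm{srbd}_{\mathscr C}(G)$ is the minimal depth of a strong recursive backdoor of $G$ to $\mathscr C$. Let $\lambda_k=4\cdot 2^k$. For $G\in\mathscr C_d$, the *$(i,d,k)$-obstruction-trees* $T$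 of $G$ ($i\ge d$), their element sets $V(T)$ and destroy-neighborhoods $N^\dagger_G(T)$ are defined inductively. If $c$ is a clause adjacent to exactly $d$ variables $x_1,\dots,x_d$, then $T=\{c,x_1,\dots,x_d\}$ is a $(d,d,k)$-obstruction-tree with $V(T)=T$ and $N^\dagger_G(T)=\{x_1,\dots,x_d\}$. If $T_1,T_2$ are $(i,d,k)$-obstruction-trees with $N^\dagger_G(T_1)\cap N^\dagger_G(T_2)=\emptyset$ and $P$ is a path of length at most $\lambda_k$ from a vertex of $V(T_1)$ to a vertex of $V(T_2)$ (length $0$ is allowed), then $T=(T_1,P,T_2)$ is an $(i+1,d,k)$-obstruction-tree with $V(T)=V(T_1)\cup V(P)\cup V(T_2)$, and $N^\dagger_G(T)$ consists of the variables in $V(T)$ and the variables joined by a positive edge to one clause in $V(T)$ and by a negative edge to another clause in $V(T)$. **Proposition 5.9 (Obstruction-Trees Are Easy to Compute).** There is an algorithm (a program of a random access machine) that, given integers $i,d,k\ge 0$ with $d\le i\le k+1$ and an incidence graph $G\in\mathscr C_d$, in time $2^{2^{O(k)}}\cdot|G|$ (precisely: at most $2^{2^{a(k+1)}}\cdot(|G|+1)$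 steps, for a constant $a$ that does not depend on $i,d,k,G$) either 1. returns an $(i,d,k)$-obstruction-tree of $G$, or 2. returns a strong recursive backdoor of $G$ to $\mathscr C_{d-1}$ of depth at most $3^{i-d}\cdot\lambda_k\cdot d$, or 3. concludes (correctly) that $\mathrm{srbd}_{\mathscr C_0}(G)>k$. -/

import Mathlib

/-! ### Random access machine

Programs of a random access machine.  A program has finitely many registers and finitely many
arrays, all holding natural numbers, and finitely many (possibly recursive) procedures.  The only
arithmetic operations are increment and decrement, so that in `t` steps no number can exceed the
largest number of the input and of the program text by more than `t`.  Every instruction, every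
test and every procedure call costs one unit of time. -/
namespace Ram

/-- Comparison of two registers. -/
inductive Test where
  | eq (x y : ℕ)
  | ne (x y : ℕ)
  | lt (x y : ℕ)

/-- Commands; `x`, `y` are register names, `a` is an array name, `p` is a procedure name. -/
inductive Cmd where
  /-- do nothing -/
  | skip
  /-- `x := n` -/
  | const (x n : ℕ)
  /-- `x := y` -/
  | copy (x y : ℕ)
  /-- `x := x + 1` -/
  | inc (x : ℕ)
  /-- `x := x - 1` (and `0` stays `0`) -/
  | dec (x : ℕ)
  /-- `x := a[y]` -/
  | load (x a y : ℕ)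
  /-- `a[x] := y` -/
  | store (a x y : ℕ)
  /-- sequential composition -/
  | seq (c₁ c₂ : Cmd)
  /-- `if b then c₁ else c₂` -/
  | ite (b : Test) (c₁ c₂ : Cmd)
  /-- `while b do c` -/
  | loop (b : Test) (c : Cmd)
  /-- call of the procedure number `p` -/
  | call (p : ℕ)

/-- A program: a finite list of procedure bodies and a main command. -/
structure Program where
  procs : List Cmd
  main : Cmd

/-- A machine state: the contents of the registers and of the arrays. -/
structure State where
  reg : ℕ → ℕ
  mem : ℕ → ℕ → ℕ

/-- Assign the value `v` to the register `x`. -/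
def State.setReg (σ : State) (x v : ℕ) : State :=
  ⟨Function.update σ.reg x v, σ.mem⟩

/-- Assign the value `v` to the cell `j` of the array `a`. -/
def State.setMem (σ : State) (a j v : ℕ) : State :=
  ⟨σ.reg, Function.update σ.mem a (Function.update (σ.mem a) j v)⟩

/-- The test `b` succeeds in the state `σ`. -/
def Test.Holds (σ : State) : Test → Prop
  | .eq x y => σ.reg x = σ.reg y
  | .ne x y => σ.reg x ≠ σ.reg y
  | .lt x y => σ.reg x < σ.reg y

/-- `Exec procs c σ σ' t`: the command `c`, started in the state `σ`, terminates in the state `σ'`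
after exactly `t` steps.  A called procedure works on its own copy of the registers, which is
discarded on return (a constant amount of work, as a program mentions only finitely many
registers); its results are passed back through the arrays, which are global. -/
inductive Exec (procs : List Cmd) : Cmd → State → State → ℕ → Prop
  | skip (σ : State) : Exec procs .skip σ σ 1
  | const (σ : State) (x n : ℕ) : Exec procs (.const x n) σ (σ.setReg x n) 1
  | copy (σ : State) (x y : ℕ) : Exec procs (.copy x y) σ (σ.setReg x (σ.reg y)) 1
  | inc (σ : State) (x : ℕ) : Exec procs (.inc x) σ (σ.setReg x (σ.reg x + 1)) 1
  | dec (σ : State) (x : ℕ) : Exec procs (.dec x) σ (σ.setReg x (σ.reg x - 1)) 1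
  | load (σ : State) (x a y : ℕ) :
      Exec procs (.load x a y) σ (σ.setReg x (σ.mem a (σ.reg y))) 1
  | store (σ : State) (a x y : ℕ) :
      Exec procs (.store a x y) σ (σ.setMem a (σ.reg x) (σ.reg y)) 1
  | seq {c₁ c₂ : Cmd} {σ σ' σ'' : State} {t t' : ℕ} :
      Exec procs c₁ σ σ' t → Exec procs c₂ σ' σ'' t' → Exec procs (.seq c₁ c₂) σ σ'' (t + t')
  | iteTrue {b : Test} {c₁ c₂ : Cmd} {σ σ' : State} {t : ℕ} :
      b.Holds σ → Exec procs c₁ σ σ' t → Exec procs (.ite b c₁ c₂) σ σ' (t + 1)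
  | iteFalse {b : Test} {c₁ c₂ : Cmd} {σ σ' : State} {t : ℕ} :
      ¬ b.Holds σ → Exec procs c₂ σ σ' t → Exec procs (.ite b c₁ c₂) σ σ' (t + 1)
  | loopTrue {b : Test} {c : Cmd} {σ σ' σ'' : State} {t t' : ℕ} :
      b.Holds σ → Exec procs c σ σ' t → Exec procs (.loop b c) σ' σ'' t' →
      Exec procs (.loop b c) σ σ'' (t + t' + 1)
  | loopFalse {b : Test} {c : Cmd} {σ : State} :
      ¬ b.Holds σ → Exec procs (.loop b c) σ σ 1
  | call {p : ℕ} {c : Cmd} {σ σ' : State} {t : ℕ} :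
      procs[p]? = some c → Exec procs c σ σ' t → Exec procs (.call p) σ ⟨σ.reg, σ'.mem⟩ (t + 1)

/-- An array holding the list `l`: its length in the cell `0`, then its entries, then zeros. -/
def listArray (l : List ℕ) : ℕ → ℕ := fun j => (l.length :: l).getD j 0

/-- The initial state: the array `0` holds the input, everything else is `0`. -/
def initState (inp : List ℕ) : State :=
  ⟨fun _ => 0, fun a => if a = 0 then listArray inp else fun _ => 0⟩

/-- `P.Computes inp out t`: on the input `inp` the program `P` halts after exactly `t` steps, and
then the array `1` begins with the length of the list `out`, followed by its entries. -/
def Program.Computes (P : Program) (inp out : List ℕ) (t : ℕ) : Prop :=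
  ∃ σ : State, Exec P.procs P.main (initState inp) σ t ∧
    ∀ j ≤ out.length, σ.mem 1 j = listArray out j

end Ram

/-! ### Incidence graphs -/

/-- The incidence graph of a CNF formula: variables and clauses are numbered, and every clause is
given by the list of its literals, where `(x, true)` is the positive and `(x, false)` the negative
literal of `x`.  No clause contains a variable twice, in particular none contains a complementary
pair.  Every variable occurs in some clause.  (Several clauses may have the same literals, as
happens in the induced subgraphs that arise from partial assignments.) -/
structure IncGraph where
  numVar : ℕ
  numCla : ℕ
  clause : Fin numCla → List (Fin numVar × Bool)
  nodup : ∀ c, ((clause c).map Prod.fst).Nodup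
  occurs : ∀ x, ∃ c s, (x, s) ∈ clause c

namespace IncGraph

variable (G : IncGraph)

/-- The vertices: variables (left) and clauses (right). -/
abbrev Vertex : Type := Fin G.numVar ⊕ Fin G.numCla

/-- The size `|G|`: the number of vertices. -/
def size : ℕ := G.numVar + G.numCla

/-- `x` and `c` are joined by a positive (`s = true`) or negative (`s = false`) edge. -/
def Edge (s : Bool) (x : Fin G.numVar) (c : Fin G.numCla) : Prop := (x, s) ∈ G.clause c

/-- The underlying bipartite graph, without polarities. -/
def graph : SimpleGraph G.Vertex where
  Adj u v := match u, v with
    | .inl x, .inr c => ∃ s, G.Edge s x c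
    | .inr c, .inl x => ∃ s, G.Edge s x c
    | _, _ => False
  symm := ⟨by rintro (x | c) (y | e) h <;> exact h⟩
  loopless := ⟨by rintro (x | c) h <;> exact h⟩

/-! All subgraphs below are induced subgraphs `G[S]`, given by their vertex sets `S`. -/

/-- The width of the clause `c` in `G[S]`. -/
noncomputable def width (S : Set G.Vertex) (c : Fin G.numCla) : ℕ :=
  {x : Fin G.numVar | Sum.inl x ∈ S ∧ ∃ s, G.Edge s x c}.ncard

/-- `G[S]` belongs to the class `𝒞_d`: all its clauses have width at most `d`.  (So `𝒞_0` is the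
class of edgeless graphs and `𝒞_{-1}` is the class of graphs without clauses.) -/
def InClass (d : ℤ) (S : Set G.Vertex) : Prop :=
  ∀ c, Sum.inr c ∈ S → (G.width S c : ℤ) ≤ d

/-- The vertex set of `H[x ↦ s]` for `H = G[S]`: the clauses satisfied by the literal `(x, s)` are
removed, the variable `x` is removed, and the variables of the new formula are those that occur in
one of the remaining clauses. -/
def assign (S : Set G.Vertex) (x : Fin G.numVar) (s : Bool) : Set G.Vertex :=
  {v | v ∈ S ∧ match v with
    | .inl y => y ≠ x ∧ ∃ c t, Sum.inr c ∈ S ∧ ¬ G.Edge s x c ∧ G.Edge t y c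
    | .inr c => ¬ G.Edge s x c}

/-- `K` is the vertex set of a connected component of `G[S]`. -/
def IsComponent (S K : Set G.Vertex) : Prop :=
  ∃ C : (G.graph.induce S).ConnectedComponent, K = Subtype.val '' C.supp

/-! ### Strong recursive backdoors -/

/-- The labeled trees used for strong recursive backdoors.  Component nodes are labeled with an
induced subgraph, given by the list of its vertices.  `branch W x t₊ t₋` is a component node with
its only child, a variable node labeled `x`, which has the children `t₊` and `t₋`. -/
inductive BTree where
  | leaf (W : List G.Vertex)
  | branch (W : List G.Vertex) (x : Fin G.numVar) (pos neg : BTree)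
  | split (W : List G.Vertex) (children : List BTree)

variable {G}

/-- The list of vertices labeling the root. -/
def BTree.label : G.BTree → List G.Vertex
  | .leaf W => W
  | .branch W _ _ _ => W
  | .split W _ => W

/-- The vertex set of the graph labeling the root. -/
def BTree.labelSet (t : G.BTree) : Set G.Vertex := {v | v ∈ t.label}

mutual
/-- The maximal number of variable nodes on a path from the root to a leaf. -/
def BTree.depth : G.BTree → ℕ
  | .leaf _ => 0
  | .branch _ _ pos neg => 1 + max pos.depth neg.depth
  | .split _ children => BTree.depthList children
/-- The maximal depth in a list of trees. -/
def BTree.depthList : List G.BTree → ℕ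
  | [] => 0
  | t :: ts => max t.depth (BTree.depthList ts)
end

variable (G)

/-- `t` is a strong recursive backdoor, to the class `𝒞`, of the graph that labels its root. -/
inductive IsBackdoor (𝒞 : Set G.Vertex → Prop) : G.BTree → Prop
  | leaf (W : List G.Vertex) : W.Nodup → 𝒞 {v | v ∈ W} → IsBackdoor 𝒞 (.leaf W)
  | branch (W : List G.Vertex) (x : Fin G.numVar) (pos neg : G.BTree) :
      W.Nodup → (G.graph.induce {v | v ∈ W}).Connected → Sum.inl x ∈ W →
      pos.labelSet = G.assign {v | v ∈ W} x true → neg.labelSet = G.assign {v | v ∈ W} x false →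
      IsBackdoor 𝒞 pos → IsBackdoor 𝒞 neg → IsBackdoor 𝒞 (.branch W x pos neg)
  | split (W : List G.Vertex) (children : List G.BTree) :
      W.Nodup → ¬ (G.graph.induce {v | v ∈ W}).Preconnected →
      (children.map BTree.labelSet).Nodup →
      (∀ K, K ∈ children.map BTree.labelSet ↔ G.IsComponent {v | v ∈ W} K) →
      (∀ t ∈ children, IsBackdoor 𝒞 t) → IsBackdoor 𝒞 (.split W children)

/-- `B` is a strong recursive backdoor of `G` to the class `𝒞`. -/
def IsBackdoorOf (𝒞 : Set G.Vertex → Prop) (B : G.BTree) : Prop :=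
  B.labelSet = Set.univ ∧ G.IsBackdoor 𝒞 B

/-- The strong recursive backdoor depth of `G` to the class `𝒞`: the minimal depth of a strong
recursive backdoor (`⊤` if there is none). -/
noncomputable def srbd (𝒞 : Set G.Vertex → Prop) : ℕ∞ :=
  ⨅ (B : G.BTree) (_ : G.IsBackdoorOf 𝒞 B), (B.depth : ℕ∞)

/-! ### Obstruction-trees -/

/-- The objects from which obstruction-trees are selected: `base c` stands for the set consisting
of the clause `c` and its variables, `join T₁ p T₂` for the triple `(T₁, p, T₂)`. -/
inductive OTree where
  | base (c : Fin G.numCla)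
  | join (T₁ : OTree) {u v : G.Vertex} (p : G.graph.Walk u v) (T₂ : OTree)

variable {G}

/-- The set `V(T)` of elements of `T`. -/
def OTree.elements : G.OTree → Set G.Vertex
  | .base c => {Sum.inr c} ∪ Sum.inl '' {x | ∃ s, G.Edge s x c}
  | .join T₁ p T₂ => T₁.elements ∪ {w | w ∈ p.support} ∪ T₂.elements

/-- The destroy-neighborhood of `T` in `G`. -/
def OTree.destroyNbhd : G.OTree → Set (Fin G.numVar)
  | .base c => {x | Sum.inl x ∈ (OTree.base c).elements}
  | .join T₁ p T₂ =>
      {x | Sum.inl x ∈ (OTree.join T₁ p T₂).elements} ∪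
      {x | ∃ c₁ c₂, Sum.inr c₁ ∈ (OTree.join T₁ p T₂).elements ∧
        Sum.inr c₂ ∈ (OTree.join T₁ p T₂).elements ∧ G.Edge true x c₁ ∧ G.Edge false x c₂}

variable (G)

/-- `G.IsObstructionTree d k i T`: `T` is an `(i, d, k)`-obstruction-tree of `G`. -/
inductive IsObstructionTree (d k : ℕ) : ℕ → G.OTree → Prop
  | base (c : Fin G.numCla) : G.width Set.univ c = d → IsObstructionTree d k d (.base c)
  | join {i : ℕ} {T₁ T₂ : G.OTree} {u v : G.Vertex} (p : G.graph.Walk u v) :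
      IsObstructionTree d k i T₁ → IsObstructionTree d k i T₂ →
      Disjoint T₁.destroyNbhd T₂.destroyNbhd →
      u ∈ T₁.elements → v ∈ T₂.elements → p.IsPath → p.length ≤ 4 * 2 ^ k →
      IsObstructionTree d k (i + 1) (.join T₁ p T₂)

/-! ### Input and output format -/

/-- A clause as a list of numbers: its width, then the variable and the sign of each literal. -/
def clauseCode (c : Fin G.numCla) : List ℕ :=
  (G.clause c).length :: (G.clause c).flatMap fun l => [(l.1 : ℕ), if l.2 then 1 else 0]

/-- `G` as a list of numbers: the numbers of variables and of clauses, then all clauses. -/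
def code : List ℕ :=
  G.numVar :: G.numCla :: (List.ofFn G.clauseCode).flatten

variable {G}

/-- A list of vertices as a list of numbers: its length, then kind and number of each vertex. -/
def vertexListCode (W : List G.Vertex) : List ℕ :=
  W.length :: W.flatMap fun
    | .inl x => [0, (x : ℕ)]
    | .inr c => [1, (c : ℕ)]

mutual
/-- A tree as a list of numbers, in preorder, with all labels. -/
def BTree.code : G.BTree → List ℕ
  | .leaf W => 0 :: vertexListCode W
  | .branch W x pos neg => 1 :: (vertexListCode W ++ (x : ℕ) :: (pos.code ++ neg.code))
  | .split W children =>
      2 :: (vertexListCode W ++ children.length :: BTree.codeList children)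
/-- The concatenated codes of a list of trees. -/
def BTree.codeList : List G.BTree → List ℕ
  | [] => []
  | t :: ts => t.code ++ BTree.codeList ts
end

/-- An obstruction-tree as a list of numbers, in preorder. -/
def OTree.code : G.OTree → List ℕ
  | .base c => [0, (c : ℕ)]
  | .join T₁ p T₂ => 1 :: (T₁.code ++ vertexListCode p.support ++ T₂.code)

variable (G)

/-- `out` is a correct answer for the parameters `i, d, k` and the graph `G`: a first number that
selects the alternative, followed by the obstruction-tree or the backdoor. -/
def IsAnswer (i d k : ℕ) (out : List ℕ) : Prop :=
  (∃ T : G.OTree, G.IsObstructionTree d k i T ∧ out = 0 :: T.code) ∨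
  (∃ B : G.BTree, G.IsBackdoorOf (G.InClass ((d : ℤ) - 1)) B ∧
    B.depth ≤ 3 ^ (i - d) * (4 * 2 ^ k) * d ∧ out = 1 :: B.code) ∨
  ((k : ℕ∞) < G.srbd (G.InClass 0) ∧ out = [2])

end IncGraph

-- The algorithm works on residual graphs `G.vset L A`, given by a list `L` of clauses and a set `A`
-- of assigned variables. The notion that carries the argument is that of a reduced vertex set
-- (`Red`): each of its variables occurs in one of its clauses, and each variable outside of it
-- occurs in its clauses with at most one sign. Partial assignments and passing to components
-- preserve this, because assigning a literal deletes all clauses that contain it.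
--
-- Level `j` turns a residual graph into a `(d + j, d, k)`-obstruction-tree inside a reduced subset,
-- a backdoor to `𝒞_{d-1}`, or a failure. On level `0`, a clause with `d` unassigned literals is a
-- tree, and a graph without such a clause is a leaf. On level `j + 1`, a connected graph is first
-- given to level `j`. If a tree `T₁` comes back, the unassigned variables `X` of its clauses are
-- collected, and level `j` runs once more, now branching over `X` and splitting into components in
-- between. If all branches return backdoors, these combine to one of depth at most `|X| + 3^j * λ *
-- d`, and `|X| ≤ 2 * (3^j * λ * d)` (`length_vars_le`) makes this at most `3^(j+1) * λ * d`. The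
-- first other result ends the search. If it is a tree `T₂`, it lies in a reduced set `S₂` that
-- contains no variable of `X`. A variable in both destroy-neighborhoods would occur in a clause of
-- `T₁`, hence lie outside of `S₂`; then it is not an element of `T₂` and, as `S₂` is reduced, does
-- not occur with both signs in the clauses of `T₂`. So the destroy-neighborhoods are disjoint, and
-- a shortest path in the connected graph joins the trees (`TreeData.join`, `join_spec`, `up_spec`).
--
-- Failure is justified by `near_of_backdoor`: if a backdoor of depth `k` to the edgeless graphs
-- exists, all components of all reduced sets have diameter at most `4 * (2^k - 1)`. Both graph
-- searches, the computation of components by propagating labels (`comps_spec`) and the breadth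
-- first search (`bfs_spec`), therefore run for only `λ = 4 * 2^k` rounds, each linear in the
-- current graph. If that is not enough, some component is too wide and `srbd` exceeds `k`
-- (`lt_srbd_of_not_smallDiam`).
--
-- For the running time, trees have size at most `M`, which is `2^O(k)`. Every step of the recursion
-- decreases a measure that starts at `j * (M + 2)`, and it multiplies the cost by at most `8` while
-- remaining linear in the number of clauses, since the clauses of the components add up to those of
-- the graph (`conn_spec`). This gives `C * 8^f` with `C` and `f` in `2^O(k)`, which is doubly
-- exponential (`cost_bound`).
--
-- Programs are verified by weakest preconditions that assert termination and expose the exact step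
-- count; frame conditions (`Same`, `Grow`, `Ext`) record which arrays change and how the stacks
-- grow.

namespace Ram

/-! ### Weakest preconditions with step counts -/

/-- The contents of the arrays. -/
abbrev Mem := ℕ → ℕ → ℕ

/-- The command `c` started in `σ` halts in a state and after a number of steps that satisfy `Q`. -/
def WP (procs : List Cmd) (c : Cmd) (σ : State) (Q : State → ℕ → Prop) : Prop :=
  ∃ σ' t, Exec procs c σ σ' t ∧ Q σ' t

/-- The procedure `p` called with registers `r` and memory `m` halts with a memory and after a
number of steps that satisfy `Q`. -/
def Proc (procs : List Cmd) (p : ℕ) (r : ℕ → ℕ) (m : Mem) (Q : Mem → ℕ → Prop) : Prop :=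
  WP procs (.call p) ⟨r, m⟩ (fun σ' t => Q σ'.mem t)

variable {procs : List Cmd}

theorem WP.mono {c : Cmd} {σ : State} {Q Q' : State → ℕ → Prop} (h : WP procs c σ Q)
    (hQ : ∀ σ' t, Q σ' t → Q' σ' t) : WP procs c σ Q' := by
  obtain ⟨σ', t, h, hq⟩ := h
  exact ⟨σ', t, h, hQ _ _ hq⟩

theorem Proc.mono {p : ℕ} {r : ℕ → ℕ} {m : Mem} {Q Q' : Mem → ℕ → Prop} (h : Proc procs p r m Q)
    (hQ : ∀ m' t, Q m' t → Q' m' t) : Proc procs p r m Q' :=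
  WP.mono h fun _ _ => hQ _ _

@[simp] theorem setReg_mk (r : ℕ → ℕ) (m : Mem) (x v : ℕ) :
    (State.mk r m).setReg x v = ⟨Function.update r x v, m⟩ := rfl

/-- Assign the value `v` to the cell `j` of the array `a`. -/
def setCell (m : Mem) (a j v : ℕ) : Mem := Function.update m a (Function.update (m a) j v)

@[simp] theorem setMem_mk (r : ℕ → ℕ) (m : Mem) (a j v : ℕ) :
    (State.mk r m).setMem a j v = ⟨r, setCell m a j v⟩ := rfl

theorem setCell_self (m : Mem) (a j v : ℕ) : setCell m a j v a j = v := by simp [setCell]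

theorem setCell_apply (m : Mem) (a j v i : ℕ) :
    setCell m a j v a i = if i = j then v else m a i := by
  simp [setCell, Function.update_apply]

@[simp] theorem setCell_array (m : Mem) (a j v : ℕ) :
    setCell m a j v a = Function.update (m a) j v := by
  simp [setCell]

@[simp] theorem setCell_ne (m : Mem) {a b : ℕ} (h : b ≠ a) (j v : ℕ) :
    setCell m a j v b = m b := by simp [setCell, h]

@[simp] theorem wp_skip (σ : State) (Q) : WP procs .skip σ Q ↔ Q σ 1 :=
  ⟨fun ⟨_, _, h, hq⟩ => by cases h; exact hq, fun h => ⟨_, _, .skip σ, h⟩⟩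

@[simp] theorem wp_const (σ : State) (x n : ℕ) (Q) :
    WP procs (.const x n) σ Q ↔ Q (σ.setReg x n) 1 :=
  ⟨fun ⟨_, _, h, hq⟩ => by cases h; exact hq, fun h => ⟨_, _, .const σ x n, h⟩⟩

@[simp] theorem wp_copy (σ : State) (x y : ℕ) (Q) :
    WP procs (.copy x y) σ Q ↔ Q (σ.setReg x (σ.reg y)) 1 :=
  ⟨fun ⟨_, _, h, hq⟩ => by cases h; exact hq, fun h => ⟨_, _, .copy σ x y, h⟩⟩

@[simp] theorem wp_inc (σ : State) (x : ℕ) (Q) :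
    WP procs (.inc x) σ Q ↔ Q (σ.setReg x (σ.reg x + 1)) 1 :=
  ⟨fun ⟨_, _, h, hq⟩ => by cases h; exact hq, fun h => ⟨_, _, .inc σ x, h⟩⟩

@[simp] theorem wp_dec (σ : State) (x : ℕ) (Q) :
    WP procs (.dec x) σ Q ↔ Q (σ.setReg x (σ.reg x - 1)) 1 :=
  ⟨fun ⟨_, _, h, hq⟩ => by cases h; exact hq, fun h => ⟨_, _, .dec σ x, h⟩⟩

@[simp] theorem wp_load (σ : State) (x a y : ℕ) (Q) :
    WP procs (.load x a y) σ Q ↔ Q (σ.setReg x (σ.mem a (σ.reg y))) 1 :=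
  ⟨fun ⟨_, _, h, hq⟩ => by cases h; exact hq, fun h => ⟨_, _, .load σ x a y, h⟩⟩

@[simp] theorem wp_store (σ : State) (a x y : ℕ) (Q) :
    WP procs (.store a x y) σ Q ↔ Q (σ.setMem a (σ.reg x) (σ.reg y)) 1 :=
  ⟨fun ⟨_, _, h, hq⟩ => by cases h; exact hq, fun h => ⟨_, _, .store σ a x y, h⟩⟩

@[simp] theorem wp_seq (σ : State) (c₁ c₂ : Cmd) (Q) :
    WP procs (.seq c₁ c₂) σ Q ↔
      WP procs c₁ σ (fun σ' t => WP procs c₂ σ' (fun σ'' t' => Q σ'' (t + t'))) := by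
  constructor
  · rintro ⟨_, _, h, hq⟩
    cases h with
    | seq h₁ h₂ => exact ⟨_, _, h₁, _, _, h₂, hq⟩
  · rintro ⟨_, _, h₁, _, _, h₂, hq⟩
    exact ⟨_, _, h₁.seq h₂, hq⟩

theorem wp_ite (σ : State) (b : Test) (c₁ c₂ : Cmd) (Q) :
    WP procs (.ite b c₁ c₂) σ Q ↔
      (b.Holds σ → WP procs c₁ σ (fun σ' t => Q σ' (t + 1))) ∧
      (¬ b.Holds σ → WP procs c₂ σ (fun σ' t => Q σ' (t + 1))) := by
  constructor
  · rintro ⟨_, _, h, hq⟩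
    cases h with
    | iteTrue hb h => exact ⟨fun _ => ⟨_, _, h, hq⟩, fun hn => absurd hb hn⟩
    | iteFalse hb h => exact ⟨fun hn => absurd hn hb, fun _ => ⟨_, _, h, hq⟩⟩
  · rintro ⟨h₁, h₂⟩
    by_cases hb : b.Holds σ
    · obtain ⟨_, _, h, hq⟩ := h₁ hb
      exact ⟨_, _, .iteTrue hb h, hq⟩
    · obtain ⟨_, _, h, hq⟩ := h₂ hb
      exact ⟨_, _, .iteFalse hb h, hq⟩

@[simp] theorem holds_eq (σ : State) (x y : ℕ) : (Test.eq x y).Holds σ ↔ σ.reg x = σ.reg y := Iff.rfl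
@[simp] theorem holds_ne (σ : State) (x y : ℕ) : (Test.ne x y).Holds σ ↔ σ.reg x ≠ σ.reg y := Iff.rfl
@[simp] theorem holds_lt (σ : State) (x y : ℕ) : (Test.lt x y).Holds σ ↔ σ.reg x < σ.reg y := Iff.rfl

theorem wp_call {p : ℕ} {c : Cmd} (hp : procs[p]? = some c) (σ : State) (Q) :
    WP procs (.call p) σ Q ↔ WP procs c σ (fun σ' t => Q ⟨σ.reg, σ'.mem⟩ (t + 1)) := by
  constructor
  · rintro ⟨_, _, h, hq⟩
    cases h with
    | call hc h =>
      rw [hp] at hc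
      cases hc
      exact ⟨_, _, h, hq⟩
  · rintro ⟨_, _, h, hq⟩
    exact ⟨_, _, .call hp h, hq⟩

theorem Proc.intro {p : ℕ} {c : Cmd} (hp : procs[p]? = some c) {r : ℕ → ℕ} {m : Mem}
    {Q : Mem → ℕ → Prop} (h : WP procs c ⟨r, m⟩ (fun σ' t => Q σ'.mem (t + 1))) :
    Proc procs p r m Q :=
  (wp_call hp _ _).2 h

/-- A call restores the caller's registers, so a specification of a procedure needs to mention
memory and time only. -/
theorem Proc.wp {p : ℕ} {r : ℕ → ℕ} {m : Mem} {Q' : Mem → ℕ → Prop}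
    (h : Proc procs p r m Q') {Q : State → ℕ → Prop} (hQ : ∀ m' t, Q' m' t → Q ⟨r, m'⟩ t) :
    WP procs (.call p) ⟨r, m⟩ Q := by
  obtain ⟨σ', t, h, hq⟩ := h
  cases h with
  | call hc h => exact ⟨_, _, .call hc h, hQ _ _ hq⟩

/-- Hide the postcondition during symbolic execution. -/
theorem WP.hide {c : Cmd} {σ : State} {Q₀ : State → ℕ → Prop}
    (H : ∀ Q : State → ℕ → Prop, (∀ σ' t, Q₀ σ' t → Q σ' t) → WP procs c σ Q) :
    WP procs c σ Q₀ := H Q₀ fun _ _ h => h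

/-- With an opaque postcondition `Q`, `simp` can execute the body symbolically without rewriting the
specification itself. -/
theorem Proc.hide {p : ℕ} {c : Cmd} (hp : procs[p]? = some c) {r : ℕ → ℕ} {m : Mem}
    {Q₀ : Mem → ℕ → Prop} (H : ∀ Q : Mem → ℕ → Prop, (∀ m' t, Q₀ m' t → Q m' t) →
      WP procs c ⟨r, m⟩ (fun σ' t => Q σ'.mem (t + 1))) :
    Proc procs p r m Q₀ := .intro hp (H Q₀ fun _ _ h => h)

/-- The rule for a loop with `N` rounds. -/
theorem wp_loop {b : Test} {body : Cmd} {σ : State} {Q : State → ℕ → Prop}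
    (I : ℕ → State → ℕ → Prop) (N : ℕ) (h0 : I 0 σ 0)
    (step : ∀ i < N, ∀ σ t, I i σ t →
      b.Holds σ ∧ WP procs body σ (fun σ' t' => I (i + 1) σ' (t + t' + 1)))
    (final : ∀ σ t, I N σ t → ¬ b.Holds σ ∧ Q σ (t + 1)) :
    WP procs (.loop b body) σ Q := by
  -- Induction on the number `n` of remaining rounds, with the time `t` already spent as a
  -- parameter.
  suffices H : ∀ n i σ t, i + n = N → I i σ t →
      WP procs (.loop b body) σ (fun σ' t' => Q σ' (t + t')) by
    simpa using H N 0 σ 0 (by omega) h0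
  intro n
  induction n with
  | zero =>
    intro i σ t hi hI
    obtain rfl : i = N := by omega
    obtain ⟨hb, hq⟩ := final _ _ hI
    exact ⟨_, _, .loopFalse hb, hq⟩
  | succ n ih =>
    intro i σ t hi hI
    obtain ⟨hb, σ', t', hex, hI'⟩ := step i (by omega) σ t hI
    obtain ⟨σ'', t'', hex', hq⟩ := ih (i + 1) σ' _ (by omega) hI'
    refine ⟨_, _, .loopTrue hb hex hex', ?_⟩
    show Q σ'' (t + (t' + t'' + 1))
    rwa [show t + (t' + t'' + 1) = t + t' + 1 + t'' by ring]

/-! ### Lists in arrays -/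

/-- The cells of `f` from `s` on hold the entries of the list. -/
def Seg (f : ℕ → ℕ) : ℕ → List ℕ → Prop
  | _, [] => True
  | s, a :: l => f s = a ∧ Seg f (s + 1) l

@[simp] theorem seg_nil (f : ℕ → ℕ) (s : ℕ) : Seg f s [] ↔ True := Iff.rfl
@[simp] theorem seg_cons (f : ℕ → ℕ) (s a : ℕ) (l : List ℕ) :
    Seg f s (a :: l) ↔ f s = a ∧ Seg f (s + 1) l := Iff.rfl

theorem seg_append {f : ℕ → ℕ} {s : ℕ} {l₁ l₂ : List ℕ} :
    Seg f s (l₁ ++ l₂) ↔ Seg f s l₁ ∧ Seg f (s + l₁.length) l₂ := by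
  induction l₁ generalizing s with
  | nil => simp
  | cons a l ih =>
    simp only [List.cons_append, seg_cons, ih, List.length_cons, and_assoc]
    rw [show s + 1 + l.length = s + (l.length + 1) by ring]

theorem Seg.congr {f g : ℕ → ℕ} {s : ℕ} {l : List ℕ} (h : Seg f s l)
    (hfg : ∀ j, s ≤ j → j < s + l.length → g j = f j) : Seg g s l := by
  induction l generalizing s with
  | nil => trivial
  | cons a l ih =>
    rw [List.length_cons] at hfg
    exact ⟨(hfg s le_rfl (by omega)).trans h.1, ih h.2 fun j h1 h2 => hfg j (by omega) (by omega)⟩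

theorem Seg.get {f : ℕ → ℕ} {s : ℕ} {pre post : List ℕ} {a : ℕ} (h : Seg f s (pre ++ a :: post)) :
    f (s + pre.length) = a := (seg_append.1 h).2.1

theorem seg_iff_getD {f : ℕ → ℕ} {s : ℕ} {l : List ℕ} :
    Seg f s l ↔ ∀ j < l.length, f (s + j) = l.getD j 0 := by
  induction l generalizing s with
  | nil => simp
  | cons a l ih =>
    simp only [seg_cons, ih, List.length_cons]
    constructor
    · rintro ⟨h0, h⟩ (_ | j) hj
      · simpa using h0
      · simpa [add_assoc, add_comm 1] using h j (by omega)
    · intro h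
      refine ⟨by simpa using h 0 (by omega), fun j hj => ?_⟩
      simpa [add_assoc, add_comm 1] using h (j + 1) (by omega)

theorem seg_listArray (l : List ℕ) : Seg (listArray l) 0 (l.length :: l) :=
  seg_iff_getD.2 fun j _ => by simp [listArray]

/-- `m'` arises from `m` by appending `l` to the stack in array `b` with stack pointer in the cell
`0` of the array `p`. -/
structure Ext (b p : ℕ) (m m' : Mem) (l : List ℕ) : Prop where
  top : m' p 0 = m p 0 + l.length
  seg : Seg (m' b) (m p 0) l
  old : ∀ j < m p 0, m' b j = m b j

/-- The stack in array `b` with stack pointer in array `p` has not shrunk and old entries are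
unchanged. -/
structure Grow (b p : ℕ) (m m' : Mem) : Prop where
  top : m p 0 ≤ m' p 0
  old : ∀ j < m p 0, m' b j = m b j

theorem Ext.grow {b p : ℕ} {m m' : Mem} {l : List ℕ} (h : Ext b p m m' l) : Grow b p m m' :=
  ⟨by rw [h.top]; omega, h.old⟩

theorem Grow.trans {b p : ℕ} {m m' m'' : Mem} (h : Grow b p m m') (h' : Grow b p m' m'') :
    Grow b p m m'' :=
  ⟨h.top.trans h'.top, fun j hj => (h'.old j (hj.trans_le h.top)).trans (h.old j hj)⟩

theorem Grow.of_eq {b p : ℕ} {m m' : Mem} (hb : m' b = m b) (hp : m' p = m p) : Grow b p m m' :=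
  ⟨by rw [hp], fun _ _ => by rw [hb]⟩

theorem Grow.seg {b p : ℕ} {m m' : Mem} (h : Grow b p m m') {s : ℕ} {l : List ℕ}
    (hs : Seg (m b) s l) (hl : s + l.length ≤ m p 0) : Seg (m' b) s l :=
  hs.congr fun j _ h2 => h.old j (by omega)

theorem Ext.of_eq {b p : ℕ} {m m' : Mem} (hb : m' b = m b) (hp : m' p = m p) : Ext b p m m' [] :=
  ⟨by simp [hp], trivial, fun _ _ => by rw [hb]⟩

theorem Ext.trans {b p : ℕ} {m m' m'' : Mem} {l l' : List ℕ} (h : Ext b p m m' l)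
    (h' : Ext b p m' m'' l') : Ext b p m m'' (l ++ l') := by
  refine ⟨by rw [h'.top, h.top, List.length_append]; ring, ?_, (h.grow.trans h'.grow).old⟩
  rw [seg_append]
  exact ⟨h'.grow.seg h.seg (by rw [h.top]), by simpa [h.top] using h'.seg⟩

/-- Only the arrays in the list `s` have changed. -/
def Same (s : List ℕ) (m m' : Mem) : Prop := ∀ a ∉ s, m' a = m a

theorem Same.trans {s : List ℕ} {m m' m'' : Mem} (h : Same s m m') (h' : Same s m' m'') :
    Same s m m'' := fun a ha => (h' a ha).trans (h a ha)

theorem Same.refl (s : List ℕ) (m : Mem) : Same s m m := fun _ _ => rfl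

theorem Same.mono {s s' : List ℕ} {m m' : Mem} (h : Same s m m') (hs : s ⊆ s') : Same s' m m' :=
  fun a ha => h a fun h' => ha (hs h')

theorem same_setCell {s : List ℕ} (m : Mem) {a : ℕ} (ha : a ∈ s) (j v : ℕ) :
    Same s m (setCell m a j v) := fun b hb => setCell_ne _ (by rintro rfl; exact hb ha) _ _

/-- Append an entry to a stack. -/
def pushMem (b p : ℕ) (m : Mem) (v : ℕ) : Mem := setCell (setCell m b (m p 0) v) p 0 (m p 0 + 1)

theorem ext_pushMem {b p : ℕ} (hbp : b ≠ p) (m : Mem) (v : ℕ) : Ext b p m (pushMem b p m v) [v] := by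
  have : p ≠ b := hbp.symm
  refine ⟨by simp [pushMem], by simp [pushMem, hbp], fun j hj => ?_⟩
  simp [pushMem, hbp, hj.ne]

theorem pushMem_ne {b p a : ℕ} (h : a ≠ b) (h' : a ≠ p) (m : Mem) (v : ℕ) :
    pushMem b p m v a = m a := by simp [pushMem, h, h']

theorem same_pushMem {s : List ℕ} {b p : ℕ} (hb : b ∈ s) (hp : p ∈ s) (m : Mem) (v : ℕ) :
    Same s m (pushMem b p m v) := (same_setCell m hb _ _).trans (same_setCell _ hp _ _)

/-- The command that appends the contents of the register `y` to a stack, with the help of the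
register `30`. -/
def pushCmd (b p y : ℕ) : Cmd :=
  .seq (.load 30 p 0) (.seq (.store b 30 y) (.seq (.inc 30) (.store p 0 30)))

theorem wp_pushCmd {b p y : ℕ} (hbp : b ≠ p) (hy : y ≠ 30) {r : ℕ → ℕ} (h0 : r 0 = 0) (m : Mem)
    (Q : State → ℕ → Prop) :
    WP procs (pushCmd b p y) ⟨r, m⟩ Q ↔
      Q ⟨Function.update r 30 (m p 0 + 1), pushMem b p m (r y)⟩ 4 := by
  have : p ≠ b := hbp.symm
  simp [pushCmd, h0, hy, pushMem]

@[simp] theorem wp_pushHeap {y : ℕ} (hy : y ≠ 30) {r : ℕ → ℕ} (h0 : r 0 = 0) (m : Mem)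
    (Q : State → ℕ → Prop) :
    WP procs (pushCmd 2 3 y) ⟨r, m⟩ Q ↔
      Q ⟨Function.update r 30 (m 3 0 + 1), pushMem 2 3 m (r y)⟩ 4 :=
  wp_pushCmd (by simp) hy h0 m Q

@[simp] theorem wp_pushOut {y : ℕ} (hy : y ≠ 30) {r : ℕ → ℕ} (h0 : r 0 = 0) (m : Mem)
    (Q : State → ℕ → Prop) :
    WP procs (pushCmd 1 14 y) ⟨r, m⟩ Q ↔
      Q ⟨Function.update r 30 (m 14 0 + 1), pushMem 1 14 m (r y)⟩ 4 :=
  wp_pushCmd (by simp) hy h0 m Q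

/-- Run the procedure `q` for every entry of a region of the heap (array `2`) between the
registers `6` and `7`, with this entry in the register `8`. -/
def forEach (q : ℕ) : Cmd :=
  .seq (.copy 11 6) (.loop (.lt 11 7) (.seq (.load 8 2 11) (.seq (.call q) (.inc 11))))

theorem wp_forEach {α : Type*} {f : α → ℕ} (l : List α) {q : ℕ} {r : ℕ → ℕ} {m : Mem}
    {Q : State → ℕ → Prop} (I : List α → Mem → ℕ → Prop)
    (hseg : ∀ pre m t, I pre m t → Seg (m 2) (r 6) (l.map f))
    (hlen : r 7 = r 6 + l.length)
    (h0 : I [] m 0)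
    (step : ∀ pre a post m t r', l = pre ++ a :: post → I pre m t → r' 8 = f a →
      (∀ x, x ≠ 8 → x ≠ 11 → r' x = r x) →
      Proc procs q r' m (fun m' t' => I (pre ++ [a]) m' (t + t' + 3)))
    (hQ : ∀ r' m' t, I l m' t → (∀ x, x ≠ 8 → x ≠ 11 → r' x = r x) → Q ⟨r', m'⟩ (t + 2)) :
    WP procs (forEach q) ⟨r, m⟩ Q := by
  simp only [forEach, wp_seq, wp_copy, setReg_mk]
  refine wp_loop (fun i σ t => I (l.take i) σ.mem t ∧ σ.reg 11 = r 6 + i ∧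
    ∀ x, x ≠ 8 → x ≠ 11 → σ.reg x = r x) l.length ⟨by simpa using h0, by simp, ?_⟩ ?_ ?_
  · intro x _ h
    simp [h]
  · rintro i hi ⟨r₁, m₁⟩ t ⟨hI, h11, hr⟩
    simp only at h11 hr hI
    have hl : l = l.take i ++ l[i] :: l.drop (i + 1) := by simp
    refine ⟨by simp only [holds_lt]; rw [h11, hr 7 (by simp) (by simp), hlen]; omega, ?_⟩
    have hv : m₁ 2 (r 6 + i) = f l[i] := by
      have := hseg _ _ _ hI
      rw [hl, List.map_append, List.map_cons] at this
      simpa [List.length_take, min_eq_left hi.le] using this.get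
    simp only [wp_seq, wp_load, setReg_mk, h11, hv]
    refine (step _ _ _ m₁ t _ hl hI (by simp) ?_).wp ?_
    · intro x h8 h11
      simp [h8, hr x ‹_› ‹_›]
    · intro m' t' hI'
      simp only [wp_inc, setReg_mk]
      refine ⟨?_, by simp [h11, add_assoc], ?_⟩
      · rw [List.take_add_one, List.getElem?_eq_getElem hi]
        simpa [add_assoc, add_comm, add_left_comm] using hI'
      · intro x h8 h11
        simp [h8, h11, hr x ‹_› ‹_›]
  · rintro ⟨r₁, m₁⟩ t ⟨hI, h11, hr⟩
    simp only at h11 hr hI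
    refine ⟨by simp only [holds_lt]; rw [h11, hr 7 (by simp) (by simp), hlen]; omega, ?_⟩
    rw [List.take_length] at hI
    convert hQ _ _ t hI hr using 1
    omega

/-- `forEach` with a uniform bound on the cost of a round. -/
theorem wp_forEach_uniform {α : Type*} {f : α → ℕ} (l : List α) {q : ℕ} {r : ℕ → ℕ} {m : Mem}
    {Q : State → ℕ → Prop} (B : ℕ) (I : List α → Mem → Prop)
    (hseg : ∀ pre m, I pre m → Seg (m 2) (r 6) (l.map f))
    (hlen : r 7 = r 6 + l.length)
    (h0 : I [] m)
    (step : ∀ pre a post m r', l = pre ++ a :: post → I pre m → r' 8 = f a →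
      (∀ x, x ≠ 8 → x ≠ 11 → r' x = r x) →
      Proc procs q r' m (fun m' t' => I (pre ++ [a]) m' ∧ t' ≤ B))
    (hQ : ∀ r' m' t, I l m' → (∀ x, x ≠ 8 → x ≠ 11 → r' x = r x) →
      t ≤ l.length * (B + 3) + 2 → Q ⟨r', m'⟩ t) :
    WP procs (forEach q) ⟨r, m⟩ Q := by
  refine wp_forEach l (fun pre m t => I pre m ∧ t ≤ pre.length * (B + 3)) (fun pre m t h => hseg _ _ h.1) hlen
    ⟨h0, by simp⟩ ?_ ?_
  · intro pre a post m t r' hl hI h8 hr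
    refine (step pre a post m r' hl hI.1 h8 hr).mono ?_
    rintro m' t' ⟨h1, h2⟩
    refine ⟨h1, ?_⟩
    simp only [List.length_append, List.length_singleton, add_mul, one_mul]
    have := hI.2
    omega
  · intro r' m' t hI hr
    exact hQ r' m' _ hI.1 hr (by have := hI.2; omega)

end Ram

namespace IncGraph

variable {G : IncGraph}

/-! ### Distances in induced subgraphs -/

/-- `u` and `v` are joined by a walk of length at most `n` in `G[S]`. -/
inductive Near (S : Set G.Vertex) : ℕ → G.Vertex → G.Vertex → Prop
  | refl (n : ℕ) {u : G.Vertex} (h : u ∈ S) : Near S n u u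
  | tail {n : ℕ} {u w v : G.Vertex} (h : Near S n u w) (hwv : G.graph.Adj w v) (hv : v ∈ S) :
      Near S (n + 1) u v

/-- `u` and `v` are in the same component of `G[S]`. -/
def Reach (S : Set G.Vertex) (u v : G.Vertex) : Prop := ∃ n, Near S n u v

variable {S S' : Set G.Vertex}

theorem Near.left {n : ℕ} {u v : G.Vertex} (h : Near S n u v) : u ∈ S := by
  induction h with
  | refl _ h => exact h
  | tail _ _ _ ih => exact ih

theorem Near.right {n : ℕ} {u v : G.Vertex} (h : Near S n u v) : v ∈ S := by
  cases h with
  | refl _ h => exact h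
  | tail _ _ h => exact h

theorem Near.le {n m : ℕ} {u v : G.Vertex} (h : Near S n u v) (hm : n ≤ m) : Near S m u v := by
  induction h generalizing m with
  | refl _ h => exact .refl _ h
  | @tail n _ _ _ _ ha hv ih =>
    obtain ⟨m, rfl⟩ : ∃ m', m = m' + 1 := ⟨m - 1, by omega⟩
    exact .tail (ih (by omega)) ha hv

theorem Near.subset {n : ℕ} {u v : G.Vertex} (h : Near S n u v) (hS : S ⊆ S') : Near S' n u v := by
  induction h with
  | refl _ h => exact .refl _ (hS h)
  | tail _ ha hv ih => exact .tail ih ha (hS hv)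

theorem Near.trans {n m : ℕ} {u v w : G.Vertex} (h : Near S n u v) (h' : Near S m v w) :
    Near S (n + m) u w := by
  induction h' with
  | refl _ _ => exact h.le (by omega)
  | tail _ ha hv ih => exact .tail (ih h) ha hv

theorem near_one {u v : G.Vertex} (hu : u ∈ S) (ha : G.graph.Adj u v) (hv : v ∈ S) :
    Near S 1 u v := .tail (.refl 0 hu) ha hv

theorem Near.symm {n : ℕ} {u v : G.Vertex} (h : Near S n u v) : Near S n v u := by
  induction h with
  | refl _ h => exact .refl _ h
  | tail h ha hv ih => exact ((near_one hv ha.symm h.right).trans ih).le (by omega)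

/-- A walk never leaves the component of its start, so distances can be measured inside the
component. This lets statements about components be applied to arbitrary reduced sets. -/
theorem Near.restrict {n : ℕ} {u v : G.Vertex} (h : Near S n u v) :
    Near (S ∩ {w | Reach S u w}) n u v := by
  induction h with
  | refl _ h => exact .refl _ ⟨h, 0, .refl _ h⟩
  | tail h ha hv ih => exact .tail ih ha ⟨hv, _, .tail h ha hv⟩

theorem Reach.symm {u v : G.Vertex} (h : Reach S u v) : Reach S v u := h.imp fun _ h => h.symm

theorem Reach.trans {u v w : G.Vertex} (h : Reach S u v) (h' : Reach S v w) : Reach S u w := by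
  obtain ⟨_, h⟩ := h
  obtain ⟨_, h'⟩ := h'
  exact ⟨_, h.trans h'⟩

theorem Reach.subset {u v : G.Vertex} (h : Reach S u v) (hS : S ⊆ S') : Reach S' u v :=
  h.imp fun _ h => h.subset hS

theorem reach_iff {u v : G.Vertex} (hu : u ∈ S) (hv : v ∈ S) :
    Reach S u v ↔ (G.graph.induce S).Reachable ⟨u, hu⟩ ⟨v, hv⟩ := by
  constructor
  · rintro ⟨n, h⟩
    induction h with
    | refl _ h => exact .refl _
    | @tail _ _ w v h ha hv' ih =>
      exact (ih hu h.right).trans (SimpleGraph.Adj.reachable (by simpa using ha))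
  · rintro ⟨p⟩
    suffices H : ∀ {a b : S}, (G.graph.induce S).Walk a b → Reach S a.1 b.1 from H p
    intro a b p
    induction p with
    | nil => exact ⟨0, .refl _ (Subtype.property _)⟩
    | @cons a b c h p ih => exact (show Reach S a.1 b.1 from ⟨1, near_one a.2 h b.2⟩).trans ih

theorem preconnected_iff :
    (G.graph.induce S).Preconnected ↔ ∀ u ∈ S, ∀ v ∈ S, Reach S u v :=
  ⟨fun h _ hu _ hv => (reach_iff hu hv).2 (h _ _), fun h u v => (reach_iff u.2 v.2).1 (h _ u.2 _ v.2)⟩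

theorem isComponent_iff {K : Set G.Vertex} :
    G.IsComponent S K ↔ ∃ u ∈ S, K = {v | Reach S u v} := by
  have key : ∀ u (hu : u ∈ S),
      Subtype.val '' ((G.graph.induce S).connectedComponentMk ⟨u, hu⟩).supp = {v | Reach S u v} := by
    intro u hu
    ext v
    constructor
    · rintro ⟨w, hw, rfl⟩
      rw [SimpleGraph.ConnectedComponent.mem_supp_iff, SimpleGraph.ConnectedComponent.eq] at hw
      exact (reach_iff hu w.2).2 hw.symm
    · rintro ⟨n, h⟩
      refine ⟨⟨v, h.right⟩, ?_, rfl⟩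
      rw [SimpleGraph.ConnectedComponent.mem_supp_iff, SimpleGraph.ConnectedComponent.eq]
      exact ((reach_iff hu h.right).1 ⟨n, h⟩).symm
  constructor
  · rintro ⟨C, rfl⟩
    induction C using SimpleGraph.ConnectedComponent.ind with
    | _ u => exact ⟨u.1, u.2, key _ _⟩
  · rintro ⟨u, hu, rfl⟩
    exact ⟨_, (key u hu).symm⟩

/-! ### Partial assignments -/

/-- Every variable of `G[S]` occurs in `G[S]`, and every other variable occurs in `G[S]` with at
most one sign.  This holds for all graphs that arise from `G` by partial assignments and taking
components. -/
structure Red (S : Set G.Vertex) : Prop where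
  occ : ∀ x, Sum.inl x ∈ S → ∃ c s, Sum.inr c ∈ S ∧ G.Edge s x c
  pol : ∀ x, Sum.inl x ∉ S → ∀ c c' s s', Sum.inr c ∈ S → Sum.inr c' ∈ S → G.Edge s x c →
    G.Edge s' x c' → s = s'

theorem adj_inl_inr {x : Fin G.numVar} {c : Fin G.numCla} :
    G.graph.Adj (.inl x) (.inr c) ↔ ∃ s, G.Edge s x c := Iff.rfl

theorem adj_inr_inl {x : Fin G.numVar} {c : Fin G.numCla} :
    G.graph.Adj (.inr c) (.inl x) ↔ ∃ s, G.Edge s x c := Iff.rfl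

theorem red_univ : Red (Set.univ : Set G.Vertex) :=
  ⟨fun x _ => by
    obtain ⟨c, s, h⟩ := G.occurs x
    exact ⟨c, s, trivial, h⟩, fun x h => absurd trivial h⟩

/-- All clauses containing the literal `(x, s)` are gone, so `x` can only remain with the other
sign. A variable that disappears together with its last clause does not occur at all any more. -/
theorem Red.assign (h : Red S) (x : Fin G.numVar) (s : Bool) : Red (G.assign S x s) := by
  constructor
  · rintro y ⟨hy, hyx, c, t, hc, hs, ht⟩
    exact ⟨c, t, ⟨hc, hs⟩, ht⟩
  · rintro y hy c c' t t' ⟨hc, hcs⟩ ⟨hc', hcs'⟩ ht ht'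
    by_cases hyx : y = x
    · subst hyx
      have h1 : t ≠ s := by rintro rfl; exact hcs ht
      have h2 : t' ≠ s := by rintro rfl; exact hcs' ht'
      cases s <;> cases t <;> cases t' <;> simp_all
    · by_cases hyS : Sum.inl y ∈ S
      · exact absurd ⟨hyS, hyx, c, t, hc, hcs, ht⟩ hy
      · exact h.pol y hyS c c' t t' hc hc' ht ht'

/-- A variable of `S` outside of the closed set `K` is adjacent to no clause of `K`, so no new
external variable of a remaining clause arises. -/
theorem Red.restrict (h : Red S) {K : Set G.Vertex}
    (hK : ∀ u ∈ S, ∀ v ∈ S, G.graph.Adj u v → u ∈ K → v ∈ K) : Red (S ∩ K) := by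
  constructor
  · rintro x ⟨hx, hxK⟩
    obtain ⟨c, s, hc, hs⟩ := h.occ x hx
    exact ⟨c, s, ⟨hc, hK _ hx _ hc (adj_inl_inr.2 ⟨s, hs⟩) hxK⟩, hs⟩
  · rintro x hx c c' s s' ⟨hc, hcK⟩ ⟨hc', hcK'⟩ hs hs'
    refine h.pol x (fun hxS => hx ⟨hxS, ?_⟩) c c' s s' hc hc' hs hs'
    exact hK _ hc _ hxS (adj_inr_inl.2 ⟨s, hs⟩) hcK

theorem assign_subset (S : Set G.Vertex) (x : Fin G.numVar) (s : Bool) : G.assign S x s ⊆ S :=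
  fun _ h => h.1

theorem assign_mono (h : S' ⊆ S) (x : Fin G.numVar) (s : Bool) :
    G.assign S' x s ⊆ G.assign S x s := by
  rintro (y | c) ⟨hv, hv'⟩
  · obtain ⟨hyx, c, t, hc, h1, h2⟩ := hv'
    exact ⟨h hv, hyx, c, t, h hc, h1, h2⟩
  · exact ⟨h hv, hv'⟩

theorem reach_closed {u : G.Vertex} :
    ∀ v ∈ S, ∀ w ∈ S, G.graph.Adj v w → v ∈ {v | Reach S u v} → w ∈ {v | Reach S u v} := by
  rintro v _ w hw ha ⟨n, h⟩
  exact ⟨_, h.tail ha hw⟩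

/-- A set that does not contain the variable `x` survives one of the assignments of `x`. -/
theorem Red.exists_subset_assign (h : Red S') (hS : S' ⊆ S) {x : Fin G.numVar}
    (hx : Sum.inl x ∉ S') : ∃ s, S' ⊆ G.assign S x s := by
  have key : ∀ s, (∀ c, Sum.inr c ∈ S' → ¬ G.Edge s x c) → S' ⊆ G.assign S x s := by
    intro s hs v hv
    refine ⟨hS hv, ?_⟩
    match v, hv with
    | .inl y, hv =>
      refine ⟨by rintro rfl; exact hx hv, ?_⟩
      obtain ⟨c, t, hc, ht⟩ := h.occ y hv
      exact ⟨c, t, hS hc, hs c hc, ht⟩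
    | .inr c, hv => exact hs c hv
  -- By reducedness `x` has only one sign in `S'`; assigning the opposite literal deletes no clause
  -- of `S'`.
  by_cases h1 : ∃ c, Sum.inr c ∈ S' ∧ G.Edge true x c
  · obtain ⟨c, hc, hcx⟩ := h1
    exact ⟨false, key _ fun c' hc' hcx' => by simpa using h.pol x hx c c' _ _ hc hc' hcx hcx'⟩
  · exact ⟨true, key _ fun c' hc' hcx' => h1 ⟨c', hc', hcx'⟩⟩

/-- Outside of the ball of radius one around `x`, a clause does not contain `x` and stays; a
variable stays if it has a neighboring clause that stays. -/
theorem mem_assign_of_adj {x : Fin G.numVar} {s : Bool} {v w : G.Vertex} (hv : v ∈ S) (hw : w ∈ S)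
    (ha : G.graph.Adj v w) (hv' : ¬ Near S 1 (.inl x) v) (hw' : ¬ Near S 1 (.inl x) w)
    (hx : Sum.inl x ∈ S) : v ∈ G.assign S x s := by
  have aux : ∀ c, Sum.inr c ∈ S → ¬ Near S 1 (.inl x) (.inr c) → ¬ G.Edge s x c :=
    fun c hc hn he => hn (near_one hx (adj_inl_inr.2 ⟨s, he⟩) hc)
  refine ⟨hv, ?_⟩
  match v, w, ha with
  | .inr c, _, _ => exact aux c hv hv'
  | .inl y, .inr c, ha =>
    obtain ⟨t, ht⟩ := ha
    refine ⟨?_, c, t, hw, aux c hw hw', ht⟩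
    rintro rfl
    exact hv' (.refl _ hx)

/-- A vertex at distance at least two from the variable `x` is joined, in the graph after an
assignment to `x`, to a vertex at distance two from `x`, unless it has distance two itself. -/
theorem exists_near_assign {x : Fin G.numVar} (s : Bool) {n : ℕ} {w : G.Vertex}
    (h : Near S n (.inl x) w) (hw : ¬ Near S 1 (.inl x) w) :
    ∃ v, Near S 2 (.inl x) v ∧ ¬ Near S 1 (.inl x) v ∧ (v = w ∨ Reach (G.assign S x s) v w) := by
  generalize hu : (Sum.inl x : G.Vertex) = u at *
  induction h with
  | refl n h => exact absurd (.refl _ h) hw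
  | @tail n _ w' w h ha hwS ih =>
    subst hu
    by_cases hw' : Near S 1 (.inl x) w'
    -- A vertex at distance two may itself vanish under the assignment, if all its clauses contain
    -- `x`. This is why equality is a separate alternative.
    · exact ⟨w, hw'.tail ha hwS, hw, .inl rfl⟩
    · obtain ⟨v, hv, hv1, hvw⟩ := ih rfl hw'
      refine ⟨v, hv, hv1, .inr ?_⟩
      have m1 : w' ∈ G.assign S x s := mem_assign_of_adj h.right hwS ha hw' hw h.left
      have m2 : w ∈ G.assign S x s := mem_assign_of_adj hwS h.right ha.symm hw hw' h.left
      have hr : Reach (G.assign S x s) w' w := ⟨1, near_one m1 ha m2⟩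
      rcases hvw with rfl | hvw
      · exact hr
      · exact hvw.trans hr

theorem inClass_zero_not_adj (h : G.InClass 0 S) {u v : G.Vertex} (hu : u ∈ S) (hv : v ∈ S) :
    ¬ G.graph.Adj u v := by
  have key : ∀ x c s, Sum.inl x ∈ S → Sum.inr c ∈ S → ¬ G.Edge s x c := by
    intro x c s hx hc he
    have h0 : G.width S c = 0 := by have := h c hc; omega
    rw [width, Set.ncard_eq_zero (Set.toFinite _)] at h0
    exact Set.notMem_empty x (h0 ▸ ⟨hx, s, he⟩)
  intro ha
  match u, v, ha with
  | .inl x, .inr c, ⟨s, hs⟩ => exact key x c s hu hv hs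
  | .inr c, .inl x, ⟨s, hs⟩ => exact key x c s hv hu hs

theorem BTree.depth_le_depthList {t : G.BTree} {ts : List G.BTree} (h : t ∈ ts) :
    t.depth ≤ BTree.depthList ts := by
  induction ts with
  | nil => simp at h
  | cons a ts ih =>
    rw [BTree.depthList]
    rcases List.mem_cons.1 h with rfl | h
    · exact le_max_left _ _
    · exact (ih h).trans (le_max_right _ _)

/-- A graph with a strong recursive backdoor of depth `k` to the edgeless graphs, and every graph
arising from it by partial assignments and taking components, has components of diameter at most
`4 * (2 ^ k - 1)`. -/
theorem near_of_backdoor {B : G.BTree} (hB : G.IsBackdoor (G.InClass 0) B) :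
    ∀ S' : Set G.Vertex, Red S' → S' ⊆ B.labelSet → ∀ u v, Reach S' u v →
      Near S' (4 * (2 ^ B.depth - 1)) u v := by
  induction hB with
  | leaf W _ hW =>
    rintro S' - hS u v ⟨n, h⟩
    have : u = v := by
      cases h with
      | refl => rfl
      | tail h ha hv => exact absurd ha (inClass_zero_not_adj hW (hS h.right) (hS hv))
    subst this
    exact .refl _ h.left
  | split W children _ _ _ hcomp _ ih =>
    rintro S' hR hS u v hr
    have huS : u ∈ {v | v ∈ W} := by
      obtain ⟨_, h⟩ := hr
      exact hS h.left
    obtain ⟨t, ht, hK⟩ := List.mem_map.1 ((hcomp _).2 (isComponent_iff.2 ⟨u, huS, rfl⟩))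
    have hsub : S' ∩ {w | Reach S' u w} ⊆ t.labelSet := by
      rintro w ⟨_, hw⟩
      rw [hK]
      exact hw.subset hS
    obtain ⟨n, hr⟩ := hr
    -- The component of `u` in `S'` lies in one component of `W`, so the subtree of that component
    -- bounds its diameter.
    have := ih t ht _ (hR.restrict reach_closed) hsub u v ⟨n, hr.restrict⟩
    refine (this.subset Set.inter_subset_left).le ?_
    rw [BTree.depth]
    have := BTree.depth_le_depthList ht
    have := Nat.pow_le_pow_right (n := 2) (by omega) this
    omega
  | branch W x pos neg _ _ _ hpos hneg _ _ ihp ihn =>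
    intro S' hR hS
    set D := max pos.depth neg.depth with hD
    have key : ∀ s, ∀ S₁, Red S₁ → S₁ ⊆ G.assign {v | v ∈ W} x s → ∀ u v, Reach S₁ u v →
        Near S₁ (4 * (2 ^ D - 1)) u v := by
      have hp := Nat.pow_le_pow_right (n := 2) (by omega) (le_max_left pos.depth neg.depth)
      have hn := Nat.pow_le_pow_right (n := 2) (by omega) (le_max_right pos.depth neg.depth)
      rw [← hD] at hp hn
      rintro (_ | _) S₁ h1 h2 u v hr
      · exact (ihn S₁ h1 (hneg ▸ h2) u v hr).le (by omega)
      · exact (ihp S₁ h1 (hpos ▸ h2) u v hr).le (by omega)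
    -- The bound `a_D = 4 * (2^D - 1)` satisfies `a_(D+1) = 2 * (a_D + 2)`: two vertices are joined
    -- through `x`, each being at distance at most `2 + a_D` from it.
    have hpow : 4 * (2 ^ (BTree.branch W x pos neg).depth - 1) = 2 * (4 * (2 ^ D - 1) + 2) := by
      rw [BTree.depth, ← hD, add_comm, pow_succ]
      have := Nat.one_le_two_pow (n := D)
      omega
    rw [hpow]
    have hto : ∀ w, Reach S' (.inl x) w → Near S' (4 * (2 ^ D - 1) + 2) (.inl x) w := by
      rintro w ⟨n, h⟩
      by_cases hw : Near S' 1 (.inl x) w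
      · exact hw.le (by omega)
      · obtain ⟨v, hv, -, hvw⟩ := exists_near_assign true h hw
        rcases hvw with rfl | hvw
        · exact hv.le (by omega)
        · have := key true _ (hR.assign x true) (assign_mono hS x true) _ _ hvw
          exact (hv.trans (this.subset (assign_subset _ _ _))).le (by omega)
    intro u v hr
    -- A component containing `x` is covered by `hto`. A component without `x` survives one of the
    -- two assignments as a whole, and the corresponding subtree applies to it.
    by_cases hx : Reach S' u (.inl x)
    · have h1 := hto u hx.symm
      have h2 := hto v (hx.symm.trans hr)
      exact (h1.symm.trans h2).le (by omega)
    · have hR' := hR.restrict (reach_closed (u := u))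
      obtain ⟨s, hs⟩ := hR'.exists_subset_assign (x := x)
        (Set.inter_subset_left.trans hS) (fun h => hx h.2)
      obtain ⟨n, hr⟩ := hr
      exact ((key s _ hR' hs u v ⟨n, hr.restrict⟩).subset Set.inter_subset_left).le (by omega)

variable (G) in
/-- All graphs arising from `G` by partial assignments and taking components have components of
diameter at most `n`. -/
def SmallDiam (n : ℕ) : Prop :=
  ∀ S : Set G.Vertex, Red S → ∀ u v, Reach S u v → Near S n u v

/-- A backdoor of depth at most `k` would bound all diameters by `4 * (2^k - 1)`, as the whole
vertex set labels its root. -/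
theorem lt_srbd_of_not_smallDiam {k : ℕ} (h : ¬ G.SmallDiam (4 * 2 ^ k)) :
    (k : ℕ∞) < G.srbd (G.InClass 0) := by
  refine (ENat.natCast_lt_natCast.2 (Nat.lt_succ_self k)).trans_le ?_
  refine le_iInf₂ fun B hB => ?_
  rw [ENat.natCast_le_natCast]
  by_contra hlt
  refine h fun S hS u v hr => (near_of_backdoor hB.2 S hS (by simp [hB.1]) u v hr).le ?_
  have := Nat.pow_le_pow_right (n := 2) (by omega) (show B.depth ≤ k by omega)
  omega

end IncGraph

namespace IncGraph

variable {G : IncGraph}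

instance (s : Bool) (x : Fin G.numVar) (c : Fin G.numCla) : Decidable (G.Edge s x c) :=
  inferInstanceAs (Decidable ((x, s) ∈ G.clause c))

/-! ### Graphs given by a list of clauses and a set of assigned variables -/

variable (G) in
/-- The vertex set of the graph with the clauses in `L` and the variables outside of `A` that occur
in these clauses. -/
def vset (L : List (Fin G.numCla)) (A : Finset (Fin G.numVar)) : Set G.Vertex := {v | match v with
  | .inl x => x ∉ A ∧ ∃ c ∈ L, ∃ s, G.Edge s x c
  | .inr c => c ∈ L}

variable (G) in
/-- The literals of `c` whose variables are outside of `A`. -/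
def lits (A : Finset (Fin G.numVar)) (c : Fin G.numCla) : List (Fin G.numVar × Bool) :=
  (G.clause c).filter fun l => l.1 ∉ A

variable {L K : List (Fin G.numCla)} {A : Finset (Fin G.numVar)} {d k j : ℕ}

@[simp] theorem inl_mem_vset {x : Fin G.numVar} :
    Sum.inl x ∈ G.vset L A ↔ x ∉ A ∧ ∃ c ∈ L, ∃ s, G.Edge s x c := Iff.rfl

@[simp] theorem inr_mem_vset {c : Fin G.numCla} : Sum.inr c ∈ G.vset L A ↔ c ∈ L := Iff.rfl

theorem mem_lits {x : Fin G.numVar} {s : Bool} {c : Fin G.numCla} :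
    (x, s) ∈ G.lits A c ↔ x ∉ A ∧ G.Edge s x c := by
  simp [lits, Edge, and_comm]

/-- This makes the pair `(L, A)` a sufficient description of a residual graph: an assignment filters
the clauses and adds one variable, and disappearing variables need no bookkeeping. -/
theorem vset_assign (x : Fin G.numVar) (s : Bool) :
    G.assign (G.vset L A) x s = G.vset (L.filter fun c => ¬ G.Edge s x c) (insert x A) := by
  ext (y | c)
  · constructor
    · rintro ⟨⟨h1, -⟩, h2, c, t, h3, h4, h5⟩
      exact ⟨by simp [h1, h2], c, by simpa using ⟨h3, h4⟩, t, h5⟩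
    · rintro ⟨h1, c, h2, t, h3⟩
      simp only [Finset.mem_insert, not_or, List.mem_filter, decide_eq_true_eq] at h1 h2
      exact ⟨⟨h1.2, c, h2.1, t, h3⟩, h1.1, c, t, h2.1, h2.2, h3⟩
  · simp [assign]

theorem width_vset {c : Fin G.numCla} (hc : c ∈ L) :
    G.width (G.vset L A) c = (G.lits A c).length := by
  have hnd : ((G.lits A c).map Prod.fst).Nodup :=
    (G.nodup c).sublist (List.filter_sublist.map _)
  have : {x : Fin G.numVar | Sum.inl x ∈ G.vset L A ∧ ∃ s, G.Edge s x c} =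
      ((G.lits A c).map Prod.fst).toFinset := by
    ext x
    simp only [Set.mem_ofPred_eq, inl_mem_vset, List.coe_toFinset, List.mem_map, Prod.exists,
      exists_and_right, exists_eq_right, mem_lits]
    constructor
    · rintro ⟨⟨h1, _⟩, s, h⟩
      exact ⟨s, h1, h⟩
    · rintro ⟨s, h1, h⟩
      exact ⟨⟨h1, c, hc, s, h⟩, s, h⟩
  rw [width, this, Set.ncard_coe_finset, List.toFinset_card_of_nodup hnd, List.length_map]

theorem width_univ (c : Fin G.numCla) : G.width Set.univ c = (G.clause c).length := by
  have : {x : Fin G.numVar | Sum.inl x ∈ (Set.univ : Set G.Vertex) ∧ ∃ s, G.Edge s x c} =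
      ((G.clause c).map Prod.fst).toFinset := by
    ext x
    simp [Edge]
  rw [width, this, Set.ncard_coe_finset, List.toFinset_card_of_nodup (G.nodup c), List.length_map]

theorem length_clause_le (hG : G.InClass (d : ℤ) Set.univ) (c : Fin G.numCla) :
    (G.clause c).length ≤ d := by
  have := hG c trivial
  rw [width_univ] at this
  exact_mod_cast this

theorem length_lits_le (hG : G.InClass (d : ℤ) Set.univ) (c : Fin G.numCla) :
    (G.lits A c).length ≤ d :=
  List.length_filter_le _ _ |>.trans (length_clause_le hG c)

theorem inClass_vset (h : ∀ c ∈ L, (G.lits A c).length < d) :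
    G.InClass ((d : ℤ) - 1) (G.vset L A) := by
  intro c hc
  rw [width_vset hc]
  have := h c hc
  omega

theorem vset_finRange : G.vset (List.finRange G.numCla) ∅ = Set.univ := by
  ext (x | c)
  · obtain ⟨c, s, h⟩ := G.occurs x
    exact ⟨fun _ => trivial, fun _ => ⟨by simp, c, by simp, s, h⟩⟩
  · simp

/-! ### Lists of components -/

/-- `Ks` lists the clause lists of the components of the graph given by `L` and `A`. -/
structure CompList (L : List (Fin G.numCla)) (A : Finset (Fin G.numVar))
    (Ks : List (List (Fin G.numCla))) : Prop where
  perm : Ks.flatten.Perm L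
  ne : ∀ K ∈ Ks, K ≠ []
  mem : ∀ K ∈ Ks, ∀ c ∈ K, ∀ c', c' ∈ K ↔ Reach (G.vset L A) (.inr c) (.inr c')

variable {Ks : List (List (Fin G.numCla))}

theorem CompList.subset (h : CompList L A Ks) (hK : K ∈ Ks) : K ⊆ L := fun _ hc =>
  h.perm.subset (List.mem_flatten.2 ⟨K, hK, hc⟩)

/-- Each variable of the graph has a clause in it, so the clauses of a component determine its
variables, and no component consists of a variable alone. -/
theorem CompList.vset_eq (h : CompList L A Ks) (hK : K ∈ Ks) {c : Fin G.numCla} (hc : c ∈ K) :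
    G.vset K A = {v | Reach (G.vset L A) (.inr c) v} := by
  ext (x | c')
  · constructor
    · rintro ⟨hx, c', hc', s, hs⟩
      obtain ⟨n, hr⟩ := (h.mem K hK c hc c').1 hc'
      exact ⟨_, hr.tail (adj_inr_inl.2 ⟨s, hs⟩) ⟨hx, c', h.subset hK hc', s, hs⟩⟩
    · rintro ⟨n, hr⟩
      obtain ⟨hx, c', hc', s, hs⟩ := hr.right
      exact ⟨hx, c', (h.mem K hK c hc c').2 ⟨_, hr.tail (adj_inl_inr.2 ⟨s, hs⟩) hc'⟩, s, hs⟩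
  · exact h.mem K hK c hc c'

theorem CompList.red (h : CompList L A Ks) (hR : Red (G.vset L A)) (hK : K ∈ Ks) :
    Red (G.vset K A) := by
  obtain ⟨c, hc⟩ := List.exists_mem_of_ne_nil _ (h.ne K hK)
  have := hR.restrict (reach_closed (u := .inr c))
  rw [h.vset_eq hK hc]
  convert this using 1
  exact (Set.inter_eq_right.2 fun v hv => hv.elim fun _ hv => hv.right).symm

theorem CompList.preconnected (h : CompList L A Ks) (hK : K ∈ Ks) :
    ∀ u ∈ G.vset K A, ∀ v ∈ G.vset K A, Reach (G.vset K A) u v := by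
  obtain ⟨c, hc⟩ := List.exists_mem_of_ne_nil _ (h.ne K hK)
  rw [h.vset_eq hK hc]
  have key : ∀ v ∈ {v | Reach (G.vset L A) (.inr c) v},
      Reach {v | Reach (G.vset L A) (.inr c) v} (.inr c) v := by
    rintro v ⟨n, hv⟩
    exact ⟨n, hv.restrict.subset Set.inter_subset_right⟩
  intro u hu v hv
  exact (key u hu).symm.trans (key v hv)

theorem CompList.isComponent_iff (h : CompList L A Ks) {S : Set G.Vertex} :
    S ∈ Ks.map (G.vset · A) ↔ G.IsComponent (G.vset L A) S := by
  rw [IncGraph.isComponent_iff, List.mem_map]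
  constructor
  · rintro ⟨K, hK, rfl⟩
    obtain ⟨c, hc⟩ := List.exists_mem_of_ne_nil _ (h.ne K hK)
    exact ⟨.inr c, h.subset hK hc, h.vset_eq hK hc⟩
  · have key : ∀ c ∈ L, ∃ K ∈ Ks, G.vset K A = {v | Reach (G.vset L A) (.inr c) v} := by
      intro c hc
      obtain ⟨K, hK, hcK⟩ := List.mem_flatten.1 (h.perm.mem_iff.2 hc)
      exact ⟨K, hK, h.vset_eq hK hcK⟩
    rintro ⟨(x | c), hu, rfl⟩
    · obtain ⟨hx, c, hc, s, hs⟩ := id hu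
      obtain ⟨K, hK, he⟩ := key c hc
      refine ⟨K, hK, he.trans ?_⟩
      have hr : Reach (G.vset L A) (.inr c) (.inl x) :=
        ⟨1, near_one hc (adj_inr_inl.2 ⟨s, hs⟩) hu⟩
      ext v
      exact ⟨fun h => hr.symm.trans h, fun h => hr.trans h⟩
    · exact key c hu

theorem CompList.nodup (h : CompList L A Ks) (hL : L.Nodup) : (Ks.map (G.vset · A)).Nodup := by
  have hf := List.nodup_flatten.1 (h.perm.nodup_iff.2 hL)
  rw [List.Nodup, List.pairwise_map]
  refine hf.2.imp_of_mem ?_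
  intro K K' hK _ hd he
  obtain ⟨c, hc⟩ := List.exists_mem_of_ne_nil _ (h.ne K hK)
  have : Sum.inr c ∈ G.vset K' A := he ▸ (show Sum.inr c ∈ G.vset K A from hc)
  exact hd hc this

theorem CompList.not_preconnected (h : CompList L A Ks) (hL : L.Nodup) (hKs : 1 < Ks.length) :
    ¬ (G.graph.induce (G.vset L A)).Preconnected := by
  rw [preconnected_iff]
  intro hc
  match Ks, hKs, h with
  | K :: K' :: Ks, _, h =>
    obtain ⟨c, hcK⟩ := List.exists_mem_of_ne_nil _ (h.ne K (by simp))
    obtain ⟨c', hcK'⟩ := List.exists_mem_of_ne_nil _ (h.ne K' (by simp))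
    have : c' ∈ K := (h.mem K (by simp) c hcK c').2
      (hc _ (h.subset (K := K) (by simp) hcK) _ (h.subset (K := K') (by simp) hcK'))
    have hf := List.nodup_flatten.1 (h.perm.nodup_iff.2 hL)
    exact (List.pairwise_cons.1 hf.2).1 K' (by simp) this hcK'

/-- This includes the empty list, which belongs to the empty graph; that graph is then treated as
connected by the algorithm. -/
theorem CompList.reach (h : CompList L A Ks) (hKs : Ks.length ≤ 1) :
    ∀ u ∈ G.vset L A, ∀ v ∈ G.vset L A, Reach (G.vset L A) u v := by
  have key : ∀ u ∈ G.vset L A, ∃ c ∈ L, Reach (G.vset L A) u (.inr c) := by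
    rintro (x | c) hu
    · obtain ⟨hx, c, hc, s, hs⟩ := id hu
      exact ⟨c, hc, 1, near_one hu (adj_inl_inr.2 ⟨s, hs⟩) hc⟩
    · exact ⟨c, hu, 0, .refl _ hu⟩
  intro u hu v hv
  obtain ⟨c, hc, huc⟩ := key u hu
  obtain ⟨c', hc', hvc⟩ := key v hv
  refine huc.trans (Reach.trans ?_ hvc.symm)
  obtain ⟨K, hK, hcK⟩ := List.mem_flatten.1 (h.perm.mem_iff.2 hc)
  obtain ⟨K', hK', hcK'⟩ := List.mem_flatten.1 (h.perm.mem_iff.2 hc')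
  match Ks, hKs with
  | [K₀], _ =>
    simp only [List.mem_singleton] at hK hK'
    subst hK hK'
    exact (h.mem _ (by simp) c hcK c').1 hcK'

/-! ### Obstruction-trees with their clauses -/

/-- `T` is a `(d + j, d, k)`-obstruction-tree inside `S`, and `cl` lists its clauses, possibly with
repetitions. -/
structure TreeData (d k j : ℕ) (S : Set G.Vertex) (T : G.OTree) (cl : List (Fin G.numCla)) :
    Prop where
  tree : G.IsObstructionTree d k (d + j) T
  sub : T.elements ⊆ S
  ne : cl ≠ []
  cla : ∀ c, Sum.inr c ∈ T.elements ↔ c ∈ cl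
  var : ∀ x, Sum.inl x ∈ T.elements → ∃ c ∈ cl, ∃ s, G.Edge s x c
  length_le : cl.length + (2 * 2 ^ k + 1) ≤ 2 ^ j * (2 * 2 ^ k + 2)
  code_le : T.code.length + (8 * 2 ^ k + 4) ≤ 2 ^ j * (8 * 2 ^ k + 6)

theorem TreeData.base {S : Set G.Vertex} {c : Fin G.numCla} (hd : G.width Set.univ c = d)
    (hc : Sum.inr c ∈ S) (hx : ∀ x s, G.Edge s x c → Sum.inl x ∈ S) :
    TreeData d k 0 S (.base c) [c] := by
  refine ⟨.base c hd, ?_, by simp, by simp [OTree.elements], ?_, by simp; omega,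
    by simp [OTree.code]; omega⟩
  · rintro v (rfl | ⟨x, ⟨s, hs⟩, rfl⟩)
    · exact hc
    · exact hx x s hs
  · intro x hx
    simpa [OTree.elements] using hx

/-- The two properties needed for disjointness: the first is used for the first tree of a join, the
second for the second tree. -/
theorem TreeData.destroyNbhd {S : Set G.Vertex} {T : G.OTree} {cl : List (Fin G.numCla)}
    (h : TreeData d k j S T cl) {x : Fin G.numVar} (hx : x ∈ T.destroyNbhd) :
    (∃ c ∈ cl, ∃ s, G.Edge s x c) ∧ (Sum.inl x ∈ S ∨ ∃ c c', Sum.inr c ∈ S ∧ Sum.inr c' ∈ S ∧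
      G.Edge true x c ∧ G.Edge false x c') := by
  have key : x ∈ {x | Sum.inl x ∈ T.elements} ∪ {x | ∃ c₁ c₂, Sum.inr c₁ ∈ T.elements ∧
        Sum.inr c₂ ∈ T.elements ∧ G.Edge true x c₁ ∧ G.Edge false x c₂} := by
    cases T with
    | base c => exact .inl hx
    | join T₁ p T₂ => exact hx
  rcases key with hx | ⟨c, c', h1, h2, h3, h4⟩
  · exact ⟨h.var x hx, .inl (h.sub hx)⟩
  · exact ⟨⟨c, (h.cla c).1 h1, true, h3⟩, .inr ⟨c, c', h.sub h1, h.sub h2, h3, h4⟩⟩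

/-- A vertex as a list of two numbers. -/
def vertexCode : G.Vertex → List ℕ
  | .inl x => [0, (x : ℕ)]
  | .inr c => [1, (c : ℕ)]

theorem vertexListCode_eq (W : List G.Vertex) :
    vertexListCode W = W.length :: W.flatMap vertexCode := by
  rw [vertexListCode]
  congr 2

theorem length_vertexListCode (W : List G.Vertex) : (vertexListCode W).length = 2 * W.length + 1 := by
  rw [vertexListCode_eq, List.length_cons]
  congr 1
  induction W with
  | nil => rfl
  | cons v W ih =>
    rw [List.flatMap_cons, List.length_append, ih]
    cases v <;> simp [vertexCode] <;> ring

/-- Disjointness of the destroy-neighborhoods is the point. The second tree lives in a reduced set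
`S₂` that avoids every variable of `S` occurring in a clause of the first tree, and variables
outside of `S` are not in `S₂` anyway. The path may meet both trees. It runs between clauses, so it
has one more clause than variables. -/
theorem TreeData.join {S S₂ : Set G.Vertex} {T₁ T₂ : G.OTree} {cl₁ cl₂ pc : List (Fin G.numCla)}
    (h₁ : TreeData d k j S T₁ cl₁) (h₂ : TreeData d k j S₂ T₂ cl₂) (hS : S₂ ⊆ S) (hR : Red S₂)
    (hd : ∀ c ∈ cl₁, ∀ x s, G.Edge s x c → Sum.inl x ∈ S → Sum.inl x ∉ S₂)
    {u v : Fin G.numCla} (hu : u ∈ cl₁) (hv : v ∈ cl₂) (p : G.graph.Walk (.inr u) (.inr v))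
    (hp : p.IsPath) (hlen : p.length ≤ 4 * 2 ^ k) (hpS : ∀ w ∈ p.support, w ∈ S)
    (hpc : ∀ c, Sum.inr c ∈ p.support ↔ c ∈ pc)
    (hpx : ∀ x, Sum.inl x ∈ p.support → ∃ c ∈ pc, ∃ s, G.Edge s x c)
    (hpl : 2 * pc.length = p.length + 2) :
    TreeData d k (j + 1) S (.join T₁ p T₂) (cl₁ ++ pc ++ cl₂) := by
  refine ⟨.join p h₁.tree h₂.tree ?_ ((h₁.cla u).2 hu) ((h₂.cla v).2 hv) hp hlen, ?_, ?_, ?_, ?_,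
    ?_, ?_⟩
  · rw [Set.disjoint_left]
    intro x hx hx'
    obtain ⟨⟨c, hc, s, hs⟩, -⟩ := h₁.destroyNbhd hx
    have hnot : Sum.inl x ∉ S₂ := fun h => hd c hc x s hs (hS h) h
    rcases (h₂.destroyNbhd hx').2 with h | ⟨c₁, c₂, h1, h2, h3, h4⟩
    · exact hnot h
    -- Outside of the reduced set `S₂`, no variable has both signs in clauses of `T₂`.
    · simpa using hR.pol x hnot c₁ c₂ _ _ h1 h2 h3 h4
  · rintro w ((hw | hw) | hw)
    · exact h₁.sub hw
    · exact hpS w hw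
    · exact hS (h₂.sub hw)
  · simp [h₁.ne]
  · intro c
    simp [OTree.elements, h₁.cla, h₂.cla, hpc, or_assoc]
  · rintro x ((hx | hx) | hx)
    · obtain ⟨c, hc, s⟩ := h₁.var x hx
      exact ⟨c, by simp [hc], s⟩
    · obtain ⟨c, hc, s⟩ := hpx x hx
      exact ⟨c, by simp [hc], s⟩
    · obtain ⟨c, hc, s⟩ := h₂.var x hx
      exact ⟨c, by simp [hc], s⟩
  -- A path of length at most `4 * 2^k` between clauses has at most `2 * 2^k + 1` clauses. Adding
  -- this constant to the length turns the recurrence into plain doubling; the code length below is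
  -- treated in the same way.
  · have := h₁.length_le
    have := h₂.length_le
    simp only [List.length_append, pow_succ]
    set a := 2 ^ j * (2 * 2 ^ k + 2)
    rw [show 2 ^ j * 2 * (2 * 2 ^ k + 2) = 2 * a by ring]
    omega
  · have := h₁.code_le
    have := h₂.code_le
    simp only [OTree.code, List.length_cons, List.length_append, length_vertexListCode,
      SimpleGraph.Walk.length_support, pow_succ]
    set a := 2 ^ j * (8 * 2 ^ k + 6)
    rw [show 2 ^ j * 2 * (8 * 2 ^ k + 6) = 2 * a by ring]
    omega

end IncGraph

namespace Ram

/-! ### The program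

Every procedure gets its own copy of the registers, and register `0` always contains `0`.

Arrays (single numbers are stored in the cell `0`):
`0` input; `1` output, with its stack pointer in `14`; `2` heap, with its stack pointer in `3`;
`4` position of the code of a clause in the input; `5` assigned variables (`1`) and others (`0`);
`6`, `7` component label of a clause and of a variable; `8`, `9` head of the list of clauses with a
given label and successor of a clause in it; `10`, `11` distance of a clause and of a variable from
the start (plus one); `12`, `13` predecessor of a clause and of a variable on a shortest path;
`15` status (`0` obstruction-tree, `1` backdoor, `2` failure); `16` flag; `17`--`20` limits of the
heap regions with the code of the obstruction-tree and with its clauses; `21` number of components;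
`22` heap position of the list of components; `23` counter; `24` listed variables.

Registers: `1` the parameter `d`; `2` the bound `4 * 2 ^ k`; `3` the level; `4`, `5` limits of the
heap region with the variables that have to be assigned; `6`, `7` limits of the heap region with the
clauses; `8` current clause; `9`, `10` current variable and its sign. -/

/-- Sequential composition of a list of commands. -/
def seqs : List Cmd → Cmd
  | [] => .skip
  | [c] => c
  | c :: c' :: cs => .seq c (seqs (c' :: cs))

/-- Run the procedure `q` for every literal of the clause in the register `8` whose variable is not
assigned. -/
def litsOf (q : ℕ) : Cmd := seqs [.load 12 4 8, .load 13 0 12, .const 14 0,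
  .loop (.lt 14 13) (seqs [.inc 12, .load 9 0 12, .inc 12, .load 10 0 12, .load 15 5 9,
    .ite (.eq 15 0) (.call q) .skip, .inc 14])]

/-- Write the list of vertices to the output. -/
def labelCmd : Cmd := seqs [.load 16 14 0, pushCmd 1 14 0, .store 23 0 0, forEach 1, forEach 3,
  .load 17 23 0, .store 1 16 17]

def labelClause : Cmd := seqs [.const 16 1, pushCmd 1 14 16, pushCmd 1 14 8, .load 17 23 0, .inc 17,
  .store 23 0 17, litsOf 2]

def labelVar : Cmd := seqs [.load 16 24 9, .ite (.eq 16 0)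
  (seqs [.const 17 1, .store 24 9 17, pushCmd 1 14 0, pushCmd 1 14 9, .load 18 23 0, .inc 18,
    .store 23 0 18]) .skip]

/-- Test whether the variable in the register `20` occurs. -/
def occursCmd : Cmd := seqs [.store 16 0 0, forEach 5]

def occursLit : Cmd := .ite (.eq 9 20) (seqs [.const 16 1, .store 16 0 16]) .skip

/-- Write the clauses without the literal in the registers `20`, `21` to the heap. -/
def filterCmd : Cmd := forEach 7

def filterClause : Cmd := seqs [.store 16 0 0, litsOf 8, .load 16 16 0,
  .ite (.eq 16 0) (pushCmd 2 3 8) .skip]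

def filterLit : Cmd :=
  .ite (.eq 9 20) (.ite (.eq 10 21) (seqs [.const 16 1, .store 16 0 16]) .skip) .skip

/-- Look for a clause of width `d`. -/
def widthCmd : Cmd := seqs [.store 16 0 0, forEach 9]

/-- The clause number is stored plus one, as `0` in the flag means that no clause has been found. -/
def widthClause : Cmd := seqs [.store 23 0 0, litsOf 10, .load 16 23 0,
  .ite (.eq 16 1) (seqs [.inc 8, .store 16 0 8]) .skip]

def widthLit : Cmd := seqs [.load 16 23 0, .inc 16, .store 23 0 16]

/-- Compute the components. -/
def compsCmd : Cmd := seqs [forEach 11, .const 22 0, .loop (.lt 22 2) (seqs [.call 13, .inc 22]),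
  .store 16 0 0, forEach 16, .load 16 16 0, .ite (.eq 16 0)
    (seqs [forEach 18, .load 16 3 0, .store 22 0 16, .store 21 0 0, forEach 19]) .skip]

/-- Only cells of the current graph are initialized, which keeps the cost linear in that graph
rather than in the input. -/
def compsInitClause : Cmd := seqs [.store 6 8 8, .store 8 8 0, litsOf 12]

/-- Both ends of an edge end up with the smaller of their two labels. -/
def compsRelax : Cmd := seqs [.load 16 6 8, .load 17 7 9,
  .ite (.lt 16 17) (.store 7 9 16) (.store 6 8 17)]

def compsCheck : Cmd := seqs [.load 16 6 8, .load 17 7 9,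
  .ite (.eq 16 17) .skip (seqs [.const 16 1, .store 16 0 16])]

def compsBucket : Cmd := seqs [.load 16 6 8, .load 17 8 16, .store 9 8 17, .copy 18 8, .inc 18,
  .store 8 16 18]

/-- The first cell is reserved for the end position of the block and filled in once the linked list
has been copied. -/
def compsBlock : Cmd := seqs [.load 16 8 8, .ite (.eq 16 0) .skip (seqs [.load 18 3 0,
  pushCmd 2 3 0, .loop (.ne 16 0) (seqs [.dec 16, pushCmd 2 3 16, .load 16 9 16]), .load 19 3 0,
  .store 2 18 19, .load 20 21 0, .inc 20, .store 21 0 20])]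

/-- Breadth first search from the clause in the register `21`. -/
def bfsCmd : Cmd := seqs [forEach 21, .const 16 1, .store 10 21 16, .const 38 0,
  .loop (.lt 38 2) (seqs [.inc 38, .call 23])]

def bfsInitClause : Cmd := seqs [.store 10 8 0, litsOf 22]

/-- Only vertices whose value equals the round number expand. New vertices receive a larger value
and so wait for the next round. -/
def bfsRelax : Cmd := seqs [.load 16 10 8, .load 17 11 9, .copy 18 38, .inc 18,
  .ite (.eq 16 38) (.ite (.eq 17 0) (seqs [.store 11 9 18, .store 13 9 8]) .skip)
    (.ite (.eq 17 38) (.ite (.eq 16 0) (seqs [.store 10 8 18, .store 12 8 9]) .skip) .skip)]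

/-- Write the variables of the clauses in the heap region between the registers `25` and `26` to
the heap. -/
def gatherCmd : Cmd := seqs [.copy 6 25, .copy 7 26, forEach 27]

/-- Append a copy of the heap region between the registers `28` and `29` to the heap. -/
def copyCmd : Cmd := .loop (.lt 28 29) (seqs [.load 16 2 28, pushCmd 2 3 16, .inc 28])

/-- Write the path from the clause in the register `20` to the start of the breadth first search to
the heap. -/
def pathCodeCmd : Cmd := seqs [.const 17 1, .load 16 10 20, pushCmd 2 3 16,
  .loop (.ne 16 17) (seqs [pushCmd 2 3 17, pushCmd 2 3 20, .load 18 12 20, pushCmd 2 3 0,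
    pushCmd 2 3 18, .load 20 13 18, .load 16 10 20]), pushCmd 2 3 17, pushCmd 2 3 20]

/-- Write the clauses on this path to the heap. -/
def pathClausesCmd : Cmd := seqs [.const 17 1, .load 16 10 20,
  .loop (.ne 16 17) (seqs [pushCmd 2 3 20, .load 18 12 20, .load 20 13 18, .load 16 10 20]),
  pushCmd 2 3 20]

/-- Join two obstruction-trees. -/
def joinCmd : Cmd := seqs [.load 31 17 0, .load 32 18 0, .load 33 19 0, .load 34 20 0,
  .load 20 2 25, .load 21 2 33, .call 26, .load 16 10 20, .ite (.eq 16 0)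
    (seqs [.const 17 2, .store 15 0 17])
    (seqs [.load 35 3 0, .const 17 1, pushCmd 2 3 17, .copy 28 23, .copy 29 24, .call 30, .call 31,
      .copy 28 31, .copy 29 32, .call 30, .load 36 3 0, .copy 28 25, .copy 29 26, .call 30,
      .call 32, .copy 28 33, .copy 29 34, .call 30, .load 37 3 0, .store 17 0 35, .store 18 0 36,
      .store 19 0 36, .store 20 0 37, .store 15 0 0])]

/-- The lowest level: return a clause of width `d` or a leaf. -/
def baseCmd : Cmd := seqs [.call 42, .load 16 16 0, .ite (.eq 16 0)
  (seqs [pushCmd 1 14 0, .call 0, .const 17 1, .store 15 0 17])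
  (seqs [.dec 16, .load 17 3 0, .store 17 0 17, pushCmd 2 3 0, pushCmd 2 3 16, .load 17 3 0,
    .store 18 0 17, .store 19 0 17, pushCmd 2 3 16, .load 17 3 0, .store 20 0 17, .store 15 0 0])]

/-- Continue with one component, given by the registers `19` and `25`. -/
def blockCmd : Cmd := seqs [.load 16 15 0, .const 17 1, .ite (.eq 16 17)
  (seqs [.copy 6 19, .inc 6, .copy 7 25, .call 37]) .skip]

/-- Continue with all components; the register `16` contains their number. -/
def splitCmd : Cmd := seqs [.const 18 2, pushCmd 1 14 18, .call 0, pushCmd 1 14 16, .const 17 1,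
  .store 15 0 17, .load 19 22 0, .const 18 0, .loop (.lt 18 16) (seqs [.load 25 2 19, .call 35,
    .copy 19 25, .inc 18])]

/-- The algorithm for an arbitrary graph. -/
def mainCmd : Cmd := seqs [.call 20, .load 16 16 0, .ite (.eq 16 0)
  (seqs [.load 16 21 0, .const 17 1, .ite (.lt 17 16) (.call 43) (.call 37)])
  (seqs [.const 17 2, .store 15 0 17])]

/-- The algorithm for a connected graph. -/
def connCmd : Cmd := .ite (.lt 4 5)
  (seqs [.load 20 2 4, .inc 4, .call 40, .load 16 16 0, .ite (.eq 16 0) (.call 37) (.call 38)])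
  (.ite (.eq 3 1) (.call 34) (.call 39))

/-- Branch over the variable in the register `20`. -/
def branchCmd : Cmd := seqs [.const 16 1, pushCmd 1 14 16, .call 0, pushCmd 1 14 20,
  .load 22 3 0, .const 21 1, .call 41, .load 23 3 0, .const 21 0, .call 41, .load 24 3 0,
  .store 5 20 16, .copy 6 22, .copy 7 23, .call 36, .load 17 15 0, .ite (.eq 17 16)
    (seqs [.copy 6 23, .copy 7 24, .call 36]) .skip, .store 5 20 0]

/-- Climb one level. -/
def upCmd : Cmd := seqs [.load 22 14 0, .dec 3, .copy 4 5, .call 37, .load 16 15 0,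
  .ite (.eq 16 0) (seqs [.store 14 0 22, .load 23 17 0, .load 24 18 0, .load 25 19 0, .load 26 20 0,
    .load 4 3 0, .call 29, .load 5 3 0, .call 37, .load 16 15 0,
    .ite (.eq 16 0) (.call 33) .skip]) .skip]

/-- The procedures. -/
def procedures : List Cmd := [labelCmd, labelClause, .store 24 9 0, litsOf 4, labelVar,
  litsOf 6, occursLit, filterClause, filterLit, widthClause,
  widthLit, compsInitClause, .store 7 9 8, forEach 14, litsOf 15,
  compsRelax, litsOf 17, compsCheck, compsBucket, compsBlock,
  compsCmd, bfsInitClause, .store 11 9 0, forEach 24, litsOf 25,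
  bfsRelax, bfsCmd, litsOf 28, pushCmd 2 3 9, gatherCmd,
  copyCmd, pathCodeCmd, pathClausesCmd, joinCmd, baseCmd,
  blockCmd, mainCmd, connCmd, branchCmd, upCmd,
  occursCmd, filterCmd, widthCmd, splitCmd]

/-- Read the graph, run the algorithm, and write the output. -/
def mainProgram : Cmd := seqs [.const 16 1, .load 3 0 16, .inc 16, .load 1 0 16, .inc 16,
  .load 17 0 16, .inc 16, .inc 16, .load 18 0 16, .inc 16, .const 2 4, .const 19 0,
  .loop (.lt 19 17) (seqs [.copy 20 2, .const 21 0, .loop (.lt 21 20) (seqs [.inc 2, .inc 21]),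
    .inc 19]),
  .const 19 0, .loop (.lt 19 18) (seqs [.store 4 19 16, pushCmd 2 3 19, .load 20 0 16, .inc 16,
    .const 21 0, .loop (.lt 21 20) (seqs [.inc 16, .inc 16, .inc 21]), .inc 19]),
  .load 7 3 0, .const 20 2, .store 14 0 20, .call 36, .load 22 15 0, .ite (.eq 22 0)
    (seqs [.store 14 0 20, .load 28 17 0, .load 29 18 0,
      .loop (.lt 28 29) (seqs [.load 16 2 28, pushCmd 1 14 16, .inc 28])]) .skip,
  .const 16 1, .store 1 16 22, .ite (.eq 22 20) (.store 1 0 16)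
    (seqs [.load 16 14 0, .dec 16, .store 1 0 16])]

/-- The program. -/
def program : Program := ⟨procedures, mainProgram⟩

/-! ### The basic loop over literals -/

variable {procs : List Cmd} {G : IncGraph} {A : Finset (Fin G.numVar)}

/-- The arrays that represent the graph and the set `A` of assigned variables. -/
structure Repr (A : Finset (Fin G.numVar)) (m : Mem) : Prop where
  code : ∀ c : Fin G.numCla, Seg (m 0) (m 4 c) (G.clauseCode c)
  asg : ∀ x : Fin G.numVar, m 5 x = if x ∈ A then 1 else 0

theorem Repr.congr {m m' : Mem} (h : Repr A m) (h0 : m' 0 = m 0) (h4 : m' 4 = m 4)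
    (h5 : m' 5 = m 5) : Repr A m' :=
  ⟨fun c => by rw [h0, h4]; exact h.code c, fun x => by rw [h5]; exact h.asg x⟩

theorem Repr.same {m m' : Mem} (h : Repr A m) {s : List ℕ} (hs : Same s m m')
    (h0 : 0 ∉ s ∧ 4 ∉ s ∧ 5 ∉ s) : Repr A m' :=
  h.congr (hs _ h0.1) (hs _ h0.2.1) (hs _ h0.2.2)

theorem seg_pairs {α : Type*} {g h : α → ℕ} {f : ℕ → ℕ} {s : ℕ} {pre post : List α} {a : α}
    (H : Seg f s ((pre ++ a :: post).flatMap fun l => [g l, h l])) :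
    f (s + 2 * pre.length) = g a ∧ f (s + 2 * pre.length + 1) = h a := by
  have hl : ∀ l : List α, (l.flatMap fun l => [g l, h l]).length = 2 * l.length := by
    intro l
    induction l with
    | nil => rfl
    | cons a l ih => simp only [List.flatMap_cons, List.length_append, ih, List.length_cons,
        List.length_nil]; ring
  rw [List.flatMap_append, List.flatMap_cons, seg_append, hl] at H
  exact ⟨H.2.1, H.2.2.1⟩

/-- Assigned literals are read too and cost time, but the clause has at most `d` literals
altogether. The invariant `I` only sees the unassigned ones. -/
theorem wp_litsOf {c : Fin G.numCla} {q B d : ℕ} {r : ℕ → ℕ} {m : Mem} {Q : State → ℕ → Prop}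
    (hG : G.InClass (d : ℤ) Set.univ) (hm : Repr A m) (s : List ℕ) (hs : 0 ∉ s ∧ 4 ∉ s ∧ 5 ∉ s)
    (I : List (Fin G.numVar × Bool) → Mem → Prop) (hI : ∀ pre m', I pre m' → Same s m m')
    (hr0 : r 0 = 0) (hr8 : r 8 = c) (h0 : I [] m)
    (step : ∀ pre l post m r', G.lits A c = pre ++ l :: post → I pre m → r' 9 = l.1 →
      (r' 10 = if l.2 then 1 else 0) → (∀ x, x ≤ 8 ∨ 16 ≤ x → r' x = r x) →
      Proc procs q r' m (fun m' t' => I (pre ++ [l]) m' ∧ t' ≤ B))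
    (hQ : ∀ r' m' t, I (G.lits A c) m' → (∀ x, x ≤ 8 ∨ 16 ≤ x → r' x = r x) →
      t ≤ d * (B + 9) + 4 → Q ⟨r', m'⟩ t) :
    WP procs (litsOf q) ⟨r, m⟩ Q := by
  have hcode := hm.code c
  simp only [IncGraph.clauseCode, seg_cons] at hcode
  simp only [litsOf, seqs, wp_seq, wp_load, wp_const, setReg_mk, Function.update_self, hr8,
    hcode.1]
  refine wp_loop (fun i σ t => I (((G.clause c).take i).filter fun l => l.1 ∉ A) σ.mem ∧
    σ.reg 12 = m 4 c + 2 * i ∧ σ.reg 13 = (G.clause c).length ∧ σ.reg 14 = i ∧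
    (∀ x, x ≤ 8 ∨ 16 ≤ x → σ.reg x = r x) ∧ t ≤ i * (B + 9)) (G.clause c).length
    ⟨by simpa using h0, by simp, by simp, by simp, ?_, by simp⟩ ?_ ?_
  · intro x hx
    have h12 : x ≠ 12 := by omega
    have h13 : x ≠ 13 := by omega
    have h14 : x ≠ 14 := by omega
    simp [h12, h13, h14]
  · rintro i hi ⟨r₁, m₁⟩ t ⟨h1, h2, h3, h4, h5, h6⟩
    simp only at h1 h2 h3 h4 h5
    refine ⟨by simp [h4, h3, hi], ?_⟩
    have hl : G.clause c = (G.clause c).take i ++ (G.clause c)[i] :: (G.clause c).drop (i + 1) := by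
      simp
    set l := (G.clause c)[i] with hl_def
    have hsame := hI _ _ h1
    have hin : m₁ 0 = m 0 := hsame 0 hs.1
    have hasg := (hm.same hsame hs).asg l.1
    have hcell := hcode.2
    rw [hl] at hcell
    have hcell := seg_pairs hcell
    rw [List.length_take, min_eq_left hi.le] at hcell
    have e1 : m₁ 0 (m 4 c + 2 * i + 1) = l.1 := by
      rw [hin, ← hcell.1]
      congr 1
      ring
    have e2 : m₁ 0 (m 4 c + 2 * i + 1 + 1) = if l.2 then 1 else 0 := by
      rw [hin, ← hcell.2]
      congr 1
      ring
    have h0' : r₁ 0 = 0 := by rw [h5 0 (by simp), hr0]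
    have hreg : ∀ x, x ≤ 8 ∨ 16 ≤ x → x ≠ 9 ∧ x ≠ 10 ∧ x ≠ 12 ∧ x ≠ 14 ∧ x ≠ 15 := by omega
    by_cases hA : l.1 ∈ A
    · rw [if_pos hA] at hasg
      simp [wp_ite, h2, h3, h4, e1, hasg, h0']
      refine ⟨?_, by ring, ?_, ?_⟩
      · rw [List.take_add_one, List.getElem?_eq_getElem hi, List.filter_append]
        simpa [← hl_def, hA] using h1
      · intro x hx
        obtain ⟨a1, a2, a3, a4, a5⟩ := hreg x hx
        simp [a1, a2, a3, a4, a5, h5 x hx]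
      · rw [add_mul]
        omega
    · rw [if_neg hA] at hasg
      simp [wp_ite, h2, h3, h4, e1, e2, hasg, h0']
      refine (step ((((G.clause c).take i).filter fun l => l.1 ∉ A)) l
        (((G.clause c).drop (i + 1)).filter fun l => l.1 ∉ A) m₁ _ ?_ h1 (by simp) (by simp) ?_).wp ?_
      · rw [IncGraph.lits]
        conv_lhs => rw [hl, List.filter_append]
        simp [hA]
      · intro x hx
        obtain ⟨a1, a2, a3, a4, a5⟩ := hreg x hx
        simp [a1, a2, a3, a5, h5 x hx]
      · rintro m' t' ⟨hI', ht'⟩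
        simp [h3, h4]
        refine ⟨?_, by ring, ?_, ?_⟩
        · rw [List.take_add_one, List.getElem?_eq_getElem hi, List.filter_append]
          simpa [← hl_def, hA] using hI'
        · intro x hx
          obtain ⟨a1, a2, a3, a4, a5⟩ := hreg x hx
          simp [a1, a2, a3, a4, a5, h5 x hx]
        · rw [add_mul]
          omega
  · rintro ⟨r₁, m₁⟩ t ⟨h1, h3, h4, h5, h6, h7⟩
    simp only at h1 h3 h4 h5 h6
    refine ⟨by simp [h4, h5], hQ _ _ _ ?_ h6 ?_⟩
    · rwa [List.take_length] at h1
    · have := Nat.mul_le_mul_right (B + 9) (IncGraph.length_clause_le hG c)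
      omega

end Ram

-- Scanning the edges of the current graph.

namespace Ram

open IncGraph

variable {procs : List Cmd} {G : IncGraph} {A : Finset (Fin G.numVar)} {L : List (Fin G.numCla)}
  {r : ℕ → ℕ} {m : Mem} {d : ℕ}

theorem Ext.congr {b p : ℕ} {m m' m'' : Mem} {l : List ℕ} (h : Ext b p m m' l)
    (hb : m'' b = m' b) (hp : m'' p = m' p) : Ext b p m m'' l := by
  simpa using h.trans (Ext.of_eq hb hp)

theorem Ext.congr_left {b p : ℕ} {m m' m'' : Mem} {l : List ℕ} (h : Ext b p m' m'' l)
    (hb : m' b = m b) (hp : m' p = m p) : Ext b p m m'' l := by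
  simpa using (Ext.of_eq hb hp).trans h

theorem Ext.push {b p : ℕ} {m m' : Mem} {l : List ℕ} (h : Ext b p m m' l) (hbp : b ≠ p) (v : ℕ) :
    Ext b p m (pushMem b p m' v) (l ++ [v]) := h.trans (ext_pushMem hbp _ _)

/-- Used for length and end fields that are written before their value is known. -/
theorem Ext.setHead {b p : ℕ} {m m' : Mem} {a : ℕ} {l : List ℕ} (h : Ext b p m m' (a :: l))
    (hbp : b ≠ p) (v : ℕ) : Ext b p m (setCell m' b (m p 0) v) (v :: l) := by
  have hpb : p ≠ b := hbp.symm
  refine ⟨by simp [hpb, h.top], ⟨by simp, ?_⟩, fun j hj => ?_⟩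
  · refine h.seg.2.congr fun j hj _ => ?_
    have : j ≠ m p 0 := by omega
    simp [this]
  · simp [hj.ne, h.old j hj]

variable (A) in
/-- The literals of the clauses in `L` whose variables are not assigned. -/
def edges (L : List (Fin G.numCla)) : List (Fin G.numCla × Fin G.numVar × Bool) :=
  L.flatMap fun c => (G.lits A c).map fun l => (c, l)

theorem mem_edges {c : Fin G.numCla} {x : Fin G.numVar} {s : Bool} :
    (c, x, s) ∈ edges A L ↔ c ∈ L ∧ x ∉ A ∧ G.Edge s x c := by
  simp [edges, mem_lits]

/-- The registers and the memory represent the graph given by `L` and `A`. -/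
structure Ctx (A : Finset (Fin G.numVar)) (L : List (Fin G.numCla)) (r : ℕ → ℕ) (m : Mem) :
    Prop where
  zero : r 0 = 0
  repr : Repr A m
  seg : Seg (m 2) (r 6) (L.map Fin.val)
  len : r 7 = r 6 + L.length
  top : r 7 ≤ m 3 0

theorem Ctx.reg {r' : ℕ → ℕ} (h : Ctx A L r m) (h0 : r' 0 = r 0) (h6 : r' 6 = r 6)
    (h7 : r' 7 = r 7) : Ctx A L r' m :=
  ⟨h0 ▸ h.zero, h.repr, h6 ▸ h.seg, by rw [h6, h7, h.len], h7 ▸ h.top⟩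

theorem Ctx.mem {m' : Mem} (h : Ctx A L r m) {s : List ℕ} (hs : Same s m m')
    (hn : 0 ∉ s ∧ 4 ∉ s ∧ 5 ∉ s) (hg : Grow 2 3 m m') : Ctx A L r m' :=
  ⟨h.zero, h.repr.same hs hn, hg.seg h.seg (by simpa [h.len] using h.top), h.len,
    h.top.trans hg.top⟩

theorem Ctx.same {m' : Mem} (h : Ctx A L r m) {s : List ℕ} (hs : Same s m m')
    (hn : 0 ∉ s ∧ 4 ∉ s ∧ 5 ∉ s ∧ 2 ∉ s ∧ 3 ∉ s) : Ctx A L r m' :=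
  h.mem hs ⟨hn.1, hn.2.1, hn.2.2.1⟩ (.of_eq (hs _ hn.2.2.2.1) (hs _ hn.2.2.2.2))

/-- The loop over all literals whose variables are not assigned. -/
theorem wp_scan {q p B : ℕ} {Q : State → ℕ → Prop} (hp : procs[p]? = some (litsOf q))
    (hG : G.InClass (d : ℤ) Set.univ) (hc : Ctx A L r m) (s : List ℕ)
    (hs : 0 ∉ s ∧ 4 ∉ s ∧ 5 ∉ s) (I : List (Fin G.numCla × Fin G.numVar × Bool) → Mem → Prop)
    (hI : ∀ pre m', I pre m' → Same s m m' ∧ Grow 2 3 m m') (h0 : I [] m)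
    (step : ∀ pre (c : Fin G.numCla) (x : Fin G.numVar) (b : Bool) post m' (r' : ℕ → ℕ),
      edges A L = pre ++ (c, x, b) :: post → I pre m' →
      r' 8 = c → r' 9 = x → (r' 10 = if b then 1 else 0) → (∀ x, x ≤ 7 ∨ 16 ≤ x → r' x = r x) →
      Proc procs q r' m' (fun m'' t' => I (pre ++ [(c, x, b)]) m'' ∧ t' ≤ B))
    (hQ : ∀ r' m' t, I (edges A L) m' → (∀ x, x ≤ 7 ∨ 16 ≤ x → r' x = r x) →
      t ≤ L.length * (d * (B + 9) + 8) + 2 → Q ⟨r', m'⟩ t) :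
    WP procs (forEach p) ⟨r, m⟩ Q := by
  refine wp_forEach_uniform L (f := Fin.val) (d * (B + 9) + 5) (fun pre m' => I (edges A pre) m')
    ?_ hc.len h0 ?_ ?_
  · intro pre m' h
    exact (hc.mem (hI _ _ h).1 hs (hI _ _ h).2).seg
  · intro pre c post m' r' hL h h8 hr
    refine .intro hp ?_
    have hc' := hc.mem (hI _ _ h).1 hs (hI _ _ h).2
    have hpre : edges A (pre ++ [c]) = edges A pre ++ (G.lits A c).map fun l => (c, l) := by
      simp [edges]
    have hedges : edges A L = edges A (pre ++ [c]) ++ edges A post := by simp [edges, hL]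
    refine wp_litsOf hG hc'.repr s hs (B := B)
      (fun pl m'' => I (edges A pre ++ pl.map fun l => (c, l)) m'')
      (fun _ _ h' a ha => ((hI _ _ h').1 a ha).trans ((hI _ _ h).1 a ha).symm) (by rw [hr 0 (by simp) (by simp), hc.zero]) h8
      (by simpa using h) ?_ ?_
    · rintro pl ⟨x, b⟩ post' m'' r'' hl hI' h9 h10 hr'
      refine (step (edges A pre ++ pl.map fun l => (c, l)) c x b
        (post'.map (fun l => (c, l)) ++ edges A post) m'' r'' ?_ hI' ?_ h9 h10 ?_).mono ?_
      · rw [hedges, hpre, hl]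
        simp
      · rw [hr' 8 (by simp), h8]
      · intro x hx
        rw [hr' x (by omega), hr x (by omega) (by omega)]
      · rintro m₃ t' ⟨h1, h2⟩
        exact ⟨by simpa using h1, h2⟩
    · rintro r'' m'' t h1 hr' ht
      exact ⟨by rw [hpre]; exact h1, by omega⟩
  · intro r' m' t h hr ht
    exact hQ r' m' t h (fun x hx => hr x (by omega) (by omega)) ht

/-- Brings the cost of every nested scan into the common shape of a constant times `(d + 1) * (n +
1)`. -/
theorem cost_le (n d a b c : ℕ) : n * (d * a + b) + c ≤ (a + b + c) * ((d + 1) * (n + 1)) := by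
  nlinarith [Nat.zero_le (n * d * b), Nat.zero_le (n * d * c), Nat.zero_le (n * c), Nat.zero_le (d * c),
    Nat.zero_le (n * a), Nat.zero_le (d * a), Nat.zero_le (d * b), Nat.zero_le a, Nat.zero_le b]

end Ram

-- Testing occurrence of a variable and restricting the clauses under an assignment.

namespace Ram

open IncGraph

variable {G : IncGraph} {A : Finset (Fin G.numVar)} {L : List (Fin G.numCla)}
  {r : ℕ → ℕ} {m : Mem} {d : ℕ}

theorem occurs_spec (hG : G.InClass (d : ℤ) Set.univ) (hc : Ctx A L r m) {x : Fin G.numVar}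
    (hx : r 20 = x) :
    Proc procedures 40 r m fun m' t => Same [16] m m' ∧
      (m' 16 0 = 0 ↔ Sum.inl x ∉ G.vset L A) ∧ t ≤ 40 * ((d + 1) * (L.length + 1)) := by
  refine .intro (c := occursCmd) rfl ?_
  simp only [occursCmd, seqs, wp_seq, wp_store, setMem_mk, hc.zero]
  have hs1 : Same [16] m (setCell m 16 0 0) := same_setCell m (by simp) _ _
  refine wp_scan (q := 6) (B := 10) rfl hG (hc.same hs1 (by simp)) [16] (by simp)
    (fun pre m' => Same [16] (setCell m 16 0 0) m' ∧ (m' 16 0 = 0 ↔ ∀ e ∈ pre, e.2.1 ≠ x))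
    (fun pre m' h => ⟨h.1, .of_eq (h.1 _ (by simp)) (h.1 _ (by simp))⟩) ⟨.refl _ _, by simp⟩ ?_ ?_
  · rintro pre c y b post m' r' he ⟨h1, h2⟩ h8 h9 h10 hr
    refine .intro (c := occursLit) rfl ?_
    have h0 : r' 0 = 0 := by rw [hr 0 (by simp), hc.zero]
    have h20 : r' 20 = x := by rw [hr 20 (by simp), hx]
    simp only [occursLit, wp_ite, holds_eq, h9, h20, Fin.val_inj]
    refine ⟨fun h => ?_, fun h => ?_⟩
    · simp only [seqs, wp_seq, wp_const, wp_store, setReg_mk, setMem_mk]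
      refine ⟨⟨h1.trans (same_setCell _ (by simp) _ _), ?_⟩, by omega⟩
      exact iff_of_false (by simp [h0]) fun hh => hh (c, y, b) (by simp) h
    · simp only [wp_skip]
      refine ⟨⟨h1, ?_⟩, by omega⟩
      simp [h2, h, or_imp, forall_and]
  · rintro r' m' t ⟨h1, h2⟩ hr ht
    refine ⟨hs1.trans h1, ?_, ?_⟩
    · rw [h2]
      constructor
      · rintro h ⟨hxA, c, hc, s, hs⟩
        exact h _ (mem_edges.2 ⟨hc, hxA, hs⟩) rfl
      · rintro h ⟨c, y, s⟩ he rfl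
        obtain ⟨h1, h2, h3⟩ := mem_edges.1 he
        exact h ⟨h2, c, h1, s, h3⟩
    · have := cost_le L.length d (10 + 9) 8 4
      omega

theorem filter_spec (hG : G.InClass (d : ℤ) Set.univ) (hc : Ctx A L r m) {x : Fin G.numVar}
    {s : Bool} (hx : r 20 = x) (hs : r 21 = if s then 1 else 0) (hxA : x ∉ A) :
    Proc procedures 41 r m fun m' t => Same [2, 3, 16] m m' ∧
      Ext 2 3 m m' ((L.filter fun c => ¬ G.Edge s x c).map Fin.val) ∧
      t ≤ 60 * ((d + 1) * (L.length + 1)) := by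
  refine .intro (c := filterCmd) rfl ?_
  refine wp_forEach_uniform L (f := Fin.val) (d * (10 + 9) + 15) (fun pre m' => Same [2, 3, 16] m m' ∧
    Ext 2 3 m m' ((pre.filter fun c => ¬ G.Edge s x c).map Fin.val))
    (fun pre m' h => (hc.mem h.1 (by simp) h.2.grow).seg) hc.len
    ⟨.refl _ _, .of_eq rfl rfl⟩ ?_ ?_
  · rintro pre c post m' r' hL ⟨h1, h2⟩ h8 hr
    refine .intro (c := filterClause) rfl ?_
    have h0 : r' 0 = 0 := by rw [hr 0 (by simp) (by simp), hc.zero]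
    simp only [filterClause, seqs, wp_seq, wp_store, setMem_mk, h0]
    have hs1 : Same [2, 3, 16] m (setCell m' 16 0 0) := h1.trans (same_setCell _ (by simp) _ _)
    refine wp_litsOf (B := 10) hG (hc.repr.same hs1 (by simp)) [16] (by simp)
      (fun pre m'' => Same [16] (setCell m' 16 0 0) m'' ∧ (m'' 16 0 = 0 ↔ (x, s) ∉ pre))
      (fun _ _ h => h.1) h0 h8 ⟨.refl _ _, by simp⟩ ?_ ?_
    · rintro pl ⟨y, b⟩ post' m'' r'' hl ⟨g1, g2⟩ h9 h10 hr'
      refine .intro (c := filterLit) rfl ?_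
      have h0 : r'' 0 = 0 := by rw [hr' 0 (by simp), h0]
      have h20 : r'' 20 = x := by rw [hr' 20 (by simp), hr 20 (by simp) (by simp), hx]
      have h21 : r'' 21 = if s then 1 else 0 := by
        rw [hr' 21 (by simp), hr 21 (by simp) (by simp), hs]
      have hbs : r'' 10 = r'' 21 ↔ b = s := by
        rw [h10, h21]
        cases b <;> cases s <;> simp
      simp only [filterLit, wp_ite, holds_eq, hbs]
      simp only [h9, h20, Fin.val_inj, seqs, wp_seq, wp_const, wp_store, setReg_mk, setMem_mk, wp_skip]
      refine ⟨fun h => ⟨fun h' => ?_, fun h' => ?_⟩, fun h => ?_⟩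
      · refine ⟨⟨g1.trans (same_setCell _ (by simp) _ _), ?_⟩, by omega⟩
        simp [h0, h, h']
      · refine ⟨⟨g1, ?_⟩, by omega⟩
        have : s ≠ b := fun h => h' h.symm
        simp [g2, this]
      · refine ⟨⟨g1, ?_⟩, by omega⟩
        have : x ≠ y := fun h' => h h'.symm
        simp [g2, this]
    · rintro r'' m'' t ⟨g1, g2⟩ hr' ht
      have h0' : r'' 0 = 0 := by rw [hr' 0 (by simp), h0]
      have g3 := hs1.trans (g1.mono (s' := [2, 3, 16]) (by simp))
      have g4 : Ext 2 3 m m'' ((pre.filter fun c => ¬ G.Edge s x c).map Fin.val) :=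
        h2.congr (by rw [g1 2 (by simp)]; simp) (by rw [g1 3 (by simp)]; simp)
      -- The scan skips assigned variables; it sees the literals of `x` because `x ∉ A`.
      have hedge : m'' 16 0 = 0 ↔ ¬ G.Edge s x c := by rw [g2, mem_lits]; simp [hxA]
      have hreg8 : r'' 8 = c := by rw [hr' 8 (by simp), h8]
      simp only [wp_load, wp_ite, setReg_mk, holds_eq, h0', Function.update_self, ne_eq,
        not_false_eq_true, Function.update_of_ne, OfNat.zero_ne_ofNat]
      refine ⟨fun h => ?_, fun h => ?_⟩
      · rw [wp_pushHeap (by simp) (by simp [h0'])]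
        refine ⟨⟨g3.trans (same_pushMem (by simp) (by simp) _ _), ?_⟩, by omega⟩
        simpa [List.filter_append, hedge.1 h, hreg8] using g4.push (by simp) c
      · simp only [wp_skip]
        refine ⟨⟨g3, ?_⟩, by omega⟩
        have : G.Edge s x c := by
          by_contra hn
          exact h (hedge.2 hn)
        simpa [List.filter_append, this] using g4
  · rintro r' m' t ⟨h1, h2⟩ hr ht
    refine ⟨h1, h2, ?_⟩
    have := cost_le L.length d (10 + 9) (15 + 3) 3
    rw [add_assoc] at ht
    omega

end Ram

-- Finding a widest clause, copying, gathering variables, and writing labels.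

namespace Ram

open IncGraph

variable {G : IncGraph} {A : Finset (Fin G.numVar)} {L : List (Fin G.numCla)}
  {r : ℕ → ℕ} {m : Mem} {d : ℕ}

theorem width_spec (hG : G.InClass (d : ℤ) Set.univ) (hc : Ctx A L r m) (hd : r 1 = d) :
    Proc procedures 42 r m fun m' t => Same [16, 23] m m' ∧
      ((m' 16 0 = 0 ∧ ∀ c ∈ L, (G.lits A c).length ≠ d) ∨
        ∃ c ∈ L, m' 16 0 = c + 1 ∧ (G.lits A c).length = d) ∧
      t ≤ 60 * ((d + 1) * (L.length + 1)) := by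
  refine .intro (c := widthCmd) rfl ?_
  simp only [widthCmd, seqs, wp_seq, wp_store, setMem_mk, hc.zero]
  have hs0 : Same [16, 23] m (setCell m 16 0 0) := same_setCell m (by simp) _ _
  refine wp_forEach_uniform L (f := Fin.val) (d * (10 + 9) + 15)
    (fun pre m' => Same [16, 23] m m' ∧
      ((m' 16 0 = 0 ∧ ∀ c ∈ pre, (G.lits A c).length ≠ d) ∨
        ∃ c ∈ pre, m' 16 0 = c + 1 ∧ (G.lits A c).length = d))
    (fun pre m' h => (hc.same h.1 (by simp)).seg) hc.len
    ⟨hs0, .inl (by simp)⟩ ?_ ?_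
  · rintro pre c post m' r' hL ⟨h1, h2⟩ h8 hr
    refine .intro (c := widthClause) rfl ?_
    have h0 : r' 0 = 0 := by rw [hr 0 (by simp) (by simp), hc.zero]
    simp only [widthClause, seqs, wp_seq, wp_store, setMem_mk, h0]
    have hs1 : Same [16, 23] m (setCell m' 23 0 0) := h1.trans (same_setCell _ (by simp) _ _)
    refine wp_litsOf (B := 10) hG (hc.repr.same hs1 (by simp)) [23] (by simp)
      (fun pre m'' => Same [23] (setCell m' 23 0 0) m'' ∧ m'' 23 0 = pre.length)
      (fun _ _ h => h.1) h0 h8 ⟨.refl _ _, by simp⟩ ?_ ?_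
    · rintro pl ⟨y, b⟩ post' m'' r'' hl ⟨g1, g2⟩ h9 h10 hr'
      refine .intro (c := widthLit) rfl ?_
      have h0 : r'' 0 = 0 := by rw [hr' 0 (by simp), h0]
      simp only [widthLit, seqs, wp_seq, wp_load, wp_inc, wp_store, setReg_mk, setMem_mk]
      refine ⟨⟨g1.trans (same_setCell _ (by simp) _ _), ?_⟩, by omega⟩
      simp [h0, g2]
    · rintro r'' m'' t ⟨g1, g2⟩ hr' ht
      have h0' : r'' 0 = 0 := by rw [hr' 0 (by simp), h0]
      have h1' : r'' 1 = d := by rw [hr' 1 (by simp), hr 1 (by simp) (by simp), hd]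
      have hreg8 : r'' 8 = c := by rw [hr' 8 (by simp), h8]
      have g3 := hs1.trans (g1.mono (s' := [16, 23]) (by simp))
      have g16 : m'' 16 = m' 16 := by rw [g1 16 (by simp)]; simp
      simp only [wp_load, wp_ite, setReg_mk, holds_eq, h0', g2, h1', Function.update_self, ne_eq,
        not_false_eq_true, Function.update_of_ne, OfNat.one_ne_ofNat]
      refine ⟨fun h => ?_, fun h => ?_⟩
      · simp only [wp_seq, wp_inc, wp_store, setReg_mk, setMem_mk]
        refine ⟨⟨g3.trans (same_setCell _ (by simp) _ _), .inr ⟨c, by simp, ?_, h⟩⟩, by omega⟩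
        simp [h0', hreg8]
      · simp only [wp_skip]
        refine ⟨⟨g3, ?_⟩, by omega⟩
        rw [g16]
        rcases h2 with ⟨e1, e2⟩ | ⟨c', e1, e2⟩
        · refine .inl ⟨e1, fun c' hc' => ?_⟩
          rcases List.mem_append.1 hc' with hc' | hc'
          · exact e2 c' hc'
          · rwa [List.mem_singleton.1 hc']
        · exact .inr ⟨c', by simp [e1], e2⟩
  · rintro r' m' t ⟨h1, h2⟩ hr ht
    refine ⟨h1, h2, ?_⟩
    have := cost_le L.length d (10 + 9) (15 + 3) 5
    rw [add_assoc] at ht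
    omega

theorem copy_spec {l : List ℕ} {s : ℕ} (h0 : r 0 = 0) (h28 : r 28 = s) (h29 : r 29 = s + l.length)
    (hs : Seg (m 2) s l) (hl : s + l.length ≤ m 3 0) :
    Proc procedures 30 r m fun m' t => Same [2, 3] m m' ∧ Ext 2 3 m m' l ∧
      t ≤ 7 * l.length + 2 := by
  refine .intro (c := copyCmd) rfl ?_
  refine wp_loop (fun i σ t => Same [2, 3] m σ.mem ∧ Ext 2 3 m σ.mem (l.take i) ∧ σ.reg 0 = 0 ∧
    σ.reg 28 = s + i ∧ σ.reg 29 = s + l.length ∧ t = 7 * i) l.length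
    ⟨.refl _ _, .of_eq rfl rfl, h0, h28, h29, rfl⟩ ?_ ?_
  · rintro i hi ⟨r₁, m₁⟩ t ⟨a1, a2, a3, a4, a5, a6⟩
    simp only at a1 a2 a3 a4 a5
    refine ⟨by simp [a4, a5, hi], ?_⟩
    -- The source lies below the old top of the heap, so appending the copy does not disturb it.
    have hv : m₁ 2 (s + i) = l[i] := by
      have := a2.grow.seg hs hl
      have := seg_iff_getD.1 this i hi
      simpa [hi] using this
    refine WP.hide fun Q hQ => ?_
    simp [seqs, a3, a4, hv]
    refine hQ _ _ ?_
    simp [a3, a5, a6]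
    refine ⟨a1.trans (same_pushMem (by simp) (by simp) _ _), ?_, by ring, by omega⟩
    rw [List.take_add_one, List.getElem?_eq_getElem hi]
    exact a2.push (by simp) l[i]
  · rintro ⟨r₁, m₁⟩ t ⟨a1, a2, a3, a4, a5, a6⟩
    simp only at a1 a2 a3 a4 a5
    refine ⟨by simp [a4, a5], a1, by simpa using a2, by omega⟩

theorem length_edges_le (hG : G.InClass (d : ℤ) Set.univ) (L : List (Fin G.numCla)) :
    (edges A L).length ≤ d * L.length := by
  induction L with
  | nil => simp [edges]
  | cons c L ih =>
    have := length_lits_le (A := A) hG c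
    simp only [edges, List.flatMap_cons, List.length_append, List.length_map] at ih ⊢
    rw [List.length_cons, mul_add]
    omega

/-- Repetitions in `xs` are harmless: a variable that has already been assigned no longer occurs and
is skipped by the branching. The length bound counts them. -/
theorem gather_spec {cl : List (Fin G.numCla)} (hG : G.InClass (d : ℤ) Set.univ) (h0 : r 0 = 0)
    (hm : Repr A m) (hs : Seg (m 2) (r 25) (cl.map Fin.val)) (h26 : r 26 = r 25 + cl.length)
    (htop : r 26 ≤ m 3 0) :
    Proc procedures 29 r m fun m' t => Same [2, 3] m m' ∧
      (∃ xs : List (Fin G.numVar), Ext 2 3 m m' (xs.map Fin.val) ∧ xs.length ≤ d * cl.length ∧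
        ∀ x, x ∈ xs ↔ x ∉ A ∧ ∃ c ∈ cl, ∃ s, G.Edge s x c) ∧
      t ≤ 40 * ((d + 1) * (cl.length + 1)) := by
  refine .intro (c := gatherCmd) rfl ?_
  simp only [gatherCmd, seqs, wp_seq, wp_copy, setReg_mk]
  refine wp_scan (L := cl) (A := A) (q := 28) (B := 10) rfl hG
    ⟨by simpa using h0, hm, by simpa using hs, by simpa using h26, by simpa using htop⟩ [2, 3] (by simp)
    (fun pre m' => Same [2, 3] m m' ∧ Ext 2 3 m m' ((pre.map fun e => e.2.1).map Fin.val))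
    (fun pre m' h => ⟨h.1, h.2.grow⟩) ⟨.refl _ _, .of_eq rfl rfl⟩ ?_ ?_
  · rintro pre c y b post m' r' he ⟨h1, h2⟩ h8 h9 h10 hr
    refine .intro (c := pushCmd 2 3 9) rfl ?_
    have h0 : r' 0 = 0 := by rw [hr 0 (by simp)]; simpa using h0
    rw [wp_pushHeap (by simp) h0, h9]
    refine ⟨⟨h1.trans (same_pushMem (by simp) (by simp) _ _), ?_⟩, by omega⟩
    simpa using h2.push (by simp) y
  · rintro r' m' t ⟨h1, h2⟩ hr ht
    refine ⟨h1, ⟨_, h2, by simpa using length_edges_le hG cl, ?_⟩, ?_⟩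
    · intro x
      simp only [List.mem_map, Prod.exists, mem_edges]
      constructor
      · rintro ⟨c, y, s, ⟨h1, h2, h3⟩, rfl⟩
        exact ⟨h2, c, h1, s, h3⟩
      · rintro ⟨h2, c, h1, s, h3⟩
        exact ⟨c, x, s, ⟨h1, h2, h3⟩, rfl⟩
    · have := cost_le cl.length d (10 + 9) 8 5
      omega

/-- The first pass lists the clauses and clears the marks of exactly the variables that occur in
them; the second lists each variable on its first occurrence and marks it. Thus duplicates are
avoided in time linear in the current graph, without clearing a whole array. -/
theorem label_spec (hG : G.InClass (d : ℤ) Set.univ) (hc : Ctx A L r m) (hL : L.Nodup) :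
    Proc procedures 0 r m fun m' t => Same [1, 14, 23, 24] m m' ∧
      (∃ W : List G.Vertex, W.Nodup ∧ {v | v ∈ W} = G.vset L A ∧
        Ext 1 14 m m' (vertexListCode W)) ∧
      t ≤ 140 * ((d + 1) * (L.length + 1)) := by
  refine .hide (c := labelCmd) rfl fun Q hQ => ?_
  simp only [labelCmd, seqs, wp_seq, wp_load, wp_store, setReg_mk, setMem_mk, hc.zero, ne_eq,
    not_false_eq_true, Function.update_of_ne, OfNat.zero_ne_ofNat, wp_pushOut]
  set m₀ := setCell (pushMem 1 14 m 0) 23 0 0 with hm₀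
  have hs0 : Same [1, 14, 23, 24] m m₀ :=
    (same_pushMem (by simp) (by simp) _ _).trans (same_setCell _ (by simp) _ _)
  have he0 : Ext 1 14 m m₀ [0] := (ext_pushMem (by simp) m 0).congr (by simp [m₀]) (by simp [m₀])
  have hc0 : Ctx A L (Function.update (Function.update r 16 (m 14 0)) 30 (m 14 0 + 1)) m₀ :=
    (hc.same hs0 (by simp)).reg (by simp) (by simp) (by simp)
  refine wp_forEach_uniform L (f := Fin.val) (d * (10 + 9) + 20)
    (fun pre m' => Same [1, 14, 23, 24] m m' ∧
      Ext 1 14 m m' (0 :: (pre.map Sum.inr).flatMap (vertexCode (G := G))) ∧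
      m' 23 0 = pre.length ∧ ∀ c ∈ pre, ∀ l ∈ G.lits A c, m' 24 l.1 = 0)
    (fun pre m' h => by simpa using (hc.same h.1 (by simp)).seg) (by simpa using hc.len)
    ⟨hs0, by simpa using he0, by simp [m₀], by simp⟩ ?_ ?_
  · rintro pre c post m' r' - ⟨h1, h2, h3, h4⟩ h8 hr
    refine .hide (c := labelClause) rfl fun Q hQ => ?_
    have h0 : r' 0 = 0 := by rw [hr 0 (by simp) (by simp), hc0.zero]
    simp [labelClause, seqs, h0, h8, h3, pushMem_ne]
    set m₁ := setCell (pushMem 1 14 (pushMem 1 14 m' 1) c) 23 0 (pre.length + 1) with hm₁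
    have hs1 : Same [1, 14, 23, 24] m m₁ :=
      ((h1.trans (same_pushMem (by simp) (by simp) _ _)).trans
        (same_pushMem (by simp) (by simp) _ _)).trans (same_setCell _ (by simp) _ _)
    have he1 : Ext 1 14 m m₁ (0 :: ((pre ++ [c]).map Sum.inr).flatMap (vertexCode (G := G))) := by
      have := (((h2.push (by simp) 1).push (by simp) c)).congr (m'' := m₁) (by simp [m₁])
        (by simp [m₁])
      simpa [vertexCode] using this
    refine wp_litsOf (c := c) (B := 10) hG (hc.repr.same hs1 (by simp)) [24] (by simp)
      (fun pl m'' => Same [24] m₁ m'' ∧ (∀ c ∈ pre, ∀ l ∈ G.lits A c, m'' 24 l.1 = 0) ∧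
        ∀ l ∈ pl, m'' 24 l.1 = 0)
      (fun _ _ h => h.1) (by simp [h0]) (by simp [h8])
      ⟨.refl _ _, by simpa [m₁, pushMem_ne] using h4, by simp⟩ ?_ ?_
    · rintro pl ⟨y, b⟩ post' m'' r'' hl ⟨g1, g2, g3⟩ h9 h10 hr'
      refine .intro (c := .store 24 9 0) rfl ?_
      have h0 : r'' 0 = 0 := by rw [hr' 0 (by simp)]; simp [h0]
      simp only [wp_store, setMem_mk, h9, h0]
      refine ⟨⟨g1.trans (same_setCell _ (by simp) _ _), ?_, ?_⟩, by omega⟩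
      · intro c hc l hl
        rw [setCell_apply, g2 c hc l hl, ite_self]
      · intro l hl
        rw [setCell_apply]
        split_ifs with h
        · rfl
        · rcases List.mem_append.1 hl with hl | hl
          · exact g3 l hl
          · rw [List.mem_singleton.1 hl] at h
            exact absurd rfl h
    · rintro r'' m'' t ⟨g1, g2, g3⟩ hr' ht
      refine hQ _ _ ⟨⟨hs1.trans (g1.mono (by simp)), he1.congr (g1 _ (by simp)) (g1 _ (by simp)), ?_, ?_⟩,
        by omega⟩
      · show m'' 23 0 = _
        rw [g1 23 (by simp)]
        simp [m₁]
      · intro c' hc' l hl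
        rcases List.mem_append.1 hc' with hc' | hc'
        · exact g2 c' hc' l hl
        · rw [List.mem_singleton.1 hc'] at hl
          exact g3 l hl
  · rintro r' m' t ⟨h1, h2, h3, h4⟩ hr ht
    have hreg : ∀ x, x ≠ 8 → x ≠ 11 → x ≠ 16 → x ≠ 30 → r' x = r x := by
      intro x a1 a2 a3 a4
      rw [hr x a1 a2]
      simp [a3, a4]
    have hc1 : Ctx A L r' m' := (hc.same h1 (by simp)).reg (hreg 0 (by simp) (by simp) (by simp)
      (by simp)) (hreg 6 (by simp) (by simp) (by simp) (by simp))
      (hreg 7 (by simp) (by simp) (by simp) (by simp))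
    refine wp_scan (q := 4) (B := 17) rfl hG hc1 [1, 14, 23, 24] (by simp)
      (fun pre m'' => Same [1, 14, 23, 24] m' m'' ∧ ∃ vs : List (Fin G.numVar), vs.Nodup ∧
        (∀ x, x ∈ vs ↔ ∃ e ∈ pre, e.2.1 = x) ∧
        Ext 1 14 m m'' (0 :: (L.map Sum.inr ++ vs.map Sum.inl).flatMap (vertexCode (G := G))) ∧
        m'' 23 0 = L.length + vs.length ∧
        ∀ e ∈ edges A L, m'' 24 e.2.1 = if e.2.1 ∈ vs then 1 else 0)
      (fun pre m'' h => ⟨h.1, .of_eq (h.1 _ (by simp)) (h.1 _ (by simp))⟩)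
      ⟨.refl _ _, [], by simp, by simp, by simpa using h2, by simpa using h3, ?_⟩ ?_ ?_
    · rintro ⟨c, x, s⟩ he
      obtain ⟨e1, e2, e3⟩ := mem_edges.1 he
      simpa using h4 c e1 (x, s) (mem_lits.2 ⟨e2, e3⟩)
    · rintro pre c x b post m'' r'' hL' ⟨g1, vs, g2, g3, g4, g5, g6⟩ h8 h9 h10 hr'
      refine .hide (c := labelVar) rfl fun Q hQ => ?_
      have h0 : r'' 0 = 0 := by rw [hr' 0 (by simp), hc1.zero]
      have hx := g6 (c, x, b) (by rw [hL']; simp)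
      simp only at hx
      simp only [labelVar, seqs, wp_seq, wp_load, setReg_mk, h9, wp_ite, holds_eq,
        Function.update_self, hx, ne_eq, not_false_eq_true, Function.update_of_ne, h0,
        OfNat.zero_ne_ofNat]
      refine ⟨fun h => ?_, fun h => ?_⟩
      · have hxvs : x ∉ vs := fun hn => by simp [hn] at h
        simp [h0, h9, pushMem_ne, g5]
        set m₂ := setCell (pushMem 1 14 (pushMem 1 14 (setCell m'' 24 x 1) 0) x)
            23 0 (L.length + vs.length + 1) with hm₂
        refine hQ _ _ ⟨⟨?_, vs ++ [x], ?_, ?_, ?_, ?_, ?_⟩, by omega⟩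
        · exact ((((g1.trans (same_setCell _ (by simp) _ _)).trans
            (same_pushMem (by simp) (by simp) _ _))).trans
            (same_pushMem (by simp) (by simp) _ _)).trans (same_setCell _ (by simp) _ _)
        · refine List.nodup_append.2 ⟨g2, by simp, ?_⟩
          rintro y hy z hz rfl
          exact hxvs (List.mem_singleton.1 hz ▸ hy)
        · intro y
          rw [List.mem_append, g3, List.mem_singleton]
          constructor
          · rintro (⟨e, he, rfl⟩ | rfl)
            · exact ⟨e, by simp [he], rfl⟩
            · exact ⟨(c, y, b), by simp, rfl⟩
          · rintro ⟨e, he, rfl⟩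
            rcases List.mem_append.1 he with he | he
            · exact .inl ⟨e, he, rfl⟩
            · rw [List.mem_singleton.1 he]
              exact .inr rfl
        · have := ((g4.congr (m'' := setCell m'' 24 x 1) (by simp) (by simp)).push (by simp) 0).push
            (by simp) x
          have := this.congr (m'' := m₂) (by simp [m₂]) (by simp [m₂])
          simpa [vertexCode] using this
        · simp [m₂, add_assoc]
        · intro e he
          have := g6 _ he
          rw [hm₂, setCell_ne _ (by simp), pushMem_ne (by simp) (by simp), pushMem_ne (by simp) (by simp),
            setCell_apply, this]
          by_cases hy : e.2.1 = x <;> simp [hy, Fin.val_inj]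
      · have hxvs : x ∈ vs := by
          by_contra hn
          simp [hn] at h
        simp only [wp_skip]
        refine hQ _ _ ⟨⟨g1, vs, g2, ?_, g4, g5, g6⟩, by omega⟩
        intro y
        rw [g3]
        constructor
        · rintro ⟨e, he, rfl⟩
          exact ⟨e, by simp [he], rfl⟩
        · rintro ⟨e, he, rfl⟩
          rcases List.mem_append.1 he with he | he
          · exact ⟨e, he, rfl⟩
          · rw [List.mem_singleton.1 he]
            exact (g3 _).1 hxvs
    · rintro r'' m'' t' ⟨g1, vs, g2, g3, g4, g5, g6⟩ hr' ht'
      have h0 : r'' 0 = 0 := by rw [hr' 0 (by simp), hc1.zero]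
      have h16 : r'' 16 = m 14 0 := by
        rw [hr' 16 (by simp), hr 16 (by simp) (by simp)]
        simp
      simp [h0, h16, g5]
      refine hQ _ _ ⟨(h1.trans g1).trans (same_setCell _ (by simp) _ _),
        ⟨L.map Sum.inr ++ vs.map Sum.inl, ?_, ?_, ?_⟩, ?_⟩
      · rw [List.nodup_append]
        refine ⟨hL.map Sum.inr_injective, g2.map Sum.inl_injective, ?_⟩
        simp
      · ext (x | c)
        · simp only [Set.mem_ofPred_eq, List.mem_append, List.mem_map, reduceCtorEq, and_false,
            exists_false, Sum.inl.injEq, exists_eq_right, false_or, g3, inl_mem_vset, Prod.exists,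
            mem_edges]
          constructor
          · rintro ⟨c, y, s, ⟨h1, h2, h3⟩, rfl⟩
            exact ⟨h2, c, h1, s, h3⟩
          · rintro ⟨h2, c, h1, s, h3⟩
            exact ⟨c, x, s, ⟨h1, h2, h3⟩, rfl⟩
        · simp
      · have := g4.setHead (by simp) (L.length + vs.length)
        rw [vertexListCode_eq]
        simpa using this
      · have := cost_le L.length d (10 + 9) (20 + 3) 2
        have := cost_le L.length d (17 + 9) 8 20
        rw [add_assoc] at ht
        omega

end Ram

namespace Ram

open IncGraph

variable {G : IncGraph} {A : Finset (Fin G.numVar)} {L : List (Fin G.numCla)}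
  {r : ℕ → ℕ} {m : Mem} {d : ℕ}

/-! ### Labels of components -/

/-- The component label of a vertex. -/
def label (m : Mem) : G.Vertex → ℕ
  | .inl x => m 7 x
  | .inr c => m 6 c

/-- Labels are clauses in the same component. -/
def LabelSound (S : Set G.Vertex) (m : Mem) : Prop :=
  ∀ v ∈ S, ∃ c : Fin G.numCla, label m v = c ∧ Reach S v (.inr c)

/-- Labels are at most the numbers of the clauses at distance at most `n`. -/
def LabelLe (S : Set G.Vertex) (n : ℕ) (m : Mem) : Prop :=
  ∀ (c : Fin G.numCla) (v : G.Vertex), Near S n (.inr c) v → label m v ≤ c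

/-- A clause is labeled by itself. A variable gets the last clause that contains it, which is a
neighbor; any clause of the component would be sound. -/
theorem compsInit_spec (hG : G.InClass (d : ℤ) Set.univ) (hc : Ctx A L r m)
    {Q : State → ℕ → Prop} (hQ : ∀ r' m' t, (∀ x, x ≤ 7 ∨ 16 ≤ x → r' x = r x) →
      Same [6, 7, 8] m m' → LabelSound (G.vset L A) m' → LabelLe (G.vset L A) 0 m' →
      (∀ c ∈ L, m' 8 c = 0) → t ≤ 50 * ((d + 1) * (L.length + 1)) → Q ⟨r', m'⟩ t) :
    WP procedures (forEach 11) ⟨r, m⟩ Q := by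
  refine wp_forEach_uniform L (f := Fin.val) (d * (10 + 9) + 7)
    (fun pre m' => Same [6, 7, 8] m m' ∧ (∀ c ∈ pre, m' 6 c = c ∧ m' 8 c = 0) ∧
      ∀ c ∈ pre, ∀ l ∈ G.lits A c, ∃ c' ∈ pre, ∃ s, m' 7 l.1 = c' ∧ G.Edge s l.1 c')
    (fun pre m' h => (hc.same h.1 (by simp)).seg) hc.len ⟨.refl _ _, by simp, by simp⟩ ?_ ?_
  · rintro pre c post m' r' hL ⟨h1, h2, h3⟩ h8 hr
    refine .hide (c := compsInitClause) rfl fun Q hQ => ?_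
    have h0 : r' 0 = 0 := by rw [hr 0 (by simp) (by simp), hc.zero]
    simp only [compsInitClause, seqs, wp_seq, wp_store, setMem_mk, h0, h8]
    set m₁ := setCell (setCell m' 6 c c) 8 c 0 with hm₁
    have hs1 : Same [6, 7, 8] m m₁ := (h1.trans (same_setCell _ (by simp) _ _)).trans
      (same_setCell _ (by simp) _ _)
    refine wp_litsOf (c := c) (B := 10) hG (hc.repr.same hs1 (by simp)) [7] (by simp)
      (fun pl m'' => Same [7] m₁ m'' ∧ (∀ l ∈ pl, m'' 7 l.1 = c) ∧
        ∀ y : ℕ, m'' 7 y = m' 7 y ∨ ∃ l ∈ pl, l.1.val = y)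
      (fun _ _ h => h.1) h0 h8 ⟨.refl _ _, by simp, fun y => .inl (by simp [m₁])⟩ ?_ ?_
    · rintro pl ⟨y, b⟩ post' m'' r'' hl ⟨g1, g2, g3⟩ h9 h10 hr'
      refine .intro (c := .store 7 9 8) rfl ?_
      have h8' : r'' 8 = c := by rw [hr' 8 (by simp), h8]
      simp only [wp_store, setMem_mk, h9, h8']
      refine ⟨⟨g1.trans (same_setCell _ (by simp) _ _), ?_, ?_⟩, by omega⟩
      · intro l hl
        rw [setCell_apply]
        split_ifs with h
        · rfl
        · rcases List.mem_append.1 hl with hl | hl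
          · exact g2 l hl
          · rw [List.mem_singleton.1 hl] at h
            exact absurd rfl h
      · intro z
        rw [setCell_apply]
        split_ifs with h
        · exact .inr ⟨(y, b), by simp, h.symm⟩
        · exact (g3 z).imp id fun ⟨l, hl, e⟩ => ⟨l, by simp [hl], e⟩
    · rintro r'' m'' t ⟨g1, g2, g3⟩ hr' ht
      refine hQ _ _ ⟨⟨hs1.trans (g1.mono (by simp)), ?_, ?_⟩, by omega⟩
      · intro c' hc'
        show m'' 6 c' = c' ∧ m'' 8 c' = 0
        rw [g1 6 (by simp), g1 8 (by simp)]
        simp only [m₁, setCell_apply, setCell_ne _ (show (6 : ℕ) ≠ 8 by simp),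
          setCell_ne _ (show (8 : ℕ) ≠ 6 by simp), Fin.val_inj]
        rcases List.mem_append.1 hc' with hc' | hc'
        · obtain ⟨e1, e2⟩ := h2 c' hc'
          rw [e1, e2]
          by_cases e : c' = c <;> simp [e]
        · simp [List.mem_singleton.1 hc']
      · intro c' hc' l hl
        show ∃ c' ∈ pre ++ [c], ∃ s, m'' 7 l.1 = c' ∧ G.Edge s l.1 c'
        -- Either the variable occurs in the current clause, and its label was just overwritten, or
        -- its old label is still there.
        by_cases hlc : ∃ b, (l.1, b) ∈ G.lits A c
        · obtain ⟨b, hb⟩ := hlc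
          exact ⟨c, by simp, b, g2 (l.1, b) hb, (mem_lits.1 hb).2⟩
        · have e : m'' 7 l.1 = m' 7 l.1 := by
            refine (g3 l.1).resolve_right ?_
            rintro ⟨⟨x, b⟩, hl', e⟩
            exact hlc ⟨b, by rwa [← Fin.val_injective e]⟩
          rcases List.mem_append.1 hc' with hc' | hc'
          · obtain ⟨c₁, e1, s, e2, e3⟩ := h3 c' hc' l hl
            exact ⟨c₁, by simp [e1], s, by rw [e, e2], e3⟩
          · rw [List.mem_singleton.1 hc'] at hl
            exact absurd ⟨l.2, hl⟩ hlc
  · rintro r' m' t ⟨h1, h2, h3⟩ hr ht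
    refine hQ r' m' t (fun x hx => hr x (by omega) (by omega)) h1 ?_ ?_ (fun c hc => (h2 c hc).2) ?_
    · rintro (x | c) hv
      · obtain ⟨hx, c, hc, s, hs⟩ := id hv
        obtain ⟨c', e1, s', e2, e3⟩ := h3 c hc (x, s) (mem_lits.2 ⟨hx, hs⟩)
        exact ⟨c', e2, 1, near_one hv (adj_inl_inr.2 ⟨s', e3⟩) e1⟩
      · exact ⟨c, (h2 c hv).1, 0, .refl _ hv⟩
    · intro c v hv
      cases hv with
      | refl _ h => exact (h2 c h).1.le
    · have := cost_le L.length d (10 + 9) (7 + 3) 2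
      rw [add_assoc] at ht
      omega

/-- Labels never increase, so after a pass over all edges in any order each label is at most the
label that a neighbor had before the pass. One round thus carries small labels one step further. -/
theorem round_spec (hG : G.InClass (d : ℤ) Set.univ) (hc : Ctx A L r m) {n : ℕ}
    (hs : LabelSound (G.vset L A) m) (hl : LabelLe (G.vset L A) n m) :
    Proc procedures 13 r m fun m' t => Same [6, 7] m m' ∧ LabelSound (G.vset L A) m' ∧
      LabelLe (G.vset L A) (n + 1) m' ∧ t ≤ 40 * ((d + 1) * (L.length + 1)) := by
  refine .intro (c := forEach 14) rfl ?_
  refine wp_scan (q := 15) (B := 10) rfl hG hc [6, 7] (by simp)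
    (fun pre m' => Same [6, 7] m m' ∧ LabelSound (G.vset L A) m' ∧
      (∀ v : G.Vertex, label m' v ≤ label m v) ∧
      ∀ e ∈ pre, label (G := G) m' (.inr e.1) ≤ label (G := G) m (.inl e.2.1) ∧
        label (G := G) m' (.inl e.2.1) ≤ label (G := G) m (.inr e.1))
    (fun pre m' h => ⟨h.1, .of_eq (h.1 _ (by simp)) (h.1 _ (by simp))⟩)
    ⟨.refl _ _, hs, fun _ => le_rfl, by simp⟩ ?_ ?_
  · rintro pre c x b post m' r' he ⟨h1, h2, h3, h4⟩ h8 h9 h10 hr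
    have hedge : (c, x, b) ∈ edges A L := by rw [he]; simp
    obtain ⟨hcL, hxA, hcx⟩ := mem_edges.1 hedge
    have hxS : Sum.inl x ∈ G.vset L A := ⟨hxA, c, hcL, b, hcx⟩
    have hrcx : Reach (G.vset L A) (.inr c) (.inl x) :=
      ⟨1, near_one hcL (adj_inr_inl.2 ⟨b, hcx⟩) hxS⟩
    suffices H : ∃ m₁ : Mem, Same [6, 7] m' m₁ ∧ (∀ v : G.Vertex, label m₁ v = label m' v ∨
        label m₁ v = min (label (G := G) m' (.inr c)) (label (G := G) m' (.inl x)) ∧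
          (v = .inr c ∨ v = .inl x)) ∧
        (∀ v : G.Vertex, v = .inr c ∨ v = .inl x →
          label m₁ v = min (label (G := G) m' (.inr c)) (label (G := G) m' (.inl x))) ∧
        Proc procedures 15 r' m' (fun m'' t => m'' = m₁ ∧ t ≤ 10) by
      obtain ⟨m₁, g1, g2, g3, g4⟩ := H
      refine g4.mono ?_
      rintro m₂ t ⟨e, ht⟩
      rw [e]
      have hle : ∀ v : G.Vertex, label m₁ v ≤ label m' v := by
        intro v
        rcases g2 v with h | ⟨h, rfl | rfl⟩
        · exact h.le
        · exact h.trans_le (min_le_left _ _)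
        · exact h.trans_le (min_le_right _ _)
      refine ⟨⟨h1.trans g1, ?_, fun v => (hle v).trans (h3 v), ?_⟩, ht⟩
      · intro v hv
        rcases g2 v with h | ⟨h, hv'⟩
        · rw [h]
          exact h2 v hv
        · obtain ⟨c₁, e1, e2⟩ := h2 _ (show Sum.inr c ∈ G.vset L A from hcL)
          obtain ⟨c₂, e3, e4⟩ := h2 _ hxS
          rw [h]
          rcases min_choice (label (G := G) m' (.inr c)) (label (G := G) m' (.inl x)) with h | h
          · refine ⟨c₁, by rw [h, e1], ?_⟩
            rcases hv' with rfl | rfl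
            · exact e2
            · exact hrcx.symm.trans e2
          · refine ⟨c₂, by rw [h, e3], ?_⟩
            rcases hv' with rfl | rfl
            · exact hrcx.trans e4
            · exact e4
      · intro e he
        rcases List.mem_append.1 he with he | he
        · exact ⟨(hle _).trans (h4 e he).1, (hle _).trans (h4 e he).2⟩
        · rw [List.mem_singleton.1 he]
          simp only
          rw [g3 _ (.inl rfl), g3 _ (.inr rfl)]
          exact ⟨(min_le_right _ _).trans (h3 _), (min_le_left _ _).trans (h3 _)⟩
    by_cases hlt : m' 6 c < m' 7 x
    · refine ⟨setCell m' 7 x (m' 6 c), same_setCell _ (by simp) _ _, ?_, ?_,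
        .intro (c := compsRelax) rfl ?_⟩
      · rintro (y | c')
        · by_cases hy : y = x
          · simp [label, hy, hlt.le]
          · simp [label, setCell_apply, hy, Fin.val_inj]
        · simp [label]
      · rintro v (rfl | rfl) <;> simp [label, hlt.le]
      · simp [compsRelax, seqs, h8, h9, wp_ite, hlt]
    · refine ⟨setCell m' 6 c (m' 7 x), same_setCell _ (by simp) _ _, ?_, ?_,
        .intro (c := compsRelax) rfl ?_⟩
      · rintro (y | c')
        · simp [label]
        · by_cases hy : c' = c
          · simp [label, hy, not_lt.1 hlt]
          · simp [label, setCell_apply, hy, Fin.val_inj]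
      · rintro v (rfl | rfl) <;> simp [label, not_lt.1 hlt]
      · simp only [compsRelax, seqs, wp_seq, wp_load, wp_ite, setReg_mk, h8]
        simp [h8, h9, hlt]
  · rintro r' m' t ⟨h1, h2, h3, h4⟩ hr ht
    refine ⟨h1, h2, ?_, ?_⟩
    · intro c v hv
      cases hv with
      | refl _ h => exact (h3 _).trans (hl _ _ (.refl _ h))
      | @tail _ _ w _ h ha hv =>
        -- The last edge of the walk has been relaxed in this round; the rest of the walk is covered
        -- by the previous bound.
        refine le_trans ?_ (hl _ _ h)
        have hw := h.right
        match w, v, ha with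
        | .inl x, .inr c', ⟨b, hb⟩ => exact (h4 (c', x, b) (mem_edges.2 ⟨hv, hw.1, hb⟩)).1
        | .inr c', .inl x, ⟨b, hb⟩ => exact (h4 (c', x, b) (mem_edges.2 ⟨hw, hv.1, hb⟩)).2
    · have := cost_le L.length d (10 + 9) 8 4
      omega

theorem check_spec (hG : G.InClass (d : ℤ) Set.univ) (hc : Ctx A L r m) (h16 : m 16 0 = 0)
    {Q : State → ℕ → Prop} (hQ : ∀ r' m' t, (∀ x, x ≤ 7 ∨ 16 ≤ x → r' x = r x) →
      Same [16] m m' → (m' 16 0 = 0 ↔ ∀ c x s, (c, x, s) ∈ edges A L → m 6 c = m 7 x) →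
      t ≤ 40 * ((d + 1) * (L.length + 1)) → Q ⟨r', m'⟩ t) :
    WP procedures (forEach 16) ⟨r, m⟩ Q := by
  refine wp_scan (q := 17) (B := 10) rfl hG hc [16] (by simp)
    (fun pre m' => Same [16] m m' ∧ (m' 16 0 = 0 ↔ ∀ e ∈ pre, m 6 e.1 = m 7 e.2.1))
    (fun pre m' h => ⟨h.1, .of_eq (h.1 _ (by simp)) (h.1 _ (by simp))⟩)
    ⟨.refl _ _, by simp [h16]⟩ ?_ ?_
  · rintro pre c x b post m' r' he ⟨h1, h2⟩ h8 h9 h10 hr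
    refine .hide (c := compsCheck) rfl fun Q hQ => ?_
    have h0 : r' 0 = 0 := by rw [hr 0 (by simp), hc.zero]
    have e6 := h1 6 (by simp)
    have e7 := h1 7 (by simp)
    simp [compsCheck, seqs, wp_ite, h8, h9, h0, e6, e7]
    refine ⟨fun h => ?_, fun h => ?_⟩
    · refine hQ _ _ ⟨⟨h1, ?_⟩, by omega⟩
      rw [h2]
      exact ⟨fun hh e he => (List.mem_append.1 he).elim (hh e) fun he => by
        rw [List.mem_singleton.1 he]; exact h, fun hh e he => hh e (by simp [he])⟩
    · refine hQ _ _ ⟨⟨h1.trans (same_setCell _ (by simp) _ _), ?_⟩, by omega⟩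
      exact iff_of_false (by simp) fun hh => h (hh (c, x, b) (by simp))
  · rintro r' m' t ⟨h1, h2⟩ hr ht
    refine hQ r' m' t hr h1 ?_ ?_
    · rw [h2]
      exact ⟨fun h c x s he => h _ he, fun h e he => h _ _ _ he⟩
    · have := cost_le L.length d (10 + 9) 8 4
      omega

end Ram

namespace Ram

open IncGraph

variable {G : IncGraph} {A : Finset (Fin G.numVar)} {L : List (Fin G.numCla)}
  {r : ℕ → ℕ} {m : Mem} {d : ℕ}

/-! ### Buckets -/

/-- The linked list starting with `h`, with successors in `nxt`, is `l`; the number `0` ends the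
list and `c + 1` stands for `c`. -/
def Chain (nxt : ℕ → ℕ) : ℕ → List ℕ → Prop
  | h, [] => h = 0
  | h, c :: l => h = c + 1 ∧ Chain nxt (nxt c) l

theorem Chain.congr {nxt nxt' : ℕ → ℕ} {h : ℕ} {l : List ℕ} (hc : Chain nxt h l)
    (hn : ∀ c ∈ l, nxt' c = nxt c) : Chain nxt' h l := by
  induction l generalizing h with
  | nil => exact hc
  | cons c l ih =>
    exact ⟨hc.1, by rw [hn c (by simp)]; exact ih hc.2 fun c hc => hn c (by simp [hc])⟩

/-- The clauses with label `c`, last one first. -/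
def bucket (m : Mem) (L : List (Fin G.numCla)) (c : Fin G.numCla) : List (Fin G.numCla) :=
  (L.filter fun c' : Fin G.numCla => m 6 c'.val = c.val).reverse

theorem mem_bucket {c c' : Fin G.numCla} : c' ∈ bucket m L c ↔ c' ∈ L ∧ m 6 c' = c := by
  simp [bucket]

theorem buckets_spec (hc : Ctx A L r m) (hL : L.Nodup) (h8 : ∀ c ∈ L, m 8 c = 0)
    (hlab : ∀ c ∈ L, ∃ c' ∈ L, m 6 c = c'.val)
    {Q : State → ℕ → Prop} (hQ : ∀ r' m' t, (∀ x, x ≤ 7 ∨ 16 ≤ x → r' x = r x) →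
      Same [8, 9] m m' → (∀ c ∈ L, Chain (m' 9) (m' 8 c) ((bucket m L c).map Fin.val)) →
      t ≤ 10 * L.length + 2 → Q ⟨r', m'⟩ t) :
    WP procedures (forEach 18) ⟨r, m⟩ Q := by
  refine wp_forEach_uniform L (f := Fin.val) 7
    (fun pre m' => Same [8, 9] m m' ∧
      ∀ c ∈ L, Chain (m' 9) (m' 8 c) ((bucket m pre c).map Fin.val))
    (fun pre m' h => (hc.same h.1 (by simp)).seg) hc.len
    ⟨.refl _ _, fun c hc => by simpa [bucket, Chain] using h8 c hc⟩ ?_ ?_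
  · rintro pre c post m' r' hL' ⟨h1, h2⟩ h8 hr
    refine .hide (c := compsBucket) rfl fun Q hQ => ?_
    have hcL : c ∈ L := by rw [hL']; simp
    obtain ⟨c', hc', e⟩ := hlab c hcL
    -- A clause not processed before is in no bucket yet, so setting its successor leaves all
    -- existing linked lists intact.
    have hcpre : c ∉ pre := fun hn => by
      rw [hL'] at hL
      exact (List.nodup_append.1 hL).2.2 c hn c (by simp) rfl
    have e6 := h1 6 (by simp)
    simp [compsBucket, seqs, h8, e6, e]
    refine hQ _ _ ⟨⟨(h1.trans (same_setCell _ (by simp) _ _)).trans (same_setCell _ (by simp) _ _),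
      ?_⟩, by omega⟩
    intro c₁ hc₁
    have h9 : ∀ x ∈ (bucket m pre c₁).map Fin.val, Function.update (m' 9) c (m' 8 c') x = m' 9 x := by
      intro x hx
      obtain ⟨y, hy, rfl⟩ := List.mem_map.1 hx
      rw [Function.update_of_ne]
      intro h
      rw [Fin.val_inj] at h
      exact hcpre (h ▸ (mem_bucket.1 hy).1)
    by_cases h : c₁ = c'
    · subst h
      have : bucket m (pre ++ [c]) c₁ = c :: bucket m pre c₁ := by
        simp [bucket, List.filter_append, e]
      rw [this]
      simp only [List.map_cons, Chain]
      refine ⟨by simp, ?_⟩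
      have := (h2 c₁ hc₁).congr h9
      simpa using this
    · have : bucket m (pre ++ [c]) c₁ = bucket m pre c₁ := by
        simp [bucket, List.filter_append, e, Fin.val_inj, Ne.symm h]
      rw [this]
      have := (h2 c₁ hc₁).congr h9
      simpa [h, Fin.val_inj] using this
  · rintro r' m' t ⟨h1, h2⟩ hr ht
    exact hQ r' m' t (fun x hx => hr x (by omega) (by omega)) h1 h2 (by omega)

/-- A list of lists in the heap from position `s` on: every list is preceded by the position of its
end. -/
def blocksCode : ℕ → List (List ℕ) → List ℕ
  | _, [] => []
  | s, K :: Ks => (s + 1 + K.length) :: (K ++ blocksCode (s + 1 + K.length) Ks)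

theorem blocksCode_append (s : ℕ) (Ks Ks' : List (List ℕ)) :
    blocksCode s (Ks ++ Ks') =
      blocksCode s Ks ++ blocksCode (s + (blocksCode s Ks).length) Ks' := by
  induction Ks generalizing s with
  | nil => simp [blocksCode]
  | cons K Ks ih =>
    simp only [List.cons_append, blocksCode, ih, List.append_assoc, List.length_cons,
      List.length_append]
    congr 4
    ring

theorem block_spec {c : Fin G.numCla} {K : List (Fin G.numCla)} (h0 : r 0 = 0) (h8 : r 8 = c)
    (hK : Chain (m 9) (m 8 c) (K.map Fin.val)) :
    Proc procedures 19 r m fun m' t => Same [2, 3, 21] m m' ∧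
      (K = [] → Ext 2 3 m m' [] ∧ m' 21 0 = m 21 0) ∧
      (K ≠ [] → Ext 2 3 m m' ((m 3 0 + 1 + K.length) :: K.map Fin.val) ∧ m' 21 0 = m 21 0 + 1) ∧
      t ≤ 7 * K.length + 20 := by
  refine .hide (c := compsBlock) rfl fun Q hQ => ?_
  have hnil : m 8 c = 0 ↔ K = [] := by
    match K with
    | [] => simpa [Chain] using hK
    | c :: K => simp [hK.1]
  simp [compsBlock, seqs, wp_ite, h0, h8, hnil]
  refine ⟨fun h => hQ _ _ ⟨.refl _ _, fun _ => ⟨.of_eq rfl rfl, rfl⟩, fun hn => absurd h hn, by omega⟩,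
    fun hne => ?_⟩
  refine wp_loop (fun i σ t => Same [2, 3] m σ.mem ∧ Ext 2 3 m σ.mem (0 :: (K.take i).map Fin.val) ∧
    Chain (m 9) (σ.reg 16) ((K.drop i).map Fin.val) ∧ σ.reg 0 = 0 ∧ σ.reg 18 = m 3 0 ∧ t = 7 * i)
    K.length ⟨same_pushMem (by simp) (by simp) _ _, by simpa using ext_pushMem (by simp) m 0,
      by simpa using hK, by simp [h0], by simp, rfl⟩ ?_ ?_
  · rintro i hi ⟨r₁, m₁⟩ t ⟨a1, a2, a3, a4, a5, a6⟩
    simp only at a1 a2 a3 a4 a5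
    rw [List.drop_eq_getElem_cons hi] at a3
    have e9 : m₁ 9 = m 9 := a1 9 (by simp)
    refine ⟨by simp [a4, a3.1], WP.hide fun Q hQ => ?_⟩
    simp [a4, a3.1, e9, pushMem_ne]
    refine hQ _ _ ⟨a1.trans (same_pushMem (by simp) (by simp) _ _), ?_, by simpa using a3.2,
      by simp [a4], by simp [a5], by omega⟩
    rw [List.take_add_one, List.getElem?_eq_getElem hi]
    have := a2.push (by simp) K[i].val
    simpa only [List.map_append, List.map_cons, List.map_nil, List.cons_append, Option.toList]
      using this
  · rintro ⟨r₁, m₁⟩ t ⟨a1, a2, a3, a4, a5, a6⟩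
    simp only at a1 a2 a3 a4 a5
    simp [Chain] at a3
    refine ⟨by simp [a3, a4], ?_⟩
    have e21 : m₁ 21 = m 21 := a1 21 (by simp)
    simp [a4, a5, e21]
    rw [List.take_length] at a2
    have htop := a2.top
    simp only [List.length_cons, List.length_map] at htop
    refine hQ _ _ ⟨((a1.mono (by simp)).trans (same_setCell _ (by simp) _ _)).trans
      (same_setCell _ (by simp) _ _), fun h => absurd h hne, fun _ => ⟨?_, by simp⟩, by omega⟩
    have := (a2.setHead (by simp) (m₁ 3 0)).congr
      (m'' := setCell (setCell m₁ 2 (m 3 0) (m₁ 3 0)) 21 0 (m 21 0 + 1)) (by simp) (by simp)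
    rwa [show m₁ 3 0 = m 3 0 + 1 + K.length by omega] at this ⊢

/-- Every clause is tried as a label and most buckets may be empty. The time is amortized: a
constant per label, plus the total size of the buckets. `m₀` is a memory from which the labels
defining the buckets are read. -/
theorem blocks_spec (hc : Ctx A L r m) (h21 : m 21 0 = 0) (m₀ : Mem)
    (hch : ∀ c ∈ L, Chain (m 9) (m 8 c) ((bucket m₀ L c).map Fin.val))
    {Q : State → ℕ → Prop} (hQ : ∀ r' m' t (Ks : List (List (Fin G.numCla))),
      Ks = (L.map (bucket m₀ L)).filter (fun K => K ≠ []) → Same [2, 3, 21] m m' →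
      Ext 2 3 m m' (blocksCode (m 3 0) (Ks.map (List.map Fin.val))) → m' 21 0 = Ks.length →
      t ≤ 30 * L.length + 7 * Ks.flatten.length + 10 → Q ⟨r', m'⟩ t) :
    WP procedures (forEach 19) ⟨r, m⟩ Q := by
  refine wp_forEach L (f := Fin.val)
    (fun pre m' t => Same [2, 3, 21] m m' ∧
      ∃ Ks, Ks = (pre.map (bucket m₀ L)).filter (fun K => K ≠ []) ∧
      Ext 2 3 m m' (blocksCode (m 3 0) (Ks.map (List.map Fin.val))) ∧ m' 21 0 = Ks.length ∧
      t ≤ 30 * pre.length + 7 * Ks.flatten.length)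
    ?_ hc.len ⟨.refl _ _, [], by simp, .of_eq rfl rfl, by simpa using h21, by simp⟩ ?_ ?_
  · rintro pre m' t ⟨h1, Ks, -, h2, -⟩
    exact (hc.mem h1 (by simp) h2.grow).seg
  · rintro pre c post m' t r' hL' ⟨h1, Ks, h2, h3, h4, h5⟩ h8 hr
    have hcL : c ∈ L := by rw [hL']; simp
    have h0 : r' 0 = 0 := by rw [hr 0 (by simp) (by simp), hc.zero]
    have hK := hch c hcL
    rw [← h1 8 (by simp), ← h1 9 (by simp)] at hK
    refine (block_spec h0 h8 hK).mono ?_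
    rintro m'' t' ⟨g1, g2, g3, g4⟩
    refine ⟨h1.trans g1, ?_⟩
    by_cases hn : bucket m₀ L c = []
    · obtain ⟨g5, g6⟩ := g2 hn
      refine ⟨Ks, by simp [h2, hn], by simpa using h3.trans g5, by rw [g6, h4], ?_⟩
      rw [hn, List.length_nil] at g4
      rw [List.length_append, List.length_singleton]
      omega
    · obtain ⟨g5, g6⟩ := g3 hn
      refine ⟨Ks ++ [bucket m₀ L c], by simp [h2, hn], ?_, by simp [g6, h4], ?_⟩
      · have := h3.trans g5
        rw [h3.top] at this
        simpa [blocksCode_append, blocksCode] using this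
      · rw [List.flatten_append, List.length_append, List.length_append, List.length_singleton,
          List.flatten_singleton]
        omega
  · rintro r' m' t ⟨h1, Ks, h2, h3, h4, h5⟩ hr
    exact hQ r' m' _ Ks h2 h1 h3 h4 (by omega)

end Ram

-- Stable labels determine the components.

namespace Ram

open IncGraph

variable {G : IncGraph} {A : Finset (Fin G.numVar)} {L : List (Fin G.numCla)}
  {r : ℕ → ℕ} {m : Mem} {d : ℕ}

theorem label_eq_of_reach (he : ∀ c x s, (c, x, s) ∈ edges A L → m 6 c = m 7 x) {u v : G.Vertex}
    (h : Reach (G.vset L A) u v) : label m u = label m v := by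
  obtain ⟨n, h⟩ := h
  induction h with
  | refl => rfl
  | @tail _ _ w v h ha hv ih =>
    rw [ih]
    have hw := h.right
    match w, v, ha with
    | .inl x, .inr c', ⟨b, hb⟩ => exact (he c' x b (mem_edges.2 ⟨hv, hw.1, hb⟩)).symm
    | .inr c', .inl x, ⟨b, hb⟩ => exact he c' x b (mem_edges.2 ⟨hw, hv.1, hb⟩)

/-- Labels that agree along all edges are constant on components. Conversely, a label names a clause
of the component, so equal labels mean a common component. -/
theorem reach_iff_label (he : ∀ c x s, (c, x, s) ∈ edges A L → m 6 c = m 7 x)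
    (hs : LabelSound (G.vset L A) m) {c c' : Fin G.numCla} (hc : c ∈ L) (hc' : c' ∈ L) :
    Reach (G.vset L A) (.inr c) (.inr c') ↔ m 6 c = m 6 c' := by
  refine ⟨fun h => label_eq_of_reach he h, fun h => ?_⟩
  obtain ⟨c₁, h1, h2⟩ := hs (.inr c) hc
  obtain ⟨c₂, h3, h4⟩ := hs (.inr c') hc'
  obtain rfl : c₁ = c₂ := by
    rw [← Fin.val_inj]
    exact (h1.symm.trans h).trans h3
  exact h2.trans h4.symm

theorem compList_of_labels (he : ∀ c x s, (c, x, s) ∈ edges A L → m 6 c = m 7 x)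
    (hs : LabelSound (G.vset L A) m) (hL : L.Nodup) :
    CompList L A ((L.map (bucket m L)).filter (fun K => K ≠ [])) := by
  have hKs : ∀ K, K ∈ (L.map (bucket m L)).filter (fun K => K ≠ []) ↔
      (∃ c ∈ L, bucket m L c = K) ∧ K ≠ [] := by simp
  refine ⟨?_, fun K hK => ((hKs K).1 hK).2, ?_⟩
  · rw [List.perm_ext_iff_of_nodup ?_ hL]
    · intro c
      rw [List.mem_flatten]
      constructor
      · rintro ⟨K, hK, hc⟩
        obtain ⟨⟨c', -, rfl⟩, -⟩ := (hKs K).1 hK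
        exact (mem_bucket.1 hc).1
      · intro hc
        obtain ⟨c₁, h1, n, h2⟩ := hs (.inr c) hc
        have hmem : c ∈ bucket m L c₁ := mem_bucket.2 ⟨hc, h1⟩
        exact ⟨_, (hKs _).2 ⟨⟨c₁, h2.right, rfl⟩, List.ne_nil_of_mem hmem⟩, hmem⟩
    · rw [List.nodup_flatten]
      constructor
      · intro K hK
        obtain ⟨⟨c', -, rfl⟩, -⟩ := (hKs K).1 hK
        exact List.nodup_reverse.2 (hL.filter _)
      · refine List.Pairwise.filter _ (List.pairwise_map.2 (hL.imp ?_))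
        intro c c' hne x hx hx'
        exact hne (Fin.val_injective ((mem_bucket.1 hx).2.symm.trans (mem_bucket.1 hx').2))
  · intro K hK c hc c'
    obtain ⟨⟨c₁, -, rfl⟩, -⟩ := (hKs K).1 hK
    obtain ⟨h1, h2⟩ := mem_bucket.1 hc
    rw [mem_bucket]
    constructor
    · rintro ⟨h3, h4⟩
      exact (reach_iff_label he hs h1 h3).2 (h2.trans h4.symm)
    · rintro ⟨n, h⟩
      exact ⟨h.right, ((reach_iff_label he hs h1 h.right).1 ⟨n, h⟩).symm.trans h2⟩

/-- The label of `x` is a clause of the component, hence within distance `n` of `c`, so the label of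
`c` is at most that of `x`; the converse holds by symmetry. -/
theorem label_eq_of_smallDiam (hR : Red (G.vset L A)) {n : ℕ} (hD : G.SmallDiam n)
    (hs : LabelSound (G.vset L A) m) (hl : LabelLe (G.vset L A) n m) (c : Fin G.numCla)
    (x : Fin G.numVar) (s : Bool) (he : (c, x, s) ∈ edges A L) : m 6 c = m 7 x := by
  obtain ⟨hc, hx, hcx⟩ := mem_edges.1 he
  have hxS : Sum.inl x ∈ G.vset L A := ⟨hx, c, hc, s, hcx⟩
  have hr : Reach (G.vset L A) (.inr c) (.inl x) := ⟨1, near_one hc (adj_inr_inl.2 ⟨s, hcx⟩) hxS⟩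
  obtain ⟨c₁, h1, h2⟩ := hs (.inr c) hc
  obtain ⟨c₂, h3, h4⟩ := hs _ hxS
  have a1 := hl c₂ (.inr c) (hD _ hR _ _ (hr.trans h4).symm)
  have a2 := hl c₁ (.inl x) (hD _ hR _ _ (hr.symm.trans h2).symm)
  rw [← h3] at a1
  rw [← h1] at a2
  exact le_antisymm a1 a2

/-- After `lam` rounds the labels are checked along all edges. Agreement gives the components; a
disagreement shows that some component has diameter larger than `lam`. -/
theorem comps_spec (hG : G.InClass (d : ℤ) Set.univ) (hc : Ctx A L r m) (hL : L.Nodup)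
    (hR : Red (G.vset L A)) {lam : ℕ} (h2 : r 2 = lam) :
    Proc procedures 20 r m fun m' t => Same [2, 3, 6, 7, 8, 9, 16, 21, 22] m m' ∧
      Grow 2 3 m m' ∧ t ≤ 200 * ((lam + 1) * ((d + 1) * (L.length + 1))) ∧
      ((m' 16 0 = 0 ∧ m' 22 0 = m 3 0 ∧ ∃ Ks : List (List (Fin G.numCla)), CompList L A Ks ∧
          m' 21 0 = Ks.length ∧
          Ext 2 3 m m' (blocksCode (m 3 0) (Ks.map (List.map Fin.val)))) ∨
        (m' 16 0 ≠ 0 ∧ ¬ G.SmallDiam lam)) := by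
  set E := (d + 1) * (L.length + 1) with hE
  have hE1 : L.length + 1 ≤ E := by rw [hE]; nlinarith [Nat.zero_le (d * (L.length + 1))]
  refine .hide (c := compsCmd) rfl fun Q hQ => ?_
  simp only [compsCmd, seqs, wp_seq]
  refine compsInit_spec hG hc ?_
  intro r₁ m₁ t₁ hr₁ hs₁ hso₁ hle₁ h8₁ ht₁
  simp only [wp_const, setReg_mk]
  refine wp_loop (fun i σ t => Same [6, 7] m₁ σ.mem ∧ LabelSound (G.vset L A) σ.mem ∧
    LabelLe (G.vset L A) i σ.mem ∧ σ.reg 22 = i ∧ (∀ x, x ≤ 7 → σ.reg x = r x) ∧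
    t ≤ i * (40 * E + 3)) lam ⟨.refl _ _, hso₁, hle₁, by simp, ?_, by simp⟩ ?_ ?_
  · intro x hx
    have : x ≠ 22 := by omega
    simp [this, hr₁ x (by omega)]
  · rintro i hi ⟨r₂, m₂⟩ t ⟨a1, a2, a3, a4, a5, a6⟩
    simp only at a1 a2 a3 a4 a5
    have hs₂ : Same [6, 7, 8] m m₂ := hs₁.trans (a1.mono (by simp))
    have hc₂ : Ctx A L r₂ m₂ := (hc.same hs₂ (by simp)).reg (a5 0 (by simp)) (a5 6 (by simp))
      (a5 7 (by simp))
    refine ⟨by simp [a4, a5 2 (by simp), h2, hi], ?_⟩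
    simp only [wp_seq]
    refine (round_spec hG hc₂ a2 a3).wp ?_
    rintro m₃ t₃ ⟨b1, b2, b3, b4⟩
    simp only [wp_inc, setReg_mk]
    refine ⟨a1.trans b1, b2, b3, by simp [a4], ?_, ?_⟩
    · intro x hx
      have : x ≠ 22 := by omega
      simp [this, a5 x hx]
    · rw [add_mul]
      change t₃ ≤ 40 * E at b4
      omega
  · rintro ⟨r₂, m₂⟩ t ⟨a1, a2, a3, a4, a5, a6⟩
    simp only at a1 a2 a3 a4 a5
    have hs₂ : Same [6, 7, 8] m m₂ := hs₁.trans (a1.mono (by simp))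
    have h0 : r₂ 0 = 0 := by rw [a5 0 (by simp), hc.zero]
    refine ⟨by simp [a4, a5 2 (by simp), h2], ?_⟩
    simp only [wp_store, setMem_mk, h0]
    set m₃ := setCell m₂ 16 0 0 with hm₃
    have hs₃ : Same [16] m₂ m₃ := same_setCell _ (by simp) _ _
    have hs₃' : Same [6, 7, 8, 16] m m₃ := (hs₂.mono (by simp)).trans (hs₃.mono (by simp))
    have hc₃ : Ctx A L r₂ m₃ := (hc.same hs₃' (by simp)).reg (a5 0 (by simp)) (a5 6 (by simp))
      (a5 7 (by simp))
    refine check_spec hG hc₃ (by simp [m₃]) ?_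
    intro r₄ m₄ t₄ hr₄ hs₄ h16 ht₄
    have hs₂₄ : Same [16] m₂ m₄ := hs₃.trans hs₄
    have hs₄' : Same [6, 7, 8, 16] m m₄ := hs₃'.trans (hs₄.mono (by simp))
    have h0' : r₄ 0 = 0 := by rw [hr₄ 0 (by simp), h0]
    rw [hm₃, setCell_ne _ (by simp), setCell_ne _ (by simp)] at h16
    have htime : t ≤ lam * (43 * E) :=
      a6.trans (Nat.mul_le_mul_left _ (by omega))
    rw [show lam * (43 * E) = 43 * (lam * E) by ring] at htime
    have hexp : (lam + 1) * E = lam * E + E := by ring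
    simp only [wp_load, setReg_mk, wp_ite, holds_eq, h0', Function.update_self, ne_eq,
      not_false_eq_true, Function.update_of_ne, OfNat.zero_ne_ofNat]
    refine ⟨fun hz => ?_, fun hz => ?_⟩
    · have hedge := h16.1 hz
      have hlabel : ∀ c ∈ L, ∃ c' ∈ L, m₄ 6 c = c'.val := by
        intro c hc
        obtain ⟨c', e1, n, e2⟩ := a2 (.inr c) hc
        exact ⟨c', e2.right, by rw [hs₂₄ 6 (by simp)]; exact e1⟩
      have hb : ∀ c : Fin G.numCla, bucket m₄ L c = bucket m₂ L c := by
        intro c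
        simp only [bucket, hs₂₄ 6 (by simp)]
      have hc₅ : Ctx A L (Function.update r₄ 16 (m₄ 16 0)) m₄ := by
        refine (hc₃.same hs₄ (by simp)).reg ?_ ?_ ?_
        · simp [hr₄ 0 (by simp)]
        · simp [hr₄ 6 (by simp)]
        · simp [hr₄ 7 (by simp)]
      simp only [wp_seq]
      refine buckets_spec hc₅ hL (fun c hc => ?_) hlabel ?_
      · rw [hs₂₄ 8 (by simp), a1 8 (by simp)]
        exact h8₁ c hc
      intro r₆ m₆ t₆ hr₆ hs₆ hch ht₆
      have h0₆ : r₆ 0 = 0 := by rw [hr₆ 0 (by simp)]; simp [h0']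
      simp only [wp_load, wp_store, setReg_mk, setMem_mk, h0₆, ne_eq,
        not_false_eq_true, Function.update_of_ne, OfNat.zero_ne_ofNat, Function.update_self]
      set m₇ := setCell (setCell m₆ 22 0 (m₆ 3 0)) 21 0 0 with hm₇
      have hs₇ : Same [6, 7, 8, 9, 16, 21, 22] m m₇ :=
        (((hs₄'.mono (by simp)).trans (hs₆.mono (by simp))).trans
          (same_setCell _ (by simp) _ _)).trans (same_setCell _ (by simp) _ _)
      have hc₇ : Ctx A L (Function.update r₆ 16 (m₆ 3 0)) m₇ := by
        refine (hc.same hs₇ (by simp)).reg ?_ ?_ ?_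
        · simp [h0₆, hc.zero]
        · simp [hr₆ 6 (by simp), hr₄ 6 (by simp), a5 6 (by simp)]
        · simp [hr₆ 7 (by simp), hr₄ 7 (by simp), a5 7 (by simp)]
      refine blocks_spec hc₇ (by simp [m₇]) m₄ (by simpa [m₇] using hch) ?_
      rintro r₈ m₈ t₈ Ks hKs hs₈ hext h21 ht₈
      have hcl : CompList L A Ks := by
        have := compList_of_labels hedge a2 hL
        rw [hKs]
        convert this using 3
        exact funext fun c => hb c
      rw [hcl.perm.length_eq] at ht₈
      have e3 : m₇ 3 = m 3 := hs₇ 3 (by simp)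
      have e2 : m₇ 2 = m 2 := hs₇ 2 (by simp)
      rw [e3] at hext
      have hext := hext.congr_left e2 e3
      refine hQ _ _ ⟨(hs₇.mono (by simp)).trans (hs₈.mono (by simp)), hext.grow, ?_,
        .inl ⟨?_, ?_, Ks, hcl, h21, hext⟩⟩
      · rw [hexp]
        omega
      · show m₈ 16 0 = 0
        rw [hs₈ 16 (by simp), hm₇, setCell_ne _ (by simp), setCell_ne _ (by simp), hs₆ 16 (by simp),
          hz]
      · show m₈ 22 0 = m 3 0
        rw [hs₈ 22 (by simp), hm₇, setCell_ne _ (by simp), setCell_self, hs₆ 3 (by simp),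
          hs₄' 3 (by simp)]
    · simp only [wp_skip]
      refine hQ _ _ ⟨hs₄'.mono (by simp), .of_eq (hs₄' 2 (by simp)) (hs₄' 3 (by simp)), ?_,
        .inr ⟨hz, fun hD => hz (h16.2 ?_)⟩⟩
      · rw [hexp]
        omega
      · exact fun c x s he => label_eq_of_smallDiam hR hD a2 a3 c x s he

end Ram

namespace Ram

open IncGraph

variable {G : IncGraph} {A : Finset (Fin G.numVar)} {L : List (Fin G.numCla)}
  {r : ℕ → ℕ} {m : Mem} {d : ℕ}

/-! ### Breadth first search -/

/-- The distance from the start, plus one, or `0` if the vertex has not been found. -/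
def found (m : Mem) : G.Vertex → ℕ
  | .inl x => m 11 x
  | .inr c => m 10 c

/-- The predecessor of a vertex on a shortest path. -/
def pred (m : Mem) : G.Vertex → ℕ
  | .inl x => m 13 x
  | .inr c => m 12 c

/-- The number of a vertex. -/
def number : G.Vertex → ℕ
  | .inl x => x
  | .inr c => c

/-- The invariant of the breadth first search after `n` rounds. -/
structure BfsInv (S : Set G.Vertex) (root : G.Vertex) (n : ℕ) (m : Mem) : Prop where
  root_found : found m root = 1
  back : ∀ v ∈ S, found m v ≠ 0 → v = root ∨ ∃ w ∈ S, G.graph.Adj v w ∧ pred m v = number w ∧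
    found m w ≠ 0 ∧ found m v = found m w + 1
  le : ∀ v ∈ S, found m v ≤ n + 1
  near : ∀ v, Near S n root v → found m v ≠ 0
  next : ∀ u ∈ S, ∀ v ∈ S, G.graph.Adj u v → found m u ≠ 0 → found m u ≤ n → found m v ≠ 0

theorem bfsInit_spec (hG : G.InClass (d : ℤ) Set.univ) (hc : Ctx A L r m)
    {Q : State → ℕ → Prop} (hQ : ∀ r' m' t, (∀ x, x ≤ 7 ∨ 16 ≤ x → r' x = r x) →
      Same [10, 11] m m' → (∀ v ∈ G.vset L A, found m' v = 0) →
      t ≤ 50 * ((d + 1) * (L.length + 1)) → Q ⟨r', m'⟩ t) :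
    WP procedures (forEach 21) ⟨r, m⟩ Q := by
  refine wp_forEach_uniform L (f := Fin.val) (d * (10 + 9) + 7)
    (fun pre m' => Same [10, 11] m m' ∧
      ∀ c ∈ pre, m' 10 c = 0 ∧ ∀ l ∈ G.lits A c, m' 11 l.1 = 0)
    (fun pre m' h => (hc.same h.1 (by simp)).seg) hc.len ⟨.refl _ _, by simp⟩ ?_ ?_
  · rintro pre c post m' r' hL ⟨h1, h2⟩ h8 hr
    refine .hide (c := bfsInitClause) rfl fun Q hQ => ?_
    have h0 : r' 0 = 0 := by rw [hr 0 (by simp) (by simp), hc.zero]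
    simp only [bfsInitClause, seqs, wp_seq, wp_store, setMem_mk, h0, h8]
    set m₁ := setCell m' 10 c 0 with hm₁
    have hs1 : Same [10, 11] m m₁ := h1.trans (same_setCell _ (by simp) _ _)
    refine wp_litsOf (c := c) (B := 10) hG (hc.repr.same hs1 (by simp)) [11] (by simp)
      (fun pl m'' => Same [11] m₁ m'' ∧ (∀ l ∈ pl, m'' 11 l.1 = 0) ∧
        ∀ y : ℕ, m'' 11 y = m' 11 y ∨ m'' 11 y = 0)
      (fun _ _ h => h.1) h0 h8 ⟨.refl _ _, by simp, fun y => .inl (by simp [m₁])⟩ ?_ ?_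
    · rintro pl ⟨y, b⟩ post' m'' r'' hl ⟨g1, g2, g3⟩ h9 h10 hr'
      refine .intro (c := .store 11 9 0) rfl ?_
      have h0' : r'' 0 = 0 := by rw [hr' 0 (by simp), h0]
      simp only [wp_store, setMem_mk, h9, h0']
      refine ⟨⟨g1.trans (same_setCell _ (by simp) _ _), ?_, ?_⟩, by omega⟩
      · intro l hl
        rw [setCell_apply]
        split_ifs with h
        · rfl
        · rcases List.mem_append.1 hl with hl | hl
          · exact g2 l hl
          · rw [List.mem_singleton.1 hl] at h
            exact absurd rfl h
      · intro z
        rw [setCell_apply]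
        split_ifs with h
        · exact .inr rfl
        · exact g3 z
    · rintro r'' m'' t ⟨g1, g2, g3⟩ hr' ht
      refine hQ _ _ ⟨⟨hs1.trans (g1.mono (by simp)), ?_⟩, by omega⟩
      intro c' hc'
      show m'' 10 c' = 0 ∧ ∀ l ∈ G.lits A c', m'' 11 l.1 = 0
      rw [g1 10 (by simp), hm₁, setCell_apply]
      rcases List.mem_append.1 hc' with hc' | hc'
      · obtain ⟨e1, e2⟩ := h2 c' hc'
        refine ⟨by rw [e1, ite_self], fun l hl => ?_⟩
        rcases g3 l.1 with h | h
        · rw [h, e2 l hl]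
        · exact h
      · rw [List.mem_singleton.1 hc']
        exact ⟨by simp, g2⟩
  · rintro r' m' t ⟨h1, h2⟩ hr ht
    refine hQ r' m' t (fun x hx => hr x (by omega) (by omega)) h1 ?_ ?_
    · rintro (x | c) hv
      · obtain ⟨hx, c, hc, s, hs⟩ := id hv
        exact (h2 c hc).2 (x, s) (mem_lits.2 ⟨hx, hs⟩)
      · exact (h2 c hv).1
    · have := cost_le L.length d (10 + 9) (7 + 3) 2
      rw [add_assoc] at ht
      omega

/-- One step of the breadth first search. -/
theorem BfsInv.step_back {S : Set G.Vertex} {root a b : G.Vertex} {m m' : Mem} {k : ℕ}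
    (h : ∀ v ∈ S, found m v ≠ 0 → v = root ∨ ∃ w ∈ S, G.graph.Adj v w ∧ pred m v = number w ∧
      found m w ≠ 0 ∧ found m v = found m w + 1)
    (haS : a ∈ S) (hab : G.graph.Adj b a) (ha : found m a = k + 1) (hb : found m b = 0)
    (hb' : found m' b = k + 2) (hp : pred m' b = number a)
    (hv : ∀ v : G.Vertex, v ≠ b → found m' v = found m v ∧ pred m' v = pred m v) :
    ∀ v ∈ S, found m' v ≠ 0 → v = root ∨ ∃ w ∈ S, G.graph.Adj v w ∧ pred m' v = number w ∧
      found m' w ≠ 0 ∧ found m' v = found m' w + 1 := by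
  have hne : ∀ w : G.Vertex, found m w ≠ 0 → w ≠ b := by rintro w hw rfl; exact hw hb
  intro v hvS hv0
  by_cases hvb : v = b
  · subst hvb
    have := (hv a (hne a (by omega))).1
    exact .inr ⟨a, haS, hab, hp, by omega, by omega⟩
  · obtain ⟨h1, h2⟩ := hv v hvb
    rw [h1] at hv0
    refine (h v hvS hv0).imp id ?_
    rintro ⟨w, hw, hvw, e1, e2, e3⟩
    have := (hv w (hne w e2)).1
    exact ⟨w, hw, hvw, h2.trans e1, by omega, by omega⟩

/-- The memory `m` before the round decides which vertices expand. Vertices found during the round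
have value `n + 2`, so the order in which edges are scanned does not matter. -/
theorem bfsRound_spec (hG : G.InClass (d : ℤ) Set.univ) (hc : Ctx A L r m) {n : ℕ}
    {root : G.Vertex} (hi : BfsInv (G.vset L A) root n m) (hn : r 38 = n + 1) :
    Proc procedures 23 r m fun m' t => Same [10, 11, 12, 13] m m' ∧
      BfsInv (G.vset L A) root (n + 1) m' ∧ t ≤ 40 * ((d + 1) * (L.length + 1)) := by
  refine .intro (c := forEach 24) rfl ?_
  set S := G.vset L A with hS
  refine wp_scan (q := 25) (B := 12) rfl hG hc [10, 11, 12, 13] (by simp)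
    (fun pre m' => Same [10, 11, 12, 13] m m' ∧
      (∀ v ∈ S, found m' v ≠ 0 → v = root ∨ ∃ w ∈ S, G.graph.Adj v w ∧ pred m' v = number w ∧
        found m' w ≠ 0 ∧ found m' v = found m' w + 1) ∧
      (∀ v : G.Vertex, found m' v = found m v ∨ found m v = 0 ∧ found m' v = n + 2) ∧
      ∀ e ∈ pre, (found (G := G) m (.inr e.1) = n + 1 → found (G := G) m' (.inl e.2.1) ≠ 0) ∧
        (found (G := G) m (.inl e.2.1) = n + 1 → found (G := G) m' (.inr e.1) ≠ 0))
    (fun pre m' h => ⟨h.1, .of_eq (h.1 _ (by simp)) (h.1 _ (by simp))⟩)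
    ⟨.refl _ _, hi.back, fun _ => .inl rfl, by simp⟩ ?_ ?_
  · rintro pre c x b post m' r' he ⟨h1, h2, h3, h4⟩ h8 h9 h10 hr
    have hedge : (c, x, b) ∈ edges A L := by rw [he]; simp
    obtain ⟨hcL, hxA, hcx⟩ := mem_edges.1 hedge
    have hcS : Sum.inr c ∈ S := hcL
    have hxS : Sum.inl x ∈ S := ⟨hxA, c, hcL, b, hcx⟩
    have h38 : r' 38 = n + 1 := by rw [hr 38 (by simp), hn]
    have h0 : r' 0 = 0 := by rw [hr 0 (by simp), hc.zero]
    refine .hide (c := bfsRelax) rfl fun Q hQ => ?_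
    have old : ∀ v : G.Vertex, found m v = n + 1 → found m' v = n + 1 := by
      intro v hv
      rcases h3 v with h | ⟨h, -⟩ <;> omega
    have old' : ∀ v : G.Vertex, found m v ≠ 0 → found m' v ≠ 0 := by
      intro v hv
      rcases h3 v with h | ⟨h, -⟩ <;> omega
    -- The case in which the edge changes nothing; `upd` covers the case in which `b` is discovered
    -- from `a`.
    have keep : (found (G := G) m' (.inr c) = n + 1 → found (G := G) m' (.inl x) ≠ 0) →
        (found (G := G) m' (.inl x) = n + 1 → found (G := G) m' (.inr c) ≠ 0) → ∀ t ≤ 12, Q m' t := by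
      intro k1 k2 t ht
      refine hQ _ _ ⟨⟨h1, h2, h3, ?_⟩, ht⟩
      intro e he
      rcases List.mem_append.1 he with he | he
      · exact h4 e he
      · rw [List.mem_singleton.1 he]
        exact ⟨fun h => k1 (old _ h), fun h => k2 (old _ h)⟩
    have upd : ∀ (m₁ : Mem) (a b : G.Vertex), Same [10, 11, 12, 13] m' m₁ → a ∈ S →
        G.graph.Adj b a → found m' a = n + 1 → found m' b = 0 → found m₁ b = n + 2 →
        pred m₁ b = number a →
        (∀ v : G.Vertex, v ≠ b → found m₁ v = found m' v ∧ pred m₁ v = pred m' v) →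
        (a = .inr c ∧ b = .inl x ∨ a = .inl x ∧ b = .inr c) → ∀ t ≤ 12, Q m₁ t := by
      intro m₁ a b k1 k2 k3 k4 k5 k6 k7 k8 k9 t ht
      have mono : ∀ v : G.Vertex, found m' v ≠ 0 → found m₁ v ≠ 0 := by
        intro v hv
        by_cases hvb : v = b
        · rw [hvb]; omega
        · rwa [(k8 v hvb).1]
      refine hQ _ _ ⟨⟨h1.trans k1, BfsInv.step_back h2 k2 k3 k4 k5 k6 k7 k8, ?_, ?_⟩, ht⟩
      · intro v
        by_cases hvb : v = b
        · rw [hvb]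
          rcases h3 b with h | ⟨h, h'⟩
          · exact .inr ⟨by omega, k6⟩
          · omega
        · rw [(k8 v hvb).1]
          exact h3 v
      · intro e he
        rcases List.mem_append.1 he with he | he
        · exact ⟨fun h => mono _ ((h4 e he).1 h), fun h => mono _ ((h4 e he).2 h)⟩
        · rw [List.mem_singleton.1 he]
          have ha : found m₁ a ≠ 0 := mono a (by omega)
          have hb : found m₁ b ≠ 0 := by omega
          rcases k9 with ⟨rfl, rfl⟩ | ⟨rfl, rfl⟩
          · exact ⟨fun _ => hb, fun _ => ha⟩
          · exact ⟨fun _ => ha, fun _ => hb⟩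
    simp only [found] at keep
    by_cases hcn : m' 10 c = n + 1
    · by_cases hx0 : m' 11 x = 0
      · simp [bfsRelax, seqs, wp_ite, h8, h9, h0, h38, hcn, hx0]
        refine upd _ (.inr c) (.inl x) ?_ hcS (adj_inl_inr.2 ⟨b, hcx⟩) hcn hx0
          (by simp [found]) (by simp [pred, number]) ?_ (.inl ⟨rfl, rfl⟩) _ (by omega)
        · exact (same_setCell _ (by simp) _ _).trans (same_setCell _ (by simp) _ _)
        · rintro (y | c') hv
          · have : y ≠ x := fun h => hv (by rw [h])
            simp [found, pred, setCell_apply, Fin.val_inj, this]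
          · simp [found, pred]
      · simp [bfsRelax, seqs, wp_ite, h8, h9, h0, h38, hcn, hx0]
        exact keep (fun _ => hx0) (fun _ => by omega) _ (by omega)
    · by_cases hxn : m' 11 x = n + 1
      · by_cases hc0 : m' 10 c = 0
        · simp [bfsRelax, seqs, wp_ite, h8, h9, h0, h38, hxn, hc0]
          refine upd _ (.inl x) (.inr c) ?_ hxS (adj_inr_inl.2 ⟨b, hcx⟩) hxn hc0
            (by simp [found]) (by simp [pred, number]) ?_ (.inr ⟨rfl, rfl⟩) _ (by omega)
          · exact (same_setCell _ (by simp) _ _).trans (same_setCell _ (by simp) _ _)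
          · rintro (y | c') hv
            · simp [found, pred]
            · have : c' ≠ c := fun h => hv (by rw [h])
              simp [found, pred, setCell_apply, Fin.val_inj, this]
        · simp [bfsRelax, seqs, wp_ite, h8, h9, h0, h38, hxn, hc0, hcn]
          exact keep (fun h => absurd h hcn) (fun _ => hc0) _ (by omega)
      · simp [bfsRelax, seqs, wp_ite, h8, h9, h38, hxn, hcn]
        exact keep (fun h => absurd h hcn) (fun h => absurd h hxn) _ (by omega)
  · rintro r' m' t ⟨h1, h2, h3, h4⟩ hr ht
    have mono : ∀ v : G.Vertex, found m v ≠ 0 → found m' v ≠ 0 := by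
      intro v hv
      rcases h3 v with h | ⟨h, -⟩ <;> omega
    have hnext : ∀ u ∈ S, ∀ v ∈ S, G.graph.Adj u v → found m' u ≠ 0 → found m' u ≤ n + 1 →
        found m' v ≠ 0 := by
      intro u hu v hv ha h0 hle
      -- A value of at most `n + 1` was not assigned in this round.
      have hu' : found m' u = found m u := by
        rcases h3 u with h | ⟨h, h'⟩ <;> omega
      by_cases hun : found m u = n + 1
      · match u, v, ha with
        | .inl x, .inr c', ⟨b, hb⟩ => exact (h4 (c', x, b) (mem_edges.2 ⟨hv, hu.1, hb⟩)).2 hun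
        | .inr c', .inl x, ⟨b, hb⟩ => exact (h4 (c', x, b) (mem_edges.2 ⟨hu, hv.1, hb⟩)).1 hun
      · exact mono v (hi.next u hu v hv ha (by omega) (by omega))
    have hroot : found m' root = 1 := by
      rcases h3 root with h | ⟨h, -⟩ <;> have := hi.root_found <;> omega
    refine ⟨h1, ⟨hroot, h2, ?_, ?_, hnext⟩, ?_⟩
    · intro v hv
      change found m' v ≤ n + 1 + 1
      have := hi.le v hv
      rcases h3 v with h | ⟨-, h⟩ <;> omega
    · intro v hv
      change found m' v ≠ 0
      cases hv with
      | refl => omega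
      | @tail _ _ w _ h ha hv =>
        have hw := hi.near w h
        have hwle := hi.le w h.right
        refine hnext w h.right v hv ha (mono w hw) ?_
        rcases h3 w with h | ⟨h, -⟩ <;> omega
    · have := cost_le L.length d (12 + 9) 8 4
      omega

theorem bfs_spec (hG : G.InClass (d : ℤ) Set.univ) (hc : Ctx A L r m) {root : Fin G.numCla}
    (h21 : r 21 = root) {lam : ℕ} (h2 : r 2 = lam) :
    Proc procedures 26 r m fun m' t => Same [10, 11, 12, 13] m m' ∧
      BfsInv (G.vset L A) (.inr root) lam m' ∧
      t ≤ 60 * ((lam + 1) * ((d + 1) * (L.length + 1))) := by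
  set E := (d + 1) * (L.length + 1) with hE
  have hE1 : 1 ≤ E := by rw [hE]; nlinarith [Nat.zero_le (d * (L.length + 1))]
  refine .hide (c := bfsCmd) rfl fun Q hQ => ?_
  simp only [bfsCmd, seqs, wp_seq]
  refine bfsInit_spec hG hc ?_
  intro r₁ m₁ t₁ hr₁ hs₁ hz₁ ht₁
  simp only [wp_const, wp_store, setReg_mk, setMem_mk, ne_eq, not_false_eq_true,
    Function.update_of_ne, Function.update_self, Nat.reduceEqDiff, hr₁ 21 (by simp), h21]
  set m₂ := setCell m₁ 10 root 1 with hm₂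
  have hs₂ : Same [10, 11, 12, 13] m m₂ :=
    (hs₁.mono (by simp)).trans (same_setCell _ (by simp) _ _)
  have hinit : BfsInv (G.vset L A) (.inr root) 0 m₂ := by
    have hf : ∀ v ∈ G.vset L A, v ≠ .inr root → found m₂ v = 0 := by
      intro v hv hne
      have := hz₁ v hv
      match v with
      | .inl x => simpa [found, m₂] using this
      | .inr c =>
        have hcr : c ≠ root := fun h => hne (by rw [h])
        simpa [found, m₂, setCell_apply, Fin.val_inj, hcr] using this
    have hroot1 : found (G := G) m₂ (.inr root) = 1 := by simp [found, m₂]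
    refine ⟨hroot1, ?_, ?_, ?_, ?_⟩
    · intro v hv h0
      by_contra hn
      rw [not_or] at hn
      exact h0 (hf v hv hn.1)
    · intro v hv
      by_cases hvr : v = .inr root
      · rw [hvr, hroot1]
      · rw [hf v hv hvr]
        omega
    · intro v hv
      cases hv with
      | refl => omega
    · intro u _ v _ _ h0 h1
      omega
  refine wp_loop (fun i σ t => Same [10, 11, 12, 13] m σ.mem ∧
    BfsInv (G.vset L A) (.inr root) i σ.mem ∧ σ.reg 38 = i ∧ (∀ x, x ≤ 7 → σ.reg x = r x) ∧
    t ≤ i * (40 * E + 2)) lam ⟨hs₂, hinit, by simp, ?_, by simp⟩ ?_ ?_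
  · intro x hx
    have h16 : x ≠ 16 := by omega
    have h38 : x ≠ 38 := by omega
    simp [h16, h38, hr₁ x (by omega)]
  · rintro i hi ⟨r₃, m₃⟩ t ⟨a1, a2, a3, a4, a5⟩
    simp only at a1 a2 a3 a4
    refine ⟨by simp [a3, a4 2 (by simp), h2, hi], ?_⟩
    have hr' : ∀ x, x ≤ 7 → Function.update r₃ 38 (r₃ 38 + 1) x = r x := by
      intro x hx
      have h38 : x ≠ 38 := by omega
      simp [h38, a4 x hx]
    have hc₃ : Ctx A L (Function.update r₃ 38 (r₃ 38 + 1)) m₃ := (hc.same a1 (by simp)).reg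
      (hr' 0 (by simp)) (hr' 6 (by simp)) (hr' 7 (by simp))
    simp only [wp_seq, wp_inc, setReg_mk]
    refine (bfsRound_spec hG hc₃ a2 (by simp [a3])).wp ?_
    rintro m₄ t₄ ⟨b1, b2, b3⟩
    refine ⟨a1.trans b1, b2, by simp [a3], hr', ?_⟩
    rw [add_mul]
    change t₄ ≤ 40 * E at b3
    omega
  · rintro ⟨r₃, m₃⟩ t ⟨a1, a2, a3, a4, a5⟩
    simp only at a1 a2 a3 a4
    refine ⟨by simp [a3, a4 2 (by simp), h2], hQ _ _ ⟨a1, a2, ?_⟩⟩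
    have htime : t ≤ lam * (42 * E) := a5.trans (Nat.mul_le_mul_left _ (by omega))
    rw [show lam * (42 * E) = 42 * (lam * E) by ring] at htime
    rw [show (lam + 1) * E = lam * E + E by ring]
    omega

end Ram

namespace Ram

open IncGraph

variable {G : IncGraph} {A : Finset (Fin G.numVar)} {L : List (Fin G.numCla)}
  {r : ℕ → ℕ} {m : Mem} {d k j : ℕ}

/-! ### Shortest paths -/

/-- The predecessors, from the clause `c` on, are the entries of the list, until the root. -/
def Trace (m : Mem) (root : Fin G.numCla) :
    Fin G.numCla → List (Fin G.numCla × Fin G.numVar) → Prop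
  | c, [] => c = root ∧ m 10 c = 1
  | c, e :: l => e.1 = c ∧ m 10 c ≠ 1 ∧ m 12 c = e.2 ∧
      ∃ c' : Fin G.numCla, m 13 e.2 = c' ∧ Trace m root c' l

theorem Trace.congr {m' : Mem} {root : Fin G.numCla} {c : Fin G.numCla}
    {l : List (Fin G.numCla × Fin G.numVar)} (h : Trace m root c l) (h10 : m' 10 = m 10)
    (h12 : m' 12 = m 12) (h13 : m' 13 = m 13) : Trace m' root c l := by
  induction l generalizing c with
  | nil => exact ⟨h.1, by rw [h10]; exact h.2⟩
  | cons e l ih =>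
    obtain ⟨h1, h2, h3, c', h4, h5⟩ := h
    exact ⟨h1, by rwa [h10], by rwa [h12], c', by rwa [h13], ih h5⟩

/-- Predecessors have values smaller by one, and in a bipartite graph two steps lead from a clause
to a clause. Hence the induction drops the value by two, and the strict decrease makes the walk a
path. -/
theorem exists_trace {root : Fin G.numCla} {n : ℕ} (h : BfsInv (G.vset L A) (.inr root) n m) :
    ∀ (D : ℕ) (c : Fin G.numCla), c ∈ L → m 10 c = D → D ≠ 0 →
      ∃ (l : List (Fin G.numCla × Fin G.numVar)) (p : G.graph.Walk (.inr c) (.inr root)),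
        Trace m root c l ∧ p.IsPath ∧ p.support.length = D ∧
        (∀ w ∈ p.support, w ∈ G.vset L A ∧ found m w ≤ D) ∧
        p.support.flatMap vertexCode =
          (l.flatMap fun e => [1, (e.1 : ℕ), 0, (e.2 : ℕ)]) ++ [1, (root : ℕ)] ∧
        (∀ c', Sum.inr c' ∈ p.support ↔ c' ∈ l.map Prod.fst ++ [root]) ∧
        (∀ x, Sum.inl x ∈ p.support → ∃ c' ∈ l.map Prod.fst ++ [root], ∃ s, G.Edge s x c') ∧
        2 * l.length + 1 = D := by
  intro D
  induction D using Nat.strong_induction_on with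
  | _ D ih =>
    intro c hc hD hD0
    by_cases hroot : c = root
    · subst hroot
      have h1 : m 10 c = 1 := h.root_found
      refine ⟨[], .nil, ⟨rfl, h1⟩, .nil, by simp; omega, ?_, by simp [vertexCode], by simp, by simp,
        by simp; omega⟩
      intro w hw
      rw [SimpleGraph.Walk.support_nil, List.mem_singleton] at hw
      subst hw
      exact ⟨hc, hD.le⟩
    · obtain ⟨w, hwS, hcw, hp, hw0, hw⟩ :=
        (h.back (.inr c) hc (by simp only [found]; omega)).resolve_left (by simp [hroot])
      match w, hcw with
      | .inl x, hcw =>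
      obtain ⟨w', hwS', hcw', hp', hw0', hw'⟩ := (h.back (.inl x) hwS hw0).resolve_left (by simp)
      match w', hcw' with
      | .inr c', hcw' =>
      simp only [found] at hw hw0 hw' hw0'
      simp only [pred, number] at hp hp'
      obtain ⟨l, p, i1, i2, i3, i4, i5, i6, i7, i8⟩ := ih (D - 2) (by omega) c' hwS' (by omega)
        (by omega)
      refine ⟨(c, x) :: l, .cons hcw (.cons hcw' p), ⟨rfl, by omega, hp, c', hp', i1⟩, ?_, ?_, ?_,
        ?_, ?_, ?_, ?_⟩
      -- All vertices on the remaining path have value at most `D - 2`, whereas the two new ones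
      -- have values `D` and `D - 1`.
      · rw [SimpleGraph.Walk.cons_isPath_iff, SimpleGraph.Walk.cons_isPath_iff]
        refine ⟨⟨i2, fun hx => ?_⟩, fun hcm => ?_⟩
        · have := (i4 _ hx).2
          simp only [found] at this
          omega
        · rw [SimpleGraph.Walk.support_cons, List.mem_cons] at hcm
          rcases hcm with hcm | hcm
          · exact absurd hcm (by simp)
          · have := (i4 _ hcm).2
            simp only [found] at this
            omega
      · simp only [SimpleGraph.Walk.support_cons, List.length_cons, i3]
        omega
      · intro w hw
        simp only [SimpleGraph.Walk.support_cons, List.mem_cons] at hw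
        rcases hw with rfl | rfl | hw
        · exact ⟨hc, hD.le⟩
        · refine ⟨hwS, ?_⟩
          simp only [found]
          omega
        · exact ⟨(i4 w hw).1, (i4 w hw).2.trans (by omega)⟩
      · simp only [SimpleGraph.Walk.support_cons, List.flatMap_cons, i5]
        simp [vertexCode]
      · intro c₁
        simp [i6]
      · intro y hy
        simp only [SimpleGraph.Walk.support_cons, List.mem_cons, reduceCtorEq, false_or,
          Sum.inl.injEq] at hy
        rcases hy with rfl | hy
        · obtain ⟨s, hs⟩ := hcw
          exact ⟨c, by simp, s, hs⟩
        · obtain ⟨c₁, e1, e2⟩ := i7 y hy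
          exact ⟨c₁, by rw [List.map_cons, List.cons_append]; exact List.mem_cons_of_mem _ e1, e2⟩
      · rw [List.length_cons]
        omega

theorem pathCode_spec {root c : Fin G.numCla} {l : List (Fin G.numCla × Fin G.numVar)}
    (h0 : r 0 = 0) (h20 : r 20 = c) (ht : Trace m root c l) :
    Proc procedures 31 r m fun m' t => Same [2, 3] m m' ∧
      Ext 2 3 m m' (m 10 c :: ((l.flatMap fun e => [1, (e.1 : ℕ), 0, (e.2 : ℕ)]) ++
        [1, (root : ℕ)])) ∧ t ≤ 25 * l.length + 20 := by
  refine .hide (c := pathCodeCmd) rfl fun Q hQ => ?_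
  simp [pathCodeCmd, seqs, h0, h20]
  refine wp_loop (fun i σ t => Same [2, 3] m σ.mem ∧
    Ext 2 3 m σ.mem (m 10 c :: ((l.take i).flatMap fun e => [1, (e.1 : ℕ), 0, (e.2 : ℕ)])) ∧
    (∃ c' : Fin G.numCla, σ.reg 20 = c' ∧ Trace m root c' (l.drop i) ∧ σ.reg 16 = m 10 c') ∧
    σ.reg 0 = 0 ∧ σ.reg 17 = 1 ∧ t = 20 * i) l.length
    ⟨same_pushMem (by simp) (by simp) _ _, by simpa using ext_pushMem (by simp) m _,
      ⟨c, by simp [h20], by simpa using ht, by simp⟩, by simp [h0], by simp, rfl⟩ ?_ ?_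
  · rintro i hi ⟨r₁, m₁⟩ t ⟨a1, a2, ⟨c', a3, a4, a5⟩, a6, a7, a8⟩
    simp only at a1 a2 a3 a5 a6 a7
    rw [List.drop_eq_getElem_cons hi] at a4
    obtain ⟨b1, b2, b3, c₂, b4, b5⟩ := a4
    refine ⟨by simpa [a5, a7] using b2, WP.hide fun Q hQ => ?_⟩
    have e10 := a1 10 (by simp)
    have e12 := a1 12 (by simp)
    have e13 := a1 13 (by simp)
    simp [a3, a6, a7, pushMem_ne, e10, e12, e13, b3, b4]
    refine hQ _ _ ⟨?_, ?_, ⟨c₂, by simp, b5, by simp⟩, by simp [a6], by simp [a7], by omega⟩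
    · exact (((a1.trans (same_pushMem (by simp) (by simp) _ _)).trans
        (same_pushMem (by simp) (by simp) _ _)).trans (same_pushMem (by simp) (by simp) _ _)).trans
        (same_pushMem (by simp) (by simp) _ _)
    · have := (((a2.push (by simp) 1).push (by simp) c'.val).push (by simp) 0).push (by simp)
        l[i].2.val
      rw [List.take_add_one, List.getElem?_eq_getElem hi]
      simpa only [List.flatMap_append, List.flatMap_cons, List.flatMap_nil, Option.toList,
        List.append_nil, b1, List.cons_append, List.nil_append, List.append_assoc] using this
  · rintro ⟨r₁, m₁⟩ t ⟨a1, a2, ⟨c', a3, a4, a5⟩, a6, a7, a8⟩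
    simp only at a1 a2 a3 a5 a6 a7
    rw [List.drop_length] at a4
    rw [List.take_length] at a2
    obtain ⟨rfl, b2⟩ := a4
    refine ⟨by simp [a5, a7, b2], ?_⟩
    simp [a3, a6, a7]
    refine hQ _ _ ⟨(a1.trans (same_pushMem (by simp) (by simp) _ _)).trans
      (same_pushMem (by simp) (by simp) _ _), ?_, by omega⟩
    simpa using (a2.push (by simp) 1).push (by simp) c'.val

theorem pathClauses_spec {root c : Fin G.numCla} {l : List (Fin G.numCla × Fin G.numVar)}
    (h0 : r 0 = 0) (h20 : r 20 = c) (ht : Trace m root c l) :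
    Proc procedures 32 r m fun m' t => Same [2, 3] m m' ∧
      Ext 2 3 m m' ((l.map Prod.fst ++ [root]).map Fin.val) ∧ t ≤ 25 * l.length + 20 := by
  refine .hide (c := pathClausesCmd) rfl fun Q hQ => ?_
  simp [pathClausesCmd, seqs, h20]
  refine wp_loop (fun i σ t => Same [2, 3] m σ.mem ∧
    Ext 2 3 m σ.mem (((l.take i).map Prod.fst).map Fin.val) ∧
    (∃ c' : Fin G.numCla, σ.reg 20 = c' ∧ Trace m root c' (l.drop i) ∧ σ.reg 16 = m 10 c') ∧
    σ.reg 0 = 0 ∧ σ.reg 17 = 1 ∧ t = 8 * i) l.length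
    ⟨.refl _ _, .of_eq rfl rfl,
      ⟨c, by simp [h20], by simpa using ht, by simp⟩, by simp [h0], by simp, rfl⟩ ?_ ?_
  · rintro i hi ⟨r₁, m₁⟩ t ⟨a1, a2, ⟨c', a3, a4, a5⟩, a6, a7, a8⟩
    simp only at a1 a2 a3 a5 a6 a7
    rw [List.drop_eq_getElem_cons hi] at a4
    obtain ⟨b1, b2, b3, c₂, b4, b5⟩ := a4
    refine ⟨by simpa [a5, a7] using b2, WP.hide fun Q hQ => ?_⟩
    have e10 := a1 10 (by simp)
    have e12 := a1 12 (by simp)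
    have e13 := a1 13 (by simp)
    simp [a3, a6, pushMem_ne, e10, e12, e13, b3, b4]
    refine hQ _ _ ⟨a1.trans (same_pushMem (by simp) (by simp) _ _), ?_, ⟨c₂, by simp, b5, by simp⟩,
      by simp [a6], by simp [a7], by omega⟩
    have := a2.push (by simp) c'.val
    rw [List.take_add_one, List.getElem?_eq_getElem hi]
    simpa only [List.map_append, List.map_cons, List.map_nil, Option.toList, b1] using this
  · rintro ⟨r₁, m₁⟩ t ⟨a1, a2, ⟨c', a3, a4, a5⟩, a6, a7, a8⟩
    simp only at a1 a2 a3 a5 a6 a7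
    rw [List.drop_length] at a4
    rw [List.take_length] at a2
    obtain ⟨rfl, b2⟩ := a4
    refine ⟨by simp [a5, a7, b2], ?_⟩
    simp [a3, a6]
    refine hQ _ _ ⟨a1.trans (same_pushMem (by simp) (by simp) _ _), ?_, by omega⟩
    simpa using a2.push (by simp) c'.val

end Ram

namespace Ram

open IncGraph

variable {G : IncGraph} {A : Finset (Fin G.numVar)} {L : List (Fin G.numCla)}
  {r : ℕ → ℕ} {m : Mem} {d k j : ℕ}

/-! ### Joining two obstruction-trees -/

/-- The heap contains the code of `T` and the list `cl` of clauses. -/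
structure TreeMem (m : Mem) (T : G.OTree) (cl : List (Fin G.numCla)) : Prop where
  code : Seg (m 2) (m 17 0) T.code
  code_end : m 18 0 = m 17 0 + T.code.length
  code_top : m 18 0 ≤ m 3 0
  cla : Seg (m 2) (m 19 0) (cl.map Fin.val)
  cla_end : m 20 0 = m 19 0 + cl.length
  cla_top : m 20 0 ≤ m 3 0

/-- The first clauses of the two lists serve as ends of the path. The parts of the new tree are
copied to fresh heap space, so that its code and its clause list each become contiguous. -/
theorem join_spec (hG : G.InClass (d : ℤ) Set.univ) (hc : Ctx A L r m) (h2 : r 2 = 4 * 2 ^ k)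
    (hR : Red (G.vset L A)) (hconn : ∀ u ∈ G.vset L A, ∀ v ∈ G.vset L A, Reach (G.vset L A) u v)
    {S₂ : Set G.Vertex} {T₁ T₂ : G.OTree} {cl₁ cl₂ : List (Fin G.numCla)}
    (h₁ : TreeData d k j (G.vset L A) T₁ cl₁) (h₂ : TreeData d k j S₂ T₂ cl₂)
    (hS₂ : S₂ ⊆ G.vset L A) (hR₂ : Red S₂)
    (hd : ∀ c ∈ cl₁, ∀ x s, G.Edge s x c → Sum.inl x ∈ G.vset L A → Sum.inl x ∉ S₂)
    (hT₁ : Seg (m 2) (r 23) T₁.code) (h24 : r 24 = r 23 + T₁.code.length) (h24' : r 24 ≤ m 3 0)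
    (hcl₁ : Seg (m 2) (r 25) (cl₁.map Fin.val)) (h26 : r 26 = r 25 + cl₁.length)
    (h26' : r 26 ≤ m 3 0) (hT₂ : TreeMem m T₂ cl₂) :
    Proc procedures 33 r m fun m' t =>
      Same [2, 3, 10, 11, 12, 13, 15, 17, 18, 19, 20] m m' ∧ Grow 2 3 m m' ∧
      ((m' 15 0 = 0 ∧ ∃ T cl, TreeData d k (j + 1) (G.vset L A) T cl ∧ TreeMem m' T cl) ∨
        (m' 15 0 = 2 ∧ ¬ G.SmallDiam (4 * 2 ^ k))) ∧
      t ≤ 60 * ((4 * 2 ^ k + 1) * ((d + 1) * (L.length + 1))) + 50 * (4 * 2 ^ k) +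
        7 * (T₁.code.length + T₂.code.length + cl₁.length + cl₂.length) + 120 := by
  obtain ⟨u, cl₁', hu⟩ := List.exists_cons_of_ne_nil h₁.ne
  obtain ⟨v, cl₂', hv⟩ := List.exists_cons_of_ne_nil h₂.ne
  have hum : m 2 (r 25) = u := by rw [hu] at hcl₁; exact hcl₁.1
  have hvm : m 2 (m 19 0) = v := by have := hT₂.cla; rw [hv] at this; exact this.1
  have huS : Sum.inr u ∈ G.vset L A := h₁.sub ((h₁.cla u).2 (by simp [hu]))
  have hvS : Sum.inr v ∈ G.vset L A := hS₂ (h₂.sub ((h₂.cla v).2 (by simp [hv])))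
  have h0 := hc.zero
  refine .hide (c := joinCmd) rfl fun Q hQ => ?_
  simp only [joinCmd, seqs, wp_seq, wp_load, setReg_mk, h0, ne_eq, not_false_eq_true,
    Function.update_of_ne, Function.update_self, OfNat.zero_ne_ofNat, Nat.reduceEqDiff, hum, hvm]
  -- The search starts at the clause of `T₂`, so following predecessors from `u` writes the path in
  -- the direction from `T₁` to `T₂`, with no reversal.
  refine (bfs_spec hG (hc.reg (by simp) (by simp) (by simp)) (root := v) (by simp) (lam := 4 * 2 ^ k)
    (by simp [h2])).wp ?_
  rintro m₁ t₁ ⟨hs₁, hb, ht₁⟩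
  have hc₁ : Ctx A L r m₁ := hc.same hs₁ (by simp)
  have e2 : m₁ 2 = m 2 := hs₁ 2 (by simp)
  have e3 : m₁ 3 = m 3 := hs₁ 3 (by simp)
  simp only [wp_ite, setReg_mk, h0, ne_eq, not_false_eq_true, holds_eq,
    Function.update_of_ne, Function.update_self, OfNat.zero_ne_ofNat, Nat.reduceEqDiff]
  refine ⟨fun hz => ?_, fun hz => ?_⟩
  · simp [h0]
    refine hQ _ _ ⟨(hs₁.mono (by simp)).trans (same_setCell _ (by simp) _ _),
      .of_eq (by simp [e2]) (by simp [e3]), .inr ⟨by simp, fun hsm => ?_⟩, by omega⟩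
    -- The graph is connected and small diameters would put `u` within reach of the search, so not
    -- finding it refutes `SmallDiam`.
    exact hb.near _ (hsm _ hR _ _ (hconn _ hvS _ huS)) hz
  · obtain ⟨l, p, ht, hp, hD, hsup, hcode, hcla, hvar, hlen⟩ :=
      exists_trace hb (m₁ 10 u) u huS rfl hz
    have hD' : m₁ 10 u ≤ 4 * 2 ^ k + 1 := hb.le _ huS
    have hp' : vertexListCode p.support = m₁ 10 u ::
        ((l.flatMap fun e => [1, (e.1 : ℕ), 0, (e.2 : ℕ)]) ++ [1, (v : ℕ)]) := by
      rw [vertexListCode_eq, hcode, hD]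
    simp [h0]
    have a₂ := ext_pushMem (b := 2) (p := 3) (by simp) m₁ 1
    have s₂ : Same [2, 3] m₁ (pushMem 2 3 m₁ 1) := same_pushMem (by simp) (by simp) _ _
    set m₂ := pushMem 2 3 m₁ 1 with hm₂
    refine (copy_spec (l := T₁.code) (s := r 23) (by simp [h0]) (by simp) (by simp [h24])
      (a₂.grow.seg (by rw [e2]; exact hT₁) (by rw [e3]; omega))
      (by have := a₂.grow.top; rw [e3] at this; omega)).wp ?_
    rintro m₃ t₃ ⟨s₃, a₃, ht₃⟩
    have a₃ := a₂.trans a₃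
    have s₃ := s₂.trans s₃
    refine (pathCode_spec (c := u) (root := v) (l := l) (by simp [h0]) (by simp)
      (ht.congr (s₃ 10 (by simp)) (s₃ 12 (by simp)) (s₃ 13 (by simp)))).wp ?_
    rintro m₄ t₄ ⟨s₄, a₄, ht₄⟩
    rw [s₃ 10 (by simp), ← hp'] at a₄
    have a₄ := a₃.trans a₄
    have s₄ := s₃.trans s₄
    simp
    have g₄ := a₄.grow
    have ltop := g₄.top
    rw [e3] at ltop
    refine (copy_spec (l := T₂.code) (s := m 17 0) (by simp [h0]) (by simp)
      (by simp [hT₂.code_end])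
      (g₄.seg (by rw [e2]; exact hT₂.code) (by rw [e3, ← hT₂.code_end]; exact hT₂.code_top))
      (by rw [← hT₂.code_end]; exact hT₂.code_top.trans ltop)).wp ?_
    rintro m₅ t₅ ⟨s₅, a₅, ht₅⟩
    have a₅ := a₄.trans a₅
    have s₅ := s₄.trans s₅
    simp [h0]
    have g₅ := a₅.grow
    have ltop₅ := g₅.top
    rw [e3] at ltop₅
    refine (copy_spec (l := cl₁.map Fin.val) (s := r 25) (by simp [h0]) (by simp) (by simp [h26])
      (g₅.seg (by rw [e2]; exact hcl₁) (by rw [e3, List.length_map]; omega))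
      (by rw [List.length_map]; omega)).wp ?_
    rintro m₆ t₆ ⟨s₆, a₆, ht₆⟩
    have s₆' := s₅.trans s₆
    refine (pathClauses_spec (c := u) (root := v) (l := l) (by simp [h0]) (by simp)
      (ht.congr (s₆' 10 (by simp)) (s₆' 12 (by simp)) (s₆' 13 (by simp)))).wp ?_
    rintro m₇ t₇ ⟨s₇, a₇, ht₇⟩
    have a₇ := a₆.trans a₇
    have s₇ := s₆'.trans s₇
    simp
    have g₇ := g₅.trans a₇.grow
    have ltop₇ := g₇.top
    rw [e3] at ltop₇
    refine (copy_spec (l := cl₂.map Fin.val) (s := m 19 0) (by simp [h0]) (by simp)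
      (by simp [hT₂.cla_end])
      (g₇.seg (by rw [e2]; exact hT₂.cla)
        (by rw [e3, List.length_map, ← hT₂.cla_end]; exact hT₂.cla_top))
      (by rw [List.length_map, ← hT₂.cla_end]; exact hT₂.cla_top.trans ltop₇)).wp ?_
    rintro m₈ t₈ ⟨s₈, a₈, ht₈⟩
    have a₈ := a₇.trans a₈
    have s₈ := s₇.trans s₈
    have g₈ := g₅.trans a₈.grow
    simp [h0]
    have top₅ := a₅.top
    have top₈ := a₈.top
    have hcode' : [1] ++ T₁.code ++ vertexListCode p.support ++ T₂.code =
        (OTree.join T₁ p T₂).code := by simp [OTree.code]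
    have hcl' : cl₁.map Fin.val ++ (l.map Prod.fst ++ [v]).map Fin.val ++ cl₂.map Fin.val =
        (cl₁ ++ (l.map Prod.fst ++ [v]) ++ cl₂).map Fin.val := by simp
    rw [hcode'] at a₅ top₅
    rw [hcl', List.length_map] at top₈
    rw [hcl'] at a₈
    refine hQ _ _ ⟨?_, ?_, .inl ⟨by simp, .join T₁ p T₂, cl₁ ++ (l.map Prod.fst ++ [v]) ++ cl₂,
      ?_, ?_⟩, ?_⟩
    · have h9 : Same [2, 3, 10, 11, 12, 13, 15, 17, 18, 19, 20] m m₈ :=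
        (hs₁.mono (by simp)).trans (s₈.mono (by simp))
      exact ((((h9.trans (same_setCell _ (by simp) _ _)).trans (same_setCell _ (by simp) _ _)).trans
        (same_setCell _ (by simp) _ _)).trans (same_setCell _ (by simp) _ _)).trans
        (same_setCell _ (by simp) _ _)
    · exact ((Grow.of_eq e2 e3).trans g₈).trans (.of_eq (by simp) (by simp))
    · have hsl : p.support.length = p.length + 1 := p.length_support
      refine h₁.join h₂ hS₂ hR₂ hd (by simp [hu]) (by simp [hv]) p hp (by omega)
        (fun w hw => (hsup w hw).1) hcla hvar ?_
      rw [List.length_append, List.length_map, List.length_singleton]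
      omega
    · constructor
      · simpa using a₈.grow.seg a₅.seg (by rw [top₅])
      · simpa using top₅
      · simpa using a₈.grow.top
      · simpa using a₈.seg
      · simpa using top₈
      · simp
    · have : (vertexListCode p.support).length = 2 * (m₁ 10 u) + 1 := by
        rw [length_vertexListCode, hD]
      simp only [List.length_map] at *
      omega

end Ram

namespace Ram

open IncGraph

variable {G : IncGraph} {A : Finset (Fin G.numVar)} {L : List (Fin G.numCla)}
  {X : List (Fin G.numVar)} {r : ℕ → ℕ} {m m' : Mem} {d k j B : ℕ}

/-! ### The recursion -/

/-- The arguments of the main procedures: the parameters, the current graph, and the list `X` of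
variables that have to be assigned. -/
structure Args (d k j : ℕ) (A : Finset (Fin G.numVar)) (X : List (Fin G.numVar))
    (L : List (Fin G.numCla)) (r : ℕ → ℕ) (m : Mem) : Prop where
  ctx : Ctx A L r m
  width : r 1 = d
  dist : r 2 = 4 * 2 ^ k
  level : r 3 = d + j
  seg : Seg (m 2) (r 4) (X.map Fin.val)
  len : r 5 = r 4 + X.length
  top : r 5 ≤ m 3 0
  nodup : L.Nodup
  red : Red (G.vset L A)

theorem Args.reg {r' : ℕ → ℕ} (h : Args d k j A X L r m) (hr : ∀ x ≤ 7, r' x = r x) :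
    Args d k j A X L r' m :=
  ⟨h.ctx.reg (hr 0 (by simp)) (hr 6 (by simp)) (hr 7 (by simp)), by rw [hr 1 (by simp), h.width],
    by rw [hr 2 (by simp), h.dist], by rw [hr 3 (by simp), h.level],
    by rw [hr 4 (by simp)]; exact h.seg, by rw [hr 4 (by simp), hr 5 (by simp), h.len],
    by rw [hr 5 (by simp)]; exact h.top, h.nodup, h.red⟩

theorem Args.mem (h : Args d k j A X L r m) {s : List ℕ} (hs : Same s m m')
    (hn : 0 ∉ s ∧ 4 ∉ s ∧ 5 ∉ s) (hg : Grow 2 3 m m') : Args d k j A X L r m' :=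
  ⟨h.ctx.mem hs hn hg, h.width, h.dist, h.level,
    hg.seg h.seg (by rw [List.length_map, ← h.len]; exact h.top), h.len, h.top.trans hg.top,
    h.nodup, h.red⟩

/-- The results of the main procedures. -/
inductive Outcome (d k j : ℕ) (A : Finset (Fin G.numVar)) (X : List (Fin G.numVar))
    (L : List (Fin G.numCla)) (m m' : Mem) : Prop
  | tree (S₂ : Set G.Vertex) (T : G.OTree) (cl : List (Fin G.numCla)) (status : m' 15 0 = 0)
      (sub : S₂ ⊆ G.vset L A) (red : Red S₂) (avoid : ∀ x ∈ X, Sum.inl x ∉ S₂)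
      (data : TreeData d k j S₂ T cl) (mem : TreeMem m' T cl)
  | backdoor (B : G.BTree) (status : m' 15 0 = 1) (label : B.labelSet = G.vset L A)
      (isBackdoor : G.IsBackdoor (G.InClass ((d : ℤ) - 1)) B)
      (depth : B.depth ≤ X.length + 3 ^ j * (4 * 2 ^ k) * d) (out : Ext 1 14 m m' B.code)
  | fail (status : m' 15 0 = 2) (not : ¬ G.SmallDiam (4 * 2 ^ k))

/-- The effect of the main procedures. -/
structure Post (d k j : ℕ) (A : Finset (Fin G.numVar)) (X : List (Fin G.numVar))
    (L : List (Fin G.numCla)) (B : ℕ) (m m' : Mem) (t : ℕ) : Prop where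
  input : m' 0 = m 0
  offset : m' 4 = m 4
  repr : Repr A m'
  heap : Grow 2 3 m m'
  out : Grow 1 14 m m'
  outcome : Outcome d k j A X L m m'
  time : t ≤ B

theorem base_spec (hG : G.InClass (d : ℤ) Set.univ) (h : Args d k 0 A [] L r m) :
    Proc procedures 34 r m
      (Post d k 0 A [] L (250 * ((d + 1) * (L.length + 1))) m) := by
  set E := (d + 1) * (L.length + 1) with hE
  have hE1 : 1 ≤ E := by rw [hE]; nlinarith [Nat.zero_le (d * (L.length + 1))]
  have h0 := h.ctx.zero
  refine .hide (c := baseCmd) rfl fun Q hQ => ?_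
  simp only [baseCmd, seqs, wp_seq]
  refine (width_spec hG h.ctx h.width).wp ?_
  rintro m₁ t₁ ⟨hs₁, hw, ht₁⟩
  have g₁ : Grow 2 3 m m₁ := .of_eq (hs₁ 2 (by simp)) (hs₁ 3 (by simp))
  have h₁ := h.mem hs₁ (by simp) g₁
  change t₁ ≤ 60 * E at ht₁
  simp only [wp_load, setReg_mk, wp_ite, holds_eq, h0, ne_eq, not_false_eq_true,
    Function.update_of_ne, Function.update_self, OfNat.zero_ne_ofNat]
  refine ⟨fun hz => ?_, fun hz => ?_⟩
  · obtain ⟨-, hw⟩ := hw.resolve_right (by rintro ⟨c, -, hc, -⟩; omega)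
    simp [h0]
    have s₂ : Same [1, 14] m₁ (pushMem 1 14 m₁ 0) := same_pushMem (by simp) (by simp) _ _
    have a₂ := ext_pushMem (b := 1) (p := 14) (by simp) m₁ 0
    set m₂ := pushMem 1 14 m₁ 0 with hm₂
    have h₂ := h₁.mem s₂ (by simp) (.of_eq (s₂ 2 (by simp)) (s₂ 3 (by simp)))
    refine (label_spec hG (h₂.ctx.reg (by simp) (by simp) (by simp)) h.nodup).wp ?_
    rintro m₃ t₃ ⟨s₃, ⟨W, w1, w2, w3⟩, ht₃⟩
    change t₃ ≤ 140 * E at ht₃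
    have a₃ := a₂.trans w3
    simp [h0]
    have a₄ := (a₃.congr_left (hs₁ 1 (by simp)) (hs₁ 14 (by simp))).congr
      (m'' := setCell m₃ 15 0 1) (by simp) (by simp)
    have s₄ : Same [1, 14, 15, 16, 23, 24] m (setCell m₃ 15 0 1) :=
      (((hs₁.mono (by simp)).trans (s₂.mono (by simp))).trans (s₃.mono (by simp))).trans
        (same_setCell _ (by simp) _ _)
    refine hQ _ _ ⟨s₄ 0 (by simp), s₄ 4 (by simp), h.ctx.repr.same s₄ (by simp),
      .of_eq (s₄ 2 (by simp)) (s₄ 3 (by simp)), a₄.grow, ?_, by omega⟩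
    refine .backdoor (.leaf W) (by simp) w2 (.leaf _ w1 ?_) (by simp [BTree.depth]) ?_
    · rw [w2]
      exact inClass_vset fun c hc => lt_of_le_of_ne (length_lits_le hG c) (hw c hc)
    · simpa [BTree.code] using a₄
  · obtain ⟨c, hcL, hc, hw⟩ := hw.resolve_left (by rintro ⟨hc, -⟩; exact hz hc)
    simp [h0, hc]
    set m₂ := setCell m₁ 17 0 (m₁ 3 0) with hm₂
    have a₂ : Ext 2 3 m m₂ [] := .of_eq (by simp [m₂, hs₁ 2]) (by simp [m₂, hs₁ 3])
    have a₃ := (a₂.push (by simp) 0).push (by simp) c.val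
    set m₃ := pushMem 2 3 (pushMem 2 3 m₂ 0) c with hm₃
    set m₄ := setCell (setCell m₃ 18 0 (m₃ 3 0)) 19 0 (m₃ 3 0) with hm₄
    have a₄ := (a₃.congr (m'' := m₄) (by simp [m₄]) (by simp [m₄])).push (by simp) c.val
    set m₅ := pushMem 2 3 m₄ c with hm₅
    have s₅ : Same [2, 3, 15, 16, 17, 18, 19, 20, 23] m m₅ := ((((((hs₁.mono (by simp)).trans
      (same_setCell _ (by simp) _ _)).trans (same_pushMem (by simp) (by simp) _ _)).trans
      (same_pushMem (by simp) (by simp) _ _)).trans (same_setCell _ (by simp) _ _)).trans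
      (same_setCell _ (by simp) _ _)).trans (same_pushMem (by simp) (by simp) _ _)
    have s₆ := (s₅.trans (same_setCell m₅ (a := 20) (by simp) 0 (m₅ 3 0))).trans
      (same_setCell _ (a := 15) (by simp) 0 0)
    have a₆ := a₄.congr (m'' := setCell (setCell m₅ 20 0 (m₅ 3 0)) 15 0 0) (by simp) (by simp)
    have e3 : m₁ 3 0 = m 3 0 := by rw [hs₁ 3 (by simp)]
    have e17 : m₅ 17 0 = m 3 0 := by simp [m₅, pushMem_ne, m₄, m₃, m₂, e3]
    have e18 : m₅ 18 0 = m 3 0 + 2 := by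
      simpa [m₅, pushMem_ne, m₄] using a₃.top
    have e19 : m₅ 19 0 = m 3 0 + 2 := by
      simpa [m₅, pushMem_ne, m₄] using a₃.top
    have htop := a₄.top
    simp only [List.nil_append, List.length_append, List.length_singleton] at htop
    have hseg := a₆.seg
    simp only [List.nil_append, seg_append, List.length_append, List.length_singleton] at hseg
    have hle : (G.lits A c).length ≤ (G.clause c).length := List.length_filter_le _ _
    have hle' := length_clause_le hG c
    -- A clause has at most `d` literals in `G`, so one with `d` unassigned literals has no assigned
    -- literal and width exactly `d` in `G`.
    have hall : ∀ l ∈ G.clause c, l.1 ∉ A := by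
      have := List.length_filter_eq_length_iff.1
        (show ((G.clause c).filter fun l => l.1 ∉ A).length = (G.clause c).length by
          rw [lits] at hw hle; omega)
      simpa using this
    refine hQ _ _ ⟨s₆ 0 (by simp), s₆ 4 (by simp), h.ctx.repr.same s₆ (by simp), a₆.grow,
      .of_eq (s₆ 1 (by simp)) (s₆ 14 (by simp)), ?_, by omega⟩
    refine .tree (G.vset L A) (.base c) [c] (by simp) subset_rfl h.red (by simp)
      (.base ?_ hcL fun x s hs => ⟨hall _ hs, c, hcL, s, hs⟩) ⟨?_, ?_, ?_, ?_, ?_, ?_⟩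
    · rw [width_univ]
      omega
    · simpa [OTree.code, e17] using hseg.1
    · simp [OTree.code, e17, e18]
    · simp [e18, htop]
    · simpa [e19] using hseg.2
    · simp [e19, htop]
    · simp

end Ram

-- Splitting into components.

namespace Ram

open IncGraph

variable {G : IncGraph} {A : Finset (Fin G.numVar)} {L : List (Fin G.numCla)}
  {X : List (Fin G.numVar)} {r : ℕ → ℕ} {m m' : Mem} {d k j M C f : ℕ}

variable (G) in
/-- The specification of the procedure for connected graphs, up to the recursion depth `f`. -/
def ConnSpec (d k M C f : ℕ) : Prop :=
  ∀ (j : ℕ) (A : Finset (Fin G.numVar)) (X : List (Fin G.numVar)) (L : List (Fin G.numCla))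
    (r : ℕ → ℕ) (m : Mem), Args d k j A X L r m →
    (∀ u ∈ G.vset L A, ∀ v ∈ G.vset L A, Reach (G.vset L A) u v) →
    2 ^ j * (8 * 2 ^ k + 6) * (d + 1) ≤ M → j * (M + 2) + X.length < f →
    Proc procedures 37 r m (Post d k j A X L (C * 8 ^ f * (L.length + 1)) m)

variable (G) in
/-- The specification of the procedure for arbitrary graphs, up to the recursion depth `f`. -/
def MainSpec (d k M C f : ℕ) : Prop :=
  ∀ (j : ℕ) (A : Finset (Fin G.numVar)) (X : List (Fin G.numVar)) (L : List (Fin G.numCla))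
    (r : ℕ → ℕ) (m : Mem), Args d k j A X L r m →
    2 ^ j * (8 * 2 ^ k + 6) * (d + 1) ≤ M → j * (M + 2) + X.length < f →
    Proc procedures 36 r m (Post d k j A X L (3 * (C * 8 ^ f) * (L.length + 1)) m)

/-- The status works as a guard: once a component has given a tree or a failure, the remaining
components are skipped. -/
theorem component_spec (hs : ConnSpec G d k M C f) (h : Args d k j A X L r m)
    (hM : 2 ^ j * (8 * 2 ^ k + 6) * (d + 1) ≤ M) (hf : j * (M + 2) + X.length < f)
    {K : List (Fin G.numCla)} (hK : Seg (m 2) (r 19 + 1) (K.map Fin.val))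
    (h25 : r 25 = r 19 + 1 + K.length) (htop : r 25 ≤ m 3 0) (hnd : K.Nodup)
    (hR : Red (G.vset K A))
    (hconn : ∀ u ∈ G.vset K A, ∀ v ∈ G.vset K A, Reach (G.vset K A) u v) :
    Proc procedures 35 r m fun m' t =>
      (m 15 0 = 1 → Post d k j A X K (C * 8 ^ f * (K.length + 1) + 10) m m' t) ∧
      (m 15 0 ≠ 1 → m' = m ∧ t ≤ 10) := by
  have h0 := h.ctx.zero
  refine .hide (c := blockCmd) rfl fun Q hQ => ?_
  simp only [blockCmd, seqs, wp_seq, wp_load, wp_const, setReg_mk, wp_ite, holds_eq, h0, ne_eq,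
    not_false_eq_true, Function.update_of_ne, Function.update_self, Nat.reduceEqDiff, wp_copy,
    wp_inc, wp_skip]
  refine ⟨fun h1 => ?_, fun h1 => ?_⟩
  · refine (hs j A X K _ m ⟨⟨?_, ?_, ?_, ?_, ?_⟩, ?_, ?_, ?_, ?_, ?_, ?_, hnd, hR⟩ hconn hM hf).wp ?_
    · simp [h0]
    · exact h.ctx.repr
    · simpa using hK
    · simp [h25]
    · simpa using htop
    · simp [h.width]
    · simp [h.dist]
    · simp [h.level]
    · simpa using h.seg
    · simp [h.len]
    · simpa using h.top
    · rintro m' t ⟨p1, p2, p3, p4, p5, p6, p7⟩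
      exact hQ _ _ ⟨fun _ => ⟨p1, p2, p3, p4, p5, p6, by omega⟩, fun h => absurd h1 h⟩
  · exact hQ _ _ ⟨fun h => absurd h h1, fun _ => ⟨rfl, by omega⟩⟩

/-- Trees and failures of a subgraph are results for the whole graph. A backdoor is excluded since
it depends on its root label. -/
theorem Outcome.mono {K : List (Fin G.numCla)} {m₁ : Mem} (h : Outcome d k j A X K m m')
    (hK : K ⊆ L) (h1 : m' 15 0 ≠ 1) : Outcome d k j A X L m₁ m' := by
  have hsub : G.vset K A ⊆ G.vset L A := by
    rintro (x | c) hv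
    · obtain ⟨hx, c, hc, hs⟩ := hv
      exact ⟨hx, c, hK hc, hs⟩
    · exact hK hv
  cases h with
  | tree S₂ T cl p1 p2 p3 p4 p5 p6 => exact .tree S₂ T cl p1 (p2.trans hsub) p3 p4 p5 p6
  | backdoor B p1 => exact absurd p1 h1
  | fail p1 p2 => exact .fail p1 p2

theorem codeList_append (l l' : List G.BTree) :
    BTree.codeList (l ++ l') = BTree.codeList l ++ BTree.codeList l' := by
  induction l with
  | nil => rfl
  | cons t l ih => simp [BTree.codeList, ih]

theorem depthList_le {l : List G.BTree} {D : ℕ} (h : ∀ t ∈ l, t.depth ≤ D) :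
    BTree.depthList l ≤ D := by
  induction l with
  | nil => simp [BTree.depthList]
  | cons t l ih =>
    rw [BTree.depthList]
    exact max_le (h t (by simp)) (ih fun t ht => h t (by simp [ht]))

theorem split_spec (hs : ConnSpec G d k M C f) (hG : G.InClass (d : ℤ) Set.univ)
    (h : Args d k j A X L r m) (hM : 2 ^ j * (8 * 2 ^ k + 6) * (d + 1) ≤ M)
    (hf : j * (M + 2) + X.length < f) {Ks : List (List (Fin G.numCla))} (hKs : CompList L A Ks)
    (hlen : 1 < Ks.length) (h16 : r 16 = Ks.length)
    (hseg : Seg (m 2) (m 22 0) (blocksCode (m 22 0) (Ks.map (List.map Fin.val))))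
    (htop : m 22 0 + (blocksCode (m 22 0) (Ks.map (List.map Fin.val))).length ≤ m 3 0) :
    Proc procedures 43 r m (Post d k j A X L
      (2 * (C * 8 ^ f) * (L.length + 1) + 200 * ((d + 1) * (L.length + 1))) m) := by
  set E := (d + 1) * (L.length + 1) with hE
  have hE1 : L.length + 1 ≤ E := by rw [hE]; nlinarith [Nat.zero_le (d * (L.length + 1))]
  have h0 := h.ctx.zero
  refine .hide (c := splitCmd) rfl fun Q hQ => ?_
  simp [splitCmd, seqs, h0]
  have s₁ : Same [1, 14] m (pushMem 1 14 m 2) := same_pushMem (by simp) (by simp) _ _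
  have a₁ := ext_pushMem (b := 1) (p := 14) (by simp) m 2
  set m₁ := pushMem 1 14 m 2 with hm₁
  have h₁ := h.mem s₁ (by simp) (.of_eq (s₁ 2 (by simp)) (s₁ 3 (by simp)))
  refine (label_spec hG (h₁.ctx.reg (by simp) (by simp) (by simp)) h.nodup).wp ?_
  rintro m₂ t₂ ⟨s₂, ⟨W, w1, w2, w3⟩, ht₂⟩
  change t₂ ≤ 140 * E at ht₂
  simp [h0, h16]
  have a₂ := (a₁.trans w3).push (by simp) Ks.length
  have s₃ : Same [1, 14, 15, 23, 24] m (setCell (pushMem 1 14 m₂ Ks.length) 15 0 1) :=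
    (((s₁.mono (by simp)).trans (s₂.mono (by simp))).trans
      (same_pushMem (by simp) (by simp) _ _)).trans (same_setCell _ (by simp) _ _)
  have a₃ := a₂.congr (m'' := setCell (pushMem 1 14 m₂ Ks.length) 15 0 1) (by simp) (by simp)
  have e15 : setCell (pushMem 1 14 m₂ Ks.length) 15 0 1 15 0 = 1 := by simp
  have e22 : m₂ 22 0 = m 22 0 := by rw [s₂ 22 (by simp), s₁ 22 (by simp)]
  simp only [pushMem_ne (show 22 ≠ 1 by simp) (show 22 ≠ 14 by simp), e22]
  set m₃ := setCell (pushMem 1 14 m₂ Ks.length) 15 0 1 with hm₃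
  set s := m 22 0 with hs_def
  set D := X.length + 3 ^ j * (4 * 2 ^ k) * d with hD
  -- Either all components processed so far have backdoors, whose codes have been appended to the
  -- output, or the outcome for the whole graph is already settled and the content of the output is
  -- irrelevant.
  refine wp_loop (fun i σ t => (∀ x ≤ 7, σ.reg x = r x) ∧ σ.reg 16 = Ks.length ∧ σ.reg 18 = i ∧
    σ.reg 19 = s + (blocksCode s ((Ks.take i).map (List.map Fin.val))).length ∧
    σ.mem 0 = m 0 ∧ σ.mem 4 = m 4 ∧ Repr A σ.mem ∧ Grow 2 3 m σ.mem ∧ Grow 1 14 m σ.mem ∧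
    ((σ.mem 15 0 = 1 ∧ ∃ Bs : List G.BTree, Bs.map BTree.labelSet = (Ks.take i).map (G.vset · A) ∧
      (∀ B ∈ Bs, G.IsBackdoor (G.InClass ((d : ℤ) - 1)) B ∧ B.depth ≤ D) ∧
      Ext 1 14 m₃ σ.mem (BTree.codeList Bs)) ∨
      (σ.mem 15 0 ≠ 1 ∧ Outcome d k j A X L m σ.mem)) ∧
    t ≤ C * 8 ^ f * ((Ks.take i).flatten.length + i) + 20 * i) Ks.length
    ⟨?_, by simp [h16], by simp, ?_, s₃ 0 (by simp), s₃ 4 (by simp), h.ctx.repr.same s₃ (by simp),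
      .of_eq (s₃ 2 (by simp)) (s₃ 3 (by simp)), a₃.grow,
      .inl ⟨e15, [], by simp, by simp, .of_eq rfl rfl⟩, by simp⟩ ?_ ?_
  · intro x hx
    have : x ≠ 16 ∧ x ≠ 17 ∧ x ≠ 18 ∧ x ≠ 19 ∧ x ≠ 30 := by omega
    simp [this]
  · simp [blocksCode]
  · rintro i hi ⟨r₁, m'⟩ t ⟨b1, b2, b3, b4, b5, b6, b7, b8, b9, b10, b11⟩
    simp only at b1 b2 b3 b4 b5 b6 b7 b8 b9 b10
    refine ⟨by simp [b2, b3, hi], WP.hide fun Q hQ => ?_⟩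
    have hsplit : Ks = Ks.take i ++ Ks[i] :: Ks.drop (i + 1) := by simp
    have hKmem : Ks[i] ∈ Ks := by simp
    have htake : Ks.take (i + 1) = Ks.take i ++ [Ks[i]] := by
      rw [List.take_add_one, List.getElem?_eq_getElem hi]
      rfl
    set K := Ks[i] with hK_def
    set s' := s + (blocksCode s ((Ks.take i).map (List.map Fin.val))).length with hs'
    have hbc : blocksCode s (Ks.map (List.map Fin.val)) =
        blocksCode s ((Ks.take i).map (List.map Fin.val)) ++
          (s' + 1 + K.length) :: (K.map Fin.val ++ blocksCode (s' + 1 + K.length)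
            ((Ks.drop (i + 1)).map (List.map Fin.val))) := by
      conv_lhs => rw [hsplit, List.map_append, blocksCode_append, List.map_cons, blocksCode]
      rw [List.length_map]
    have hseg' := b8.seg hseg htop
    have htop' := htop.trans b8.top
    rw [hbc, seg_append, seg_cons, seg_append, ← hs'] at hseg'
    rw [hbc] at htop'
    simp only [List.length_append, List.length_cons, List.length_map] at htop'
    have hnext : s + (blocksCode s ((Ks.take (i + 1)).map (List.map Fin.val))).length =
        s' + 1 + K.length := by
      rw [htake, List.map_append, blocksCode_append, List.length_append, ← Nat.add_assoc, ← hs']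
      simp [blocksCode]
      ring
    have hargs : Args d k j A X L r m' := ⟨⟨h0, b7, b8.seg h.ctx.seg (by
      rw [List.length_map, ← h.ctx.len]; exact h.ctx.top), h.ctx.len, h.ctx.top.trans b8.top⟩,
      h.width, h.dist, h.level, b8.seg h.seg (by rw [List.length_map, ← h.len]; exact h.top), h.len,
      h.top.trans b8.top, h.nodup, h.red⟩
    simp only [wp_seq, wp_load, setReg_mk, b4, hseg'.2.1]
    refine (component_spec (K := K) hs (hargs.reg fun x hx => ?_) hM hf ?_ ?_ ?_ ?_
      (hKs.red h.red hKmem) (hKs.preconnected hKmem)).wp ?_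
    · have : x ≠ 25 := by omega
      simp [this, b1 x hx]
    · simpa [b4] using hseg'.2.2.1
    · simp [b4]
    · simp
      omega
    · exact (List.nodup_flatten.1 (hKs.perm.nodup_iff.2 h.nodup)).1 K hKmem
    rintro m'' t' ⟨c1, c2⟩
    simp only [wp_copy, wp_inc, setReg_mk, Function.update_self, ne_eq, not_false_eq_true,
      Function.update_of_ne, Nat.reduceEqDiff]
    have hregs : ∀ x ≤ 7, Function.update (Function.update (Function.update r₁ 25
        (s' + 1 + K.length)) 19 (s' + 1 + K.length)) 18 (r₁ 18 + 1) x = r x := by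
      intro x hx
      have : x ≠ 25 ∧ x ≠ 19 ∧ x ≠ 18 := by omega
      simp [this, b1 x hx]
    have htime : C * 8 ^ f * ((Ks.take (i + 1)).flatten.length + (i + 1)) =
        C * 8 ^ f * ((Ks.take i).flatten.length + i) + C * 8 ^ f * (K.length + 1) := by
      rw [htake, List.flatten_append, List.length_append, List.flatten_singleton]
      ring
    refine hQ _ _ ⟨hregs, by simp [b2], by simp [b3], by simpa using hnext.symm, ?_⟩
    rcases b10 with ⟨e1, Bs, e2, e3, e4⟩ | ⟨e1, e2⟩
    · obtain ⟨p1, p2, p3, p4, p5, p6, p7⟩ := c1 e1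
      refine ⟨p1.trans b5, p2.trans b6, p3, b8.trans p4, b9.trans p5, ?_, by
        rw [htime]; omega⟩
      by_cases h15 : m'' 15 0 = 1
      · cases p6 with
        | tree S₂ T cl q1 => omega
        | fail q1 => omega
        | backdoor B q1 q2 q3 q4 q5 =>
          refine .inl ⟨h15, Bs ++ [B], by rw [htake]; simp [e2, q2], ?_, ?_⟩
          · intro B' hB'
            rcases List.mem_append.1 hB' with hB' | hB'
            · exact e3 B' hB'
            · rw [List.mem_singleton] at hB'
              subst hB'
              exact ⟨q3, q4⟩
          · rw [codeList_append]
            simpa [BTree.codeList] using e4.trans q5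
      · exact .inr ⟨h15, p6.mono (hKs.subset hKmem) h15⟩
    · obtain ⟨rfl, c3⟩ := c2 e1
      exact ⟨b5, b6, b7, b8, b9, .inr ⟨e1, e2⟩, by rw [htime]; omega⟩
  · rintro ⟨r₁, m'⟩ t ⟨b1, b2, b3, b4, b5, b6, b7, b8, b9, b10, b11⟩
    simp only at b1 b2 b3 b4 b5 b6 b7 b8 b9 b10
    rw [List.take_length] at b10 b11
    -- Each component contains a clause. This bounds the `+ 1` contributed by each component and
    -- keeps the total linear.
    have hlenKs : Ks.length ≤ L.length := by
      rw [← hKs.perm.length_eq, List.length_flatten]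
      have := List.card_nsmul_le_sum (Ks.map List.length) 1 (by
        intro x hx
        obtain ⟨K, hK, rfl⟩ := List.mem_map.1 hx
        exact List.length_pos_of_ne_nil (hKs.ne K hK))
      simpa using this
    rw [hKs.perm.length_eq] at b11
    have hmul : C * 8 ^ f * (L.length + Ks.length) ≤ 2 * (C * 8 ^ f) * (L.length + 1) := by
      calc _ ≤ C * 8 ^ f * (2 * (L.length + 1)) := Nat.mul_le_mul_left _ (by omega)
        _ = _ := by ring
    refine ⟨by simp [b2, b3], ?_⟩
    refine hQ _ _ ⟨b5, b6, b7, b8, b9, ?_, by omega⟩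
    rcases b10 with ⟨e1, Bs, e2, e3, e4⟩ | ⟨e1, e2⟩
    · refine .backdoor (.split W Bs) e1 w2 ?_ (depthList_le fun B hB => (e3 B hB).2) ?_
      · refine .split W Bs w1 ?_ ?_ ?_ fun B hB => (e3 B hB).1
        · rw [w2]
          exact hKs.not_preconnected h.nodup hlen
        · rw [e2]
          exact hKs.nodup h.nodup
        · intro S
          rw [e2, w2]
          exact hKs.isComponent_iff
      · have hBs : Bs.length = Ks.length := by simpa using congrArg List.length e2
        simpa [BTree.code, hBs] using a₃.trans e4
    · exact e2

end Ram

-- Arbitrary graphs and branching over a variable.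

namespace Ram

open IncGraph

variable {G : IncGraph} {A : Finset (Fin G.numVar)} {L : List (Fin G.numCla)}
  {X : List (Fin G.numVar)} {r : ℕ → ℕ} {m m' : Mem} {d k j M C f : ℕ}

/-- All work outside of recursive calls that is linear in the graph fits into a single unit `C * 8 ^
f * (n + 1)`. The factor `M + 1` in `C` is kept for handling trees, whose size is not bounded by the
current graph. -/
theorem overhead_le (hC : 1000 * ((4 * 2 ^ k + 1) * ((d + 1) * (M + 1))) ≤ C) (n : ℕ) :
    1000 * ((4 * 2 ^ k + 1) * ((d + 1) * (n + 1))) ≤ C * 8 ^ f * (n + 1) := by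
  have h1 : 1000 * ((4 * 2 ^ k + 1) * (d + 1)) ≤ C := by
    refine le_trans ?_ hC
    gcongr
    exact Nat.le_mul_of_pos_right _ (by omega)
  calc 1000 * ((4 * 2 ^ k + 1) * ((d + 1) * (n + 1))) =
      1000 * ((4 * 2 ^ k + 1) * (d + 1)) * (n + 1) := by ring
    _ ≤ C * (n + 1) := Nat.mul_le_mul_right _ h1
    _ ≤ C * 8 ^ f * (n + 1) :=
      Nat.mul_le_mul_right _ (Nat.le_mul_of_pos_right _ (by positivity))

/-- Allows preparatory work that does not touch input or output to be put in front of a call. -/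
theorem Post.congr_left {m₁ : Mem} {B t : ℕ} (h : Post d k j A X L B m₁ m' t) (h0 : m₁ 0 = m 0)
    (h4 : m₁ 4 = m 4) (hg : Grow 2 3 m m₁) (h1 : m₁ 1 = m 1) (h14 : m₁ 14 = m 14) :
    Post d k j A X L B m m' t := by
  obtain ⟨p1, p2, p3, p4, p5, p6, p7⟩ := h
  refine ⟨p1.trans h0, p2.trans h4, p3, hg.trans p4, (Grow.of_eq h1 h14).trans p5, ?_, p7⟩
  cases p6 with
  | tree S₂ T cl q1 q2 q3 q4 q5 q6 => exact .tree S₂ T cl q1 q2 q3 q4 q5 q6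
  | fail q1 q2 => exact .fail q1 q2
  | backdoor B q1 q2 q3 q4 q5 => exact .backdoor B q1 q2 q3 q4 (q5.congr_left h1 h14)

/-- One unit of cost pays for the components and at most two for the recursive calls, as the clause
numbers of the components, each increased by one, sum to at most twice `L.length + 1`. -/
theorem main_spec (hs : ConnSpec G d k M C f) (hG : G.InClass (d : ℤ) Set.univ)
    (hC : 1000 * ((4 * 2 ^ k + 1) * ((d + 1) * (M + 1))) ≤ C) : MainSpec G d k M C f := by
  intro j A X L r m h hM hf
  have hover := overhead_le (f := f) hC L.length
  set E := (d + 1) * (L.length + 1) with hE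
  have hE1 : 1 ≤ E := by rw [hE]; nlinarith [Nat.zero_le (d * (L.length + 1))]
  have hE2 : E ≤ (4 * 2 ^ k + 1) * E := Nat.le_mul_of_pos_left _ (by omega)
  have h0 := h.ctx.zero
  refine .hide (c := mainCmd) rfl fun Q hQ => ?_
  simp only [mainCmd, seqs, wp_seq]
  refine (comps_spec hG h.ctx h.nodup h.red h.dist).wp ?_
  rintro m₁ t₁ ⟨s₁, g₁, ht₁, hcomp⟩
  rw [← hE] at ht₁
  set F := (4 * 2 ^ k + 1) * E with hF
  have h₁ := h.mem s₁ (by simp) g₁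
  have n0 : m₁ 0 = m 0 := s₁ 0 (by simp)
  have n4 : m₁ 4 = m 4 := s₁ 4 (by simp)
  have n1 : m₁ 1 = m 1 := s₁ 1 (by simp)
  have n14 : m₁ 14 = m 14 := s₁ 14 (by simp)
  simp only [wp_load, setReg_mk, wp_ite, holds_eq, holds_lt, h0, ne_eq, not_false_eq_true, wp_seq,
    Function.update_of_ne, Function.update_self, OfNat.zero_ne_ofNat, wp_const, Nat.reduceEqDiff]
  refine ⟨fun hz => ⟨fun hlt => ?_, fun hlt => ?_⟩, fun hz => ?_⟩
  · obtain ⟨-, i2, Ks, i3, i4, i5⟩ := hcomp.resolve_right fun hn => hn.1 hz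
    rw [← i2] at i5
    refine (split_spec (Ks := Ks) hs hG (h₁.reg fun x hx => ?_) hM hf i3 (by omega) (by simp [i4])
      (by have := i5.seg; rwa [← i2] at this) (by rw [i5.top, i2])).wp ?_
    · have : x ≠ 16 ∧ x ≠ 17 := by omega
      simp [this]
    · intro m' t hp
      obtain ⟨p1, p2, p3, p4, p5, p6, p7⟩ := hp.congr_left n0 n4 g₁ n1 n14
      rw [← hE] at p7
      refine hQ _ _ ⟨p1, p2, p3, p4, p5, p6, ?_⟩
      rw [show 3 * (C * 8 ^ f) * (L.length + 1) = 2 * (C * 8 ^ f) * (L.length + 1) +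
        C * 8 ^ f * (L.length + 1) by ring]
      omega
  · obtain ⟨-, i2, Ks, i3, i4, i5⟩ := hcomp.resolve_right fun hn => hn.1 hz
    refine (hs j A X L _ m₁ (h₁.reg fun x hx => ?_) (i3.reach (by omega)) hM hf).wp ?_
    · have : x ≠ 16 ∧ x ≠ 17 := by omega
      simp [this]
    · intro m' t hp
      obtain ⟨p1, p2, p3, p4, p5, p6, p7⟩ := hp.congr_left n0 n4 g₁ n1 n14
      refine hQ _ _ ⟨p1, p2, p3, p4, p5, p6, ?_⟩
      rw [show 3 * (C * 8 ^ f) * (L.length + 1) = 2 * (C * 8 ^ f * (L.length + 1)) +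
        C * 8 ^ f * (L.length + 1) by ring]
      omega
  · obtain ⟨-, i2⟩ := hcomp.resolve_left fun hn => hz hn.1
    simp [h0]
    refine hQ _ _ (Post.congr_left (m₁ := m₁) ⟨by simp, by simp,
      h₁.ctx.repr.congr (by simp) (by simp) (by simp), .of_eq (by simp) (by simp),
      .of_eq (by simp) (by simp), .fail (by simp) i2, ?_⟩ n0 n4 g₁ n1 n14)
    rw [show 3 * (C * 8 ^ f) * (L.length + 1) = 2 * (C * 8 ^ f * (L.length + 1)) +
      C * 8 ^ f * (L.length + 1) by ring]
    omega

theorem Args.assign (h : Args d k j A X L r m) (x : Fin G.numVar) (s : Bool) {r' : ℕ → ℕ}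
    (hr : ∀ y ≤ 5, r' y = r y) (hm : Repr (insert x A) m') (hg : Grow 2 3 m m')
    (hs : Seg (m' 2) (r' 6) ((L.filter fun c => ¬ G.Edge s x c).map Fin.val))
    (h7 : r' 7 = r' 6 + (L.filter fun c => ¬ G.Edge s x c).length) (h7' : r' 7 ≤ m' 3 0) :
    Args d k j (insert x A) X (L.filter fun c => ¬ G.Edge s x c) r' m' :=
  ⟨⟨by rw [hr 0 (by simp), h.ctx.zero], hm, hs, h7, h7'⟩, by rw [hr 1 (by simp), h.width],
    by rw [hr 2 (by simp), h.dist], by rw [hr 3 (by simp), h.level],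
    by rw [hr 4 (by simp)]; exact hg.seg h.seg (by rw [List.length_map, ← h.len]; exact h.top),
    by rw [hr 4 (by simp), hr 5 (by simp), h.len],
    by rw [hr 5 (by simp)]; exact h.top.trans hg.top, h.nodup.filter _,
    by rw [← vset_assign]; exact h.red.assign x s⟩

/-- A tree found after assigning `x` avoids `x`, since its reduced set lies in a graph from which
`x` has been removed; this is how `avoid` is established for the head of the list. -/
theorem Outcome.assign {x : Fin G.numVar} {s : Bool} {m₁ m₂ m₃ : Mem}
    (h : Outcome d k j (insert x A) X (L.filter fun c => ¬ G.Edge s x c) m₁ m₂)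
    (h1 : m₂ 15 0 ≠ 1) (hm : Same [5] m₂ m₃) : Outcome d k j A (x :: X) L m m₃ := by
  have e2 : m₃ 2 = m₂ 2 := hm 2 (by simp)
  have e3 : m₃ 3 = m₂ 3 := hm 3 (by simp)
  have e15 : m₃ 15 = m₂ 15 := hm 15 (by simp)
  have e17 : m₃ 17 = m₂ 17 := hm 17 (by simp)
  have e18 : m₃ 18 = m₂ 18 := hm 18 (by simp)
  have e19 : m₃ 19 = m₂ 19 := hm 19 (by simp)
  have e20 : m₃ 20 = m₂ 20 := hm 20 (by simp)
  cases h with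
  | backdoor B q1 => exact absurd q1 h1
  | fail q1 q2 => exact .fail (by rw [e15, q1]) q2
  | tree S₂ T cl q1 q2 q3 q4 q5 q6 =>
    refine .tree S₂ T cl (by rw [e15, q1]) ?_ q3 ?_ q5 ?_
    · rw [← vset_assign] at q2
      exact q2.trans (assign_subset _ _ _)
    · intro y hy
      rcases List.mem_cons.1 hy with rfl | hy
      · exact fun hn => (q2 hn).1 (Finset.mem_insert_self _ _)
      · exact q4 y hy
    · obtain ⟨b1, b2, b3, b4, b5, b6⟩ := q6
      exact ⟨by rwa [e2, e17], by rwa [e17, e18], by rwa [e18, e3], by rwa [e2, e19],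
        by rwa [e19, e20], by rwa [e20, e3]⟩

theorem Repr.assign {x : Fin G.numVar} (h : Repr A m) : Repr (insert x A) (setCell m 5 x 1) := by
  refine ⟨fun c => by simpa using h.code c, fun y => ?_⟩
  rw [setCell_apply, h.asg]
  by_cases hxy : y = x <;> simp [hxy, Fin.val_inj]

/-- Resetting the cell restores `A` precisely because `x` was unassigned before. -/
theorem Repr.unassign {x : Fin G.numVar} (hx : x ∉ A) (h : Repr (insert x A) m) :
    Repr A (setCell m 5 x 0) := by
  refine ⟨fun c => by simpa using h.code c, fun y => ?_⟩
  rw [setCell_apply, h.asg]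
  by_cases hxy : y = x <;> simp [hxy, Fin.val_inj, hx]

-- Two calls of cost three units and one unit for the label and the two filtered clause lists make
-- seven. Both lists are written to the heap before the first call, which only extends the heap, so
-- the second list survives it.
set_option maxHeartbeats 800000 in
theorem branch_spec (hs : MainSpec G d k M C f) (hG : G.InClass (d : ℤ) Set.univ)
    (hC : 1000 * ((4 * 2 ^ k + 1) * ((d + 1) * (M + 1))) ≤ C) (h : Args d k j A X L r m)
    (hconn : ∀ u ∈ G.vset L A, ∀ v ∈ G.vset L A, Reach (G.vset L A) u v)
    (hM : 2 ^ j * (8 * 2 ^ k + 6) * (d + 1) ≤ M) (hf : j * (M + 2) + X.length < f)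
    {x : Fin G.numVar} (h20 : r 20 = x) (hx : Sum.inl x ∈ G.vset L A) :
    Proc procedures 38 r m (Post d k j A (x :: X) L (7 * (C * 8 ^ f) * (L.length + 1)) m) := by
  have hover := overhead_le (f := f) hC L.length
  set E := (d + 1) * (L.length + 1) with hE
  have hE1 : 1 ≤ E := by rw [hE]; nlinarith [Nat.zero_le (d * (L.length + 1))]
  have hE2 : E ≤ (4 * 2 ^ k + 1) * E := Nat.le_mul_of_pos_left _ (by omega)
  set F := (4 * 2 ^ k + 1) * E with hF
  clear_value F E
  have h0 := h.ctx.zero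
  have hxA : x ∉ A := hx.1
  refine .hide (c := branchCmd) rfl fun Q hQ => ?_
  simp [branchCmd, seqs, h0]
  have s₁ : Same [1, 14] m (pushMem 1 14 m 1) := same_pushMem (by simp) (by simp) _ _
  have a₁ := ext_pushMem (b := 1) (p := 14) (by simp) m 1
  set m₁ := pushMem 1 14 m 1 with hm₁
  have h₁ := h.mem s₁ (by simp) (.of_eq (s₁ 2 (by simp)) (s₁ 3 (by simp)))
  refine (label_spec hG (h₁.ctx.reg (by simp) (by simp) (by simp)) h.nodup).wp ?_
  rintro m₂ t₂ ⟨s₂, ⟨W, w1, w2, w3⟩, ht₂⟩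
  rw [← hE] at ht₂
  simp [h0, h20, pushMem_ne]
  have a₂ := (a₁.trans w3).push (by simp) x.val
  have s₃ : Same [1, 14, 23, 24] m (pushMem 1 14 m₂ x) :=
    ((s₁.mono (by simp)).trans (s₂.mono (by simp))).trans (same_pushMem (by simp) (by simp) _ _)
  have n23 : m₂ 3 0 = m 3 0 := by rw [s₂ 3 (by simp), s₁ 3 (by simp)]
  rw [n23]
  set m₃ := pushMem 1 14 m₂ x with hm₃
  have h₃ := h.mem s₃ (by simp) (.of_eq (s₃ 2 (by simp)) (s₃ 3 (by simp)))
  refine (filter_spec (s := true) (x := x) hG (h₃.ctx.reg (by simp) (by simp) (by simp)) (by simp [h20])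
    (by simp) hxA).wp ?_
  rintro m₄ t₄ ⟨s₄, a₄, ht₄⟩
  rw [← hE] at ht₄
  have h₄ := h₃.mem s₄ (by simp) a₄.grow
  simp [h0]
  refine (filter_spec (s := false) (x := x) hG (h₄.ctx.reg (by simp) (by simp) (by simp)) (by simp [h20])
    (by simp) hxA).wp ?_
  rintro m₅ t₅ ⟨s₅, a₅, ht₅⟩
  rw [← hE] at ht₅
  have h₅ := h₄.mem s₅ (by simp) a₅.grow
  simp [h0, h20]
  set L₁ := L.filter fun c => ¬ G.Edge true x c with hL₁
  set L₀ := L.filter fun c => ¬ G.Edge false x c with hL₀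
  have n53 : m₅ 3 0 = m 3 0 + L₁.length + L₀.length := by
    rw [a₅.top, a₄.top, s₃ 3 (by simp), List.length_map, List.length_map]
  have n43 : m₄ 3 0 = m 3 0 + L₁.length := by
    rw [a₄.top, s₃ 3 (by simp), List.length_map]
  have hle₁ : L₁.length ≤ L.length := List.length_filter_le _ _
  have hle₀ : L₀.length ≤ L.length := List.length_filter_le _ _
  have htime : ∀ {n t₇ : ℕ}, n ≤ L.length → t₇ ≤ 3 * (C * 8 ^ f) * (n + 1) →
      t₇ ≤ 3 * (C * 8 ^ f * (L.length + 1)) := fun hn h7 =>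
    h7.trans ((Nat.mul_le_mul_left _ (Nat.add_le_add_right hn 1)).trans_eq (by ring))
  rw [show 7 * (C * 8 ^ f) * (L.length + 1) = 7 * (C * 8 ^ f * (L.length + 1)) by ring] at hQ
  generalize C * 8 ^ f * (L.length + 1) = Z at hover hQ htime
  have g₅ : Grow 2 3 m₃ m₅ := a₄.grow.trans a₅.grow
  set m₆ := setCell m₅ 5 x 1 with hm₆
  have s₆ : Same [1, 2, 3, 5, 14, 16, 23, 24] m m₆ :=
    (((s₃.mono (by simp)).trans (s₄.mono (by simp))).trans (s₅.mono (by simp))).trans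
      (same_setCell _ (by simp) _ _)
  have g₆ : Grow 2 3 m m₆ := ((Grow.of_eq (s₃ 2 (by simp)) (s₃ 3 (by simp))).trans g₅).trans
    (.of_eq (by simp [m₆]) (by simp [m₆]))
  have a₆ : Ext 1 14 m m₆ ([1] ++ vertexListCode W ++ [x.val]) :=
    a₂.congr (by simp [m₆, s₅ 1, s₄ 1]) (by simp [m₆, s₅ 14, s₄ 14])
  have f3 : m₆ 3 0 = m 3 0 + L₁.length + L₀.length := by simp [m₆, n53]
  have seg₁ : Seg (m₆ 2) (m 3 0) (L₁.map Fin.val) := by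
    have := a₅.grow.seg a₄.seg (by rw [a₄.top])
    rw [s₃ 3 (by simp)] at this
    simpa [m₆] using this
  have seg₀ : Seg (m₆ 2) (m 3 0 + L₁.length) (L₀.map Fin.val) := by
    have := a₅.seg
    rw [n43] at this
    simpa [m₆] using this
  refine (hs j (insert x A) X L₁ _ m₆ (h.assign x true (fun y hy => ?_) h₅.ctx.repr.assign g₆ ?_ ?_
    ?_) hM hf).wp ?_
  · have : y ≠ 16 ∧ y ≠ 30 ∧ y ≠ 22 ∧ y ≠ 21 ∧ y ≠ 23 ∧ y ≠ 24 ∧ y ≠ 6 ∧ y ≠ 7 := by omega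
    simp [this]
  · change Seg _ _ (L₁.map Fin.val)
    simpa using seg₁
  · simp [n43, hL₁]
  · simp [n43, f3]
  rintro m₇ t₇ ⟨p1, p2, p3, p4, p5, p6, p7⟩
  replace p7 := htime hle₁ p7
  simp [wp_ite, h0, h20]
  have i0 : m₇ 0 = m 0 := p1.trans (s₆ 0 (by simp))
  have i4 : m₇ 4 = m 4 := p2.trans (s₆ 4 (by simp))
  refine ⟨fun h15 => ?_, fun h15 => ?_⟩
  · refine (hs j (insert x A) X L₀ _ m₇ (h.assign x false (fun y hy => ?_) p3 (g₆.trans p4) ?_ ?_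
      ?_) hM hf).wp ?_
    · have : y ≠ 16 ∧ y ≠ 30 ∧ y ≠ 22 ∧ y ≠ 21 ∧ y ≠ 23 ∧ y ≠ 24 ∧ y ≠ 6 ∧ y ≠ 7 ∧ y ≠ 17 := by
        omega
      simp [this]
    · change Seg _ _ (L₀.map Fin.val)
      simpa [n43] using p4.seg seg₀ (by rw [f3, List.length_map])
    · simp [n43, n53, hL₀]
    · simpa [n53, f3] using p4.top
    rintro m₈ t₈ ⟨q1, q2, q3, q4, q5, q6, q7⟩
    replace q7 := htime hle₀ q7
    simp [h0, h20]
    have s₉ : Same [5] m₈ (setCell m₈ 5 x 0) := same_setCell _ (by simp) _ _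
    refine hQ _ _ ⟨by simp [q1, i0], by simp [q2, i4], q3.unassign hxA,
      ((g₆.trans p4).trans q4).trans (.of_eq (by simp) (by simp)),
      ((a₆.grow.trans p5).trans q5).trans (.of_eq (by simp) (by simp)), ?_, by
        clear * - hover hE1 hE2 ht₂ ht₄ ht₅ p7 q7
        omega⟩
    -- The first branch has returned a backdoor. If the second does too, the pieces of output
    -- concatenate to the code of the branch node; otherwise the second outcome is passed on.
    by_cases h15' : m₈ 15 0 = 1
    · cases p6 with
      | tree _ _ _ e => exact absurd (h15.symm.trans e) (by simp)
      | fail e => exact absurd (h15.symm.trans e) (by simp)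
      | backdoor B₁ _ u2 u3 u4 u5 =>
        cases q6 with
        | tree _ _ _ e => exact absurd (h15'.symm.trans e) (by simp)
        | fail e => exact absurd (h15'.symm.trans e) (by simp)
        | backdoor B₀ _ v2 v3 v4 v5 =>
          refine .backdoor (.branch W x B₁ B₀) (by simpa using h15') w2 ?_ ?_ ?_
          · refine .branch W x B₁ B₀ w1 ?_ ?_ ?_ ?_ u3 v3
            · rw [w2]
              have : Nonempty (G.vset L A) := ⟨⟨_, hx⟩⟩
              exact ⟨preconnected_iff.2 hconn⟩
            · have : Sum.inl x ∈ {v | v ∈ W} := by rw [w2]; exact hx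
              exact this
            · rw [w2, vset_assign, u2]
            · rw [w2, vset_assign, v2]
          · rw [BTree.depth, List.length_cons, add_right_comm, add_comm _ 1]
            exact Nat.add_le_add_left (max_le u4 v4) 1
          · have := ((a₆.trans u5).trans v5).congr (m'' := setCell m₈ 5 x 0) (by simp) (by simp)
            simpa [BTree.code] using this
    · exact q6.assign h15' s₉
  · have s₈ : Same [5] m₇ (setCell m₇ 5 x 0) := same_setCell _ (by simp) _ _
    exact hQ _ _ ⟨by simp [i0], by simp [i4], p3.unassign hxA,
      (g₆.trans p4).trans (.of_eq (by simp) (by simp)),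
      (a₆.grow.trans p5).trans (.of_eq (by simp) (by simp)), p6.assign h15 s₈, by
        clear * - hover hE1 hE2 ht₂ ht₄ ht₅ p7
        omega⟩

end Ram

-- Climbing a level, and the induction on the recursion depth.

namespace Ram

open IncGraph

variable {G : IncGraph} {A : Finset (Fin G.numVar)} {L : List (Fin G.numCla)}
  {X : List (Fin G.numVar)} {r : ℕ → ℕ} {m m' : Mem} {d k j M C f : ℕ}

/-- The first bound limits the recursion depth caused by the new list of variables. The second
leaves one third of `3^(j+1) * (4 * 2^k) * d` for the backdoors found below the branching. -/
theorem length_vars_le {n c : ℕ} (hn : n ≤ d * c)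
    (hc : c + (2 * 2 ^ k + 1) ≤ 2 ^ j * (2 * 2 ^ k + 2)) :
    n ≤ 2 ^ j * (8 * 2 ^ k + 6) * (d + 1) ∧ n ≤ 2 * (3 ^ j * (4 * 2 ^ k) * d) := by
  have hk : 1 ≤ 2 ^ k := Nat.one_le_two_pow
  have hc' : c ≤ 2 ^ j * (2 * 2 ^ k + 2) := by omega
  have h1 : n ≤ d * (2 ^ j * (2 * 2 ^ k + 2)) := hn.trans (Nat.mul_le_mul_left _ hc')
  constructor
  · calc n ≤ 2 ^ j * (2 * 2 ^ k + 2) * d := h1.trans_eq (mul_comm _ _)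
      _ ≤ 2 ^ j * (8 * 2 ^ k + 6) * (d + 1) := by gcongr <;> omega
  · have h2 : 2 ^ j ≤ 3 ^ j := Nat.pow_le_pow_left (by omega) j
    calc n ≤ 2 ^ j * (2 * 2 ^ k + 2) * d := h1.trans_eq (mul_comm _ _)
      _ ≤ 3 ^ j * (2 * (4 * 2 ^ k)) * d := by gcongr; omega
      _ = _ := by ring

theorem length_tree_le {S : Set G.Vertex} {T : G.OTree} {cl : List (Fin G.numCla)}
    (h : TreeData d k j S T cl) (hM : 2 ^ j * (8 * 2 ^ k + 6) * (d + 1) ≤ M) :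
    T.code.length ≤ M ∧ cl.length ≤ M := by
  have h1 : 2 ^ j * (8 * 2 ^ k + 6) ≤ M := (Nat.le_mul_of_pos_right _ (by omega)).trans hM
  have h2 : 2 ^ j * (2 * 2 ^ k + 2) ≤ 2 ^ j * (8 * 2 ^ k + 6) := Nat.mul_le_mul_left _ (by omega)
  have h3 := h.length_le
  have h4 := h.code_le
  omega

/-- Level `j` is called twice on the same graph, first without variables to assign and then with
those of the first tree. Two trees are joined; a backdoor or failure from either call is already an
answer. -/
theorem up_spec (hs : ConnSpec G d k M C f) (hG : G.InClass (d : ℤ) Set.univ)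
    (hC : 1000 * ((4 * 2 ^ k + 1) * ((d + 1) * (M + 1))) ≤ C) (h : Args d k (j + 1) A [] L r m)
    (hconn : ∀ u ∈ G.vset L A, ∀ v ∈ G.vset L A, Reach (G.vset L A) u v)
    (hM : 2 ^ (j + 1) * (8 * 2 ^ k + 6) * (d + 1) ≤ M) (hf : (j + 1) * (M + 2) < f + 1) :
    Proc procedures 39 r m (Post d k (j + 1) A [] L (7 * (C * 8 ^ f * (L.length + 1))) m) := by
  have hover := overhead_le (f := f) hC L.length
  have hCZ : C ≤ C * 8 ^ f * (L.length + 1) := by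
    rw [mul_assoc]
    exact Nat.le_mul_of_pos_right _ (by positivity)
  have hM' : 2 ^ j * (8 * 2 ^ k + 6) * (d + 1) ≤ M := by
    refine le_trans ?_ hM
    gcongr <;> omega
  -- Giving up one level frees `M + 2` units of the measure, enough for a list of up to `M`
  -- variables.
  have hf' : j * (M + 2) + M < f := by
    rw [add_mul] at hf
    omega
  have hP : (d + 1) * (M + 1) ≤ (4 * 2 ^ k + 1) * ((d + 1) * (M + 1)) ∧
      4 * 2 ^ k + 1 ≤ (4 * 2 ^ k + 1) * ((d + 1) * (M + 1)) ∧ M + 1 ≤ (d + 1) * (M + 1) :=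
    ⟨Nat.le_mul_of_pos_left _ (by omega),
      Nat.le_mul_of_pos_right _ (Nat.mul_pos (by omega) (by omega)),
      Nat.le_mul_of_pos_left _ (by omega)⟩
  have hpow : 3 ^ (j + 1) * (4 * 2 ^ k) * d = 3 * (3 ^ j * (4 * 2 ^ k) * d) := by ring
  have h0 := h.ctx.zero
  refine .hide (c := upCmd) rfl fun Q hQ => ?_
  simp [upCmd, seqs, h0]
  refine (hs j A [] L _ m ⟨h.ctx.reg (by simp) (by simp) (by simp), ?_, ?_, ?_, by simp, by simp,
    by simpa using h.top, h.nodup, h.red⟩ hconn hM' (by simp; omega)).wp ?_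
  · simp [h.width]
  · simp [h.dist]
  · simp [h.level]
  -- The nonlinear cost unit becomes an atom for linear arithmetic.
  obtain ⟨Z, hZ⟩ : ∃ Z, Z = C * 8 ^ f * (L.length + 1) := ⟨_, rfl⟩
  rw [← hZ] at hover hQ hCZ ⊢
  rintro m₁ t₁ ⟨p1, p2, p3, p4, p5, p6, p7⟩
  simp [h0, wp_ite]
  refine ⟨fun hz => ?_, fun hz => ?_⟩
  · cases p6 with
    | fail e => omega
    | backdoor _ e => omega
    | tree S₁ T₁ cl₁ q1 q2 q3 q4 q5 q6 =>
    have s₂ : Same [14] m₁ (setCell m₁ 14 0 (m 14 0)) := same_setCell _ (by simp) _ _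
    -- The first call may have left part of an abandoned backdoor in the output; resetting the stack
    -- pointer discards it, so that a backdoor of the second call starts at the original position.
    have o₂ : Ext 1 14 m (setCell m₁ 14 0 (m 14 0)) [] :=
      ⟨by simp, trivial, fun i hi => by simpa using p5.old i hi⟩
    have r₂ : Repr A (setCell m₁ 14 0 (m 14 0)) := p3.same s₂ (by simp)
    set m₂ := setCell m₁ 14 0 (m 14 0) with hm₂
    have e2 : m₂ 2 = m₁ 2 := s₂ 2 (by simp)
    have e3 : m₂ 3 = m₁ 3 := s₂ 3 (by simp)
    have g₂ : Grow 2 3 m m₂ := p4.trans (.of_eq e2 e3)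
    -- The reduced set of the first tree is not needed; only its clauses and their unassigned
    -- variables matter.
    have d₁ : TreeData d k j (G.vset L A) T₁ cl₁ := { q5 with sub := q5.sub.trans q2 }
    refine (gather_spec (cl := cl₁) hG (by simp [h0]) r₂ (by simpa [e2] using q6.cla)
      (by simp [q6.cla_end]) (by simpa [e3] using q6.cla_top)).wp ?_
    rintro m₃ t₃ ⟨s₃, ⟨xs, a₃, hxs, hmem⟩, ht₃⟩
    have g₃ : Grow 2 3 m m₃ := g₂.trans a₃.grow
    have o₃ : Ext 1 14 m m₃ [] := o₂.congr (s₃ 1 (by simp)) (s₃ 14 (by simp))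
    have hlen := length_vars_le hxs q5.length_le
    simp [h0]
    refine (hs j A xs L _ m₃ ⟨⟨?_, r₂.same s₃ (by simp), ?_, ?_, ?_⟩, ?_, ?_, ?_, ?_, ?_, ?_, h.nodup,
      h.red⟩ hconn hM' (by omega)).wp ?_
    · simp [h0]
    · simpa using g₃.seg h.ctx.seg (by rw [List.length_map, ← h.ctx.len]; exact h.ctx.top)
    · simp [h.ctx.len]
    · simpa using h.ctx.top.trans g₃.top
    · simp [h.width]
    · simp [h.dist]
    · simp [h.level]
    · have := a₃.seg
      rw [e3] at this
      simpa using this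
    · have := a₃.top
      rw [e3] at this
      simpa using this
    · simp
    rintro m₄ t₄ ⟨u1, u2, u3, u4, u5, u6, u7⟩
    have n0 : m₄ 0 = m 0 := by rw [u1, s₃ 0 (by simp), s₂ 0 (by simp), p1]
    have n4 : m₄ 4 = m 4 := by rw [u2, s₃ 4 (by simp), s₂ 4 (by simp), p2]
    have g₄ : Grow 2 3 m m₄ := g₃.trans u4
    have o₄ : Grow 1 14 m m₄ := o₃.grow.trans u5
    have g₁₄ : Grow 2 3 m₁ m₄ := ((Grow.of_eq e2 e3).trans a₃.grow).trans u4
    rw [← hZ] at u7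
    have b₁ := length_tree_le q5 hM'
    have ht₃' : (d + 1) * (cl₁.length + 1) ≤ (d + 1) * (M + 1) := Nat.mul_le_mul_left _ (by omega)
    simp [h0]
    refine ⟨fun hz' => ?_, fun hz' => ?_⟩
    · cases u6 with
      | fail e => omega
      | backdoor _ e => omega
      | tree S₂ T₂ cl₂ v1 v2 v3 v4 v5 v6 =>
      have b₂ := length_tree_le v5 hM'
      refine (join_spec (r := _) (T₁ := T₁) (cl₁ := cl₁) hG ⟨?_, u3, ?_, ?_, ?_⟩ ?_ h.red hconn d₁ v5
        v2 v3 ?_ ?_ ?_ ?_ ?_ ?_ ?_ v6).wp ?_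
      · simp [h0]
      · simpa using g₄.seg h.ctx.seg (by rw [List.length_map, ← h.ctx.len]; exact h.ctx.top)
      · simp [h.ctx.len]
      · simpa using h.ctx.top.trans g₄.top
      · simp [h.dist]
      -- A variable of the graph in a clause of `T₁` was gathered into `xs`, so it is avoided by the
      -- second tree.
      · intro c hc x s hs hx
        exact v4 x ((hmem x).2 ⟨hx.1, c, hc, s, hs⟩)
      · simpa using g₁₄.seg q6.code (by rw [← q6.code_end]; exact q6.code_top)
      · simp [q6.code_end]
      · simpa using q6.code_top.trans g₁₄.top
      · simpa using g₁₄.seg q6.cla (by rw [List.length_map, ← q6.cla_end]; exact q6.cla_top)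
      · simp [q6.cla_end]
      · simpa using q6.cla_top.trans g₁₄.top
      rintro m₅ t₅ ⟨s₅, g₅, hout, ht₅⟩
      refine hQ _ _ ⟨(s₅ 0 (by simp)).trans n0, (s₅ 4 (by simp)).trans n4, u3.same s₅ (by simp),
        g₄.trans g₅, o₄.trans (.of_eq (s₅ 1 (by simp)) (s₅ 14 (by simp))), ?_, ?_⟩
      · rcases hout with ⟨w1, T, cl, w2, w3⟩ | ⟨w1, w2⟩
        · exact .tree (G.vset L A) T cl w1 subset_rfl h.red (by simp) w2 w3
        · exact .fail w1 w2
      · clear * - hover hC hCZ p7 ht₃ ht₃' u7 ht₅ b₁ b₂ hP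
        linarith [hP.1, hP.2.1, hP.2.2, b₁.1, b₁.2, b₂.1, b₂.2]
    · refine hQ _ _ ⟨n0, n4, u3, g₄, o₄, ?_, ?_⟩
      · cases u6 with
        | tree _ _ _ e => exact absurd e hz'
        | fail v1 v2 => exact .fail v1 v2
        | backdoor B v1 v2 v3 v4 v5 =>
          exact .backdoor B v1 v2 v3 (by rw [hpow]; simp only [List.length_nil]; omega) (o₃.trans v5)
      · clear * - hover hC hCZ p7 ht₃ ht₃' u7 b₁ hP
        linarith [hP.1, hP.2.1, hP.2.2, b₁.1, b₁.2]
  · refine hQ _ _ ⟨p1, p2, p3, p4, p5, ?_, by omega⟩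
    cases p6 with
    | tree _ _ _ e => exact absurd e hz
    | fail q1 q2 => exact .fail q1 q2
    | backdoor B q1 q2 q3 q4 q5 => exact .backdoor B q1 q2 q3 (by rw [hpow]; omega) q5

/-- Every step lowers the measure `j * (M + 2) + X.length`, by dropping the first variable of `X` or
by going down a level, so induction on the bound `f` works. Seven units for the step and one for the
occurrence test explain the factor `8`. `MainSpec` at `f` follows from `ConnSpec` at `f` and feeds
the branching. -/
theorem conn_spec (hG : G.InClass (d : ℤ) Set.univ)
    (hC : 1000 * ((4 * 2 ^ k + 1) * ((d + 1) * (M + 1))) ≤ C) : ∀ f, ConnSpec G d k M C f := by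
  intro f
  induction f with
  | zero =>
    intro j A X L r m _ _ _ hf
    omega
  | succ f ih =>
    intro j A X L r m h hconn hM hf
    have hover := overhead_le (f := f) hC L.length
    have hpow : C * 8 ^ (f + 1) * (L.length + 1) = 8 * (C * 8 ^ f * (L.length + 1)) := by ring
    have hbr : 7 * (C * 8 ^ f) * (L.length + 1) = 7 * (C * 8 ^ f * (L.length + 1)) := by ring
    rw [hpow]
    have h0 := h.ctx.zero
    have hE1 : 1 ≤ (d + 1) * (L.length + 1) := Nat.mul_pos (by omega) (by omega)
    have hE2 : (d + 1) * (L.length + 1) ≤ (4 * 2 ^ k + 1) * ((d + 1) * (L.length + 1)) :=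
      Nat.le_mul_of_pos_left _ (by omega)
    refine .hide (c := connCmd) rfl fun Q hQ => ?_
    simp only [connCmd, wp_ite, holds_lt, h.len]
    refine ⟨fun hX => ?_, fun hX => ?_⟩
    · match X, h with
      | [], h => simp at hX
      | x :: X, h =>
      rw [List.length_cons] at hf
      have hx20 := h.seg.1
      simp [seqs, wp_ite, hx20]
      refine (occurs_spec (x := x) hG (h.ctx.reg (by simp) (by simp) (by simp)) (by simp)).wp ?_
      rintro m₁ t₁ ⟨s₁, o₁, ht₁⟩
      have n0 : m₁ 0 = m 0 := s₁ 0 (by simp)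
      have n4 : m₁ 4 = m 4 := s₁ 4 (by simp)
      have n1 : m₁ 1 = m 1 := s₁ 1 (by simp)
      have n14 : m₁ 14 = m 14 := s₁ 14 (by simp)
      have g₁ : Grow 2 3 m m₁ := .of_eq (s₁ 2 (by simp)) (s₁ 3 (by simp))
      have h₁ := h.mem s₁ (by simp) g₁
      have hargs : ∀ r' : ℕ → ℕ, (∀ y ≤ 7, y ≠ 4 → r' y = r y) → r' 4 = r 4 + 1 →
          Args d k j A X L r' m₁ := by
        intro r' hr h4
        refine ⟨h₁.ctx.reg (hr 0 (by simp) (by simp)) (hr 6 (by simp) (by simp))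
          (hr 7 (by simp) (by simp)), by rw [hr 1 (by simp) (by simp), h.width],
          by rw [hr 2 (by simp) (by simp), h.dist], by rw [hr 3 (by simp) (by simp), h.level], ?_, ?_,
          by rw [hr 5 (by simp) (by simp)]; exact h₁.top, h.nodup, h.red⟩
        · rw [h4]
          exact h₁.seg.2
        · rw [h4, hr 5 (by simp) (by simp), h.len, List.length_cons]
          ring
      simp [h0]
      refine ⟨fun hz => ?_, fun hz => ?_⟩
      · have hx := o₁.1 hz
        refine (ih j A X L _ m₁ (hargs _ (fun y hy hy4 => ?_) (by simp)) hconn hM (by omega)).wp ?_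
        · have : y ≠ 20 ∧ y ≠ 16 := by omega
          simp [this, hy4]
        intro m' t hp
        obtain ⟨q1, q2, q3, q4, q5, q6, q7⟩ := hp.congr_left n0 n4 g₁ n1 n14
        generalize C * 8 ^ f * (L.length + 1) = Z at *
        refine hQ _ _ ⟨q1, q2, q3, q4, q5, ?_, by
          clear * - hover hE1 hE2 ht₁ q7
          omega⟩
        cases q6 with
        | fail u1 u2 => exact .fail u1 u2
        | backdoor B u1 u2 u3 u4 u5 =>
          exact .backdoor B u1 u2 u3 (u4.trans (by rw [List.length_cons]; omega)) u5
        | tree S₂ T cl u1 u2 u3 u4 u5 u6 =>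
          refine .tree S₂ T cl u1 u2 u3 ?_ u5 u6
          intro y hy
          rcases List.mem_cons.1 hy with rfl | hy
          -- A skipped variable does not occur in the current graph, hence not in any subset of it.
          · exact fun hn => hx (u2 hn)
          · exact u4 y hy
      · have hx : Sum.inl x ∈ G.vset L A := by
          by_contra hn
          exact hz (o₁.2 hn)
        refine (branch_spec (main_spec ih hG hC) hG hC (hargs _ (fun y hy hy4 => ?_) (by simp)) hconn
          hM (by omega) (x := x) (by simp) hx).wp ?_
        · have : y ≠ 20 ∧ y ≠ 16 := by omega
          simp [this, hy4]
        intro m' t hp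
        obtain ⟨q1, q2, q3, q4, q5, q6, q7⟩ := hp.congr_left n0 n4 g₁ n1 n14
        rw [hbr] at q7
        generalize C * 8 ^ f * (L.length + 1) = Z at *
        exact hQ _ _ ⟨q1, q2, q3, q4, q5, q6, by
          clear * - hover hE1 hE2 ht₁ q7
          omega⟩
    · match X, h with
      | x :: X, h => simp at hX
      | [], h =>
      simp only [holds_eq, h.level, h.width]
      refine ⟨fun hj => ?_, fun hj => ?_⟩
      · obtain rfl : j = 0 := by omega
        refine (base_spec hG h).wp ?_
        rintro m' t ⟨q1, q2, q3, q4, q5, q6, q7⟩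
        generalize C * 8 ^ f * (L.length + 1) = Z at *
        exact hQ _ _ ⟨q1, q2, q3, q4, q5, q6, by
          clear * - hover hE1 hE2 q7
          omega⟩
      · obtain ⟨j, rfl⟩ : ∃ j', j = j' + 1 := ⟨j - 1, by omega⟩
        refine (up_spec ih hG hC h hconn hM (by simpa using hf)).wp ?_
        rintro m' t ⟨q1, q2, q3, q4, q5, q6, q7⟩
        generalize C * 8 ^ f * (L.length + 1) = Z at *
        exact hQ _ _ ⟨q1, q2, q3, q4, q5, q6, by
          clear * - hover hE1 hE2 q7
          omega⟩

end Ram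

namespace Ram

open IncGraph

variable {G : IncGraph} {A : Finset (Fin G.numVar)} {L : List (Fin G.numCla)}
  {X : List (Fin G.numVar)} {r : ℕ → ℕ} {m m' : Mem} {d k j M C f : ℕ}

/-! ### Reading the input and writing the output -/

/-- A loop that runs `body` until the counter in the register `21` reaches the register `20`. -/
theorem wp_count {body : Cmd} {procs : List Cmd} {n s x c : ℕ} {Q : State → ℕ → Prop}
    (hx : 20 ≠ x ∧ 21 ≠ x) (h20 : r 20 = n)
    (hbody : ∀ (r : ℕ → ℕ) (Q : State → ℕ → Prop),
      Q ⟨Function.update (Function.update r x (r x + s)) 21 (r 21 + 1), m⟩ c →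
      WP procs body ⟨r, m⟩ Q)
    (h21 : r 21 = 0)
    (hQ : Q ⟨Function.update (Function.update r x (r x + s * n)) 21 n, m⟩ ((c + 1) * n + 1)) :
    WP procs (.loop (.lt 21 20) body) ⟨r, m⟩ Q := by
  refine wp_loop (fun i σ t =>
    σ = ⟨Function.update (Function.update r x (r x + s * i)) 21 i, m⟩ ∧ t = (c + 1) * i) n
    ⟨by simp [h21 ▸ Function.update_eq_self 21 r], rfl⟩ ?_ ?_
  · rintro i hi ⟨r₁, m₁⟩ t ⟨h1, h2⟩
    simp only [State.mk.injEq] at h1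
    obtain ⟨rfl, rfl⟩ := h1
    refine ⟨by simp [h20, hi, hx.1], hbody _ _ ⟨?_, by rw [h2]; ring⟩⟩
    simp only [State.mk.injEq, and_true]
    funext y
    by_cases h1 : y = 21
    · subst h1
      simp
    · by_cases h3 : y = x
      · subst h3
        simp [hx.2.symm]
        ring
      · simp [h1, h3]
  · rintro σ t ⟨rfl, rfl⟩
    exact ⟨by simp [h20, hx.1], hQ⟩

/-- The machine cannot add, so `4 * 2^k` is computed by `k` doublings through increments. The cost
is a geometric sum of order `2^k`. -/
theorem wp_double {procs : List Cmd} {Q : State → ℕ → Prop} (h2 : r 2 = 4) (h17 : r 17 = k)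
    (h19 : r 19 = 0)
    (hQ : ∀ r' t, r' 2 = 4 * 2 ^ k → (∀ x, x ≠ 2 → x < 19 → r' x = r x) →
      t ≤ 12 * 2 ^ k + 7 * k + 1 → Q ⟨r', m⟩ t) :
    WP procs (.loop (.lt 19 17) (seqs [.copy 20 2, .const 21 0,
      .loop (.lt 21 20) (seqs [.inc 2, .inc 21]), .inc 19])) ⟨r, m⟩ Q := by
  refine wp_loop (fun i σ t => σ.mem = m ∧ σ.reg 2 = 4 * 2 ^ i ∧ σ.reg 19 = i ∧
    (∀ x, x ≠ 2 → x < 19 → σ.reg x = r x) ∧ t ≤ 12 * 2 ^ i + 7 * i) k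
    ⟨rfl, by simp [h2], by simp [h19], fun _ _ _ => rfl, by simp⟩ ?_ ?_
  · rintro i hi ⟨r₁, m₁⟩ t ⟨rfl, a2, a3, a4, a5⟩
    simp only at a2 a3 a4
    refine ⟨by simp [a3, a4 17, h17, hi], ?_⟩
    simp only [seqs, wp_seq, wp_copy, wp_const, setReg_mk]
    refine wp_count (x := 2) (s := 1) (c := 2) (n := 4 * 2 ^ i) (by simp) (by simp [a2]) ?_ (by simp) ?_
    · intro r Q hQ
      simpa using hQ
    · simp [a2, a3]
      refine ⟨by ring, ?_, ?_⟩
      · intro x h2 h19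
        have : x ≠ 20 ∧ x ≠ 21 ∧ x ≠ 19 := by omega
        simp [this, h2, a4 x h2 h19]
      · rw [pow_succ]
        omega
  · rintro ⟨r₁, m₁⟩ t ⟨rfl, a2, a3, a4, a5⟩
    simp only at a2 a3 a4
    exact ⟨by simp [a3, a4 17, h17], hQ _ _ a2 a4 (by omega)⟩

/-- The clauses start at cell `6`, after the length cell, the three parameters and the two sizes.
One pass records where the code of each clause begins and puts the list of all clauses on the heap.
-/
theorem wp_parse {procs : List Cmd} {Q : State → ℕ → Prop} (hG : G.InClass (d : ℤ) Set.univ)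
    (h0 : r 0 = 0) (h16 : r 16 = 6) (h18 : r 18 = G.numCla) (h19 : r 19 = 0)
    (hseg : Seg (m 0) 6 (List.ofFn G.clauseCode).flatten)
    (hQ : ∀ r' m' t, (∀ x, x < 16 → r' x = r x) → Same [2, 3, 4] m m' →
      Ext 2 3 m m' (List.range G.numCla) →
      (∀ c : Fin G.numCla, Seg (m' 0) (m' 4 c) (G.clauseCode c)) →
      t ≤ G.numCla * (4 * d + 20) + 1 → Q ⟨r', m'⟩ t) :
    WP procs (.loop (.lt 19 18) (seqs [.store 4 19 16, pushCmd 2 3 19, .load 20 0 16, .inc 16,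
      .const 21 0, .loop (.lt 21 20) (seqs [.inc 16, .inc 16, .inc 21]), .inc 19])) ⟨r, m⟩ Q := by
  refine wp_loop (fun i σ t => Same [2, 3, 4] m σ.mem ∧ Ext 2 3 m σ.mem (List.range i) ∧
    (∀ c : Fin G.numCla, c.val < i → Seg (m 0) (σ.mem 4 c) (G.clauseCode c)) ∧
    σ.reg 16 = 6 + ((List.ofFn G.clauseCode).take i).flatten.length ∧ σ.reg 18 = G.numCla ∧
    σ.reg 19 = i ∧ (∀ x, x < 16 → σ.reg x = r x) ∧ t ≤ i * (4 * d + 20)) G.numCla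
    ⟨.refl _ _, .of_eq rfl rfl, by simp, by simp [h16], by simp [h18], by simp [h19],
      fun _ _ => rfl, by simp⟩ ?_ ?_
  · rintro i hi ⟨r₁, m₁⟩ t ⟨a1, a2, a3, a4, a5, a6, a7, a8⟩
    simp only at a1 a2 a3 a4 a5 a6 a7
    refine ⟨by simp [a5, a6, hi], WP.hide fun Q hQ => ?_⟩
    have hlt : i < (List.ofFn G.clauseCode).length := by simpa using hi
    have htake : (List.ofFn G.clauseCode).take (i + 1) =
        (List.ofFn G.clauseCode).take i ++ [G.clauseCode ⟨i, hi⟩] := by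
      rw [List.take_add_one, List.getElem?_eq_getElem hlt, List.getElem_ofFn]
      rfl
    have hs : Seg (m 0) (6 + ((List.ofFn G.clauseCode).take i).flatten.length)
        (G.clauseCode ⟨i, hi⟩) := by
      rw [← List.take_append_drop (i + 1) (List.ofFn G.clauseCode), htake, List.flatten_append,
        List.flatten_append, List.append_assoc, seg_append, seg_append, List.flatten_singleton] at hseg
      exact hseg.2.1
    have hlen := length_clause_le hG ⟨i, hi⟩
    have hcl : (G.clauseCode ⟨i, hi⟩).length = 2 * (G.clause ⟨i, hi⟩).length + 1 := by
      rw [clauseCode, List.length_cons]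
      congr 1
      generalize G.clause ⟨i, hi⟩ = l
      induction l with
      | nil => rfl
      | cons a l ih => simp only [List.flatMap_cons, List.length_append, ih, List.length_cons,
          List.length_nil]; ring
    have hhead : m 0 (6 + ((List.ofFn G.clauseCode).take i).flatten.length) =
        (G.clause ⟨i, hi⟩).length := hs.1
    have e0 : m₁ 0 = m 0 := a1 0 (by simp)
    have hnext : 6 + ((List.ofFn G.clauseCode).take (i + 1)).flatten.length =
        6 + ((List.ofFn G.clauseCode).take i).flatten.length + 1 +
          2 * (G.clause ⟨i, hi⟩).length := by
      rw [htake, List.flatten_append, List.length_append, List.flatten_singleton, hcl]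
      ring
    rw [hnext] at hQ
    clear hseg hnext htake
    generalize ((List.ofFn G.clauseCode).take i).flatten.length = o at *
    simp [seqs, a7 0, h0, a4, a6, pushMem_ne, e0, hhead]
    refine wp_count (x := 16) (s := 2) (c := 3) (n := (G.clause ⟨i, hi⟩).length) (by simp) (by simp)
      ?_ (by simp) ?_
    · intro r Q hQ
      simpa using hQ
    · simp
      refine hQ _ _ ⟨?_, ?_, ?_, ?_, ?_, ?_, ?_, ?_⟩
      · exact (a1.trans (same_setCell _ (by simp) _ _)).trans (same_pushMem (by simp) (by simp) _ _)
      · rw [List.range_succ]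
        exact (a2.congr (by simp) (by simp)).push (by simp) i
      · intro c hc
        simp only [pushMem_ne (show 4 ≠ 2 by simp) (show 4 ≠ 3 by simp)]
        rw [setCell_apply]
        split_ifs with h
        · obtain rfl : c = ⟨i, hi⟩ := Fin.ext h
          exact hs
        · exact a3 c (by omega)
      · simp
      · simp [a5]
      · simp [a6]
      · intro x hx
        have : x ≠ 19 ∧ x ≠ 21 ∧ x ≠ 16 ∧ x ≠ 20 ∧ x ≠ 30 := by omega
        simp [this, a7 x hx]
      · rw [add_mul]
        omega
  · rintro ⟨r₁, m₁⟩ t ⟨a1, a2, a3, a4, a5, a6, a7, a8⟩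
    simp only at a1 a2 a3 a4 a5 a6 a7
    refine ⟨by simp [a5, a6], hQ _ _ _ a7 a1 a2 (fun c => ?_) (by omega)⟩
    rw [a1 0 (by simp)]
    exact a3 c c.2

/-- The output stack starts at cell `2`: cell `0` is left for the length and cell `1` for the number
of the alternative. A backdoor is already in place, while the code of a tree is copied from the heap
over partial output. -/
theorem wp_output {procs : List Cmd} {Q : State → ℕ → Prop} {M : ℕ}
    (h0 : r 0 = 0) (h20 : r 20 = 2) (h22 : r 22 = m' 15 0) (htop : m 14 0 = 2)
    (ho : Outcome d k j ∅ [] (List.finRange G.numCla) m m')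
    (hM : 2 ^ j * (8 * 2 ^ k + 6) * (d + 1) ≤ M)
    (hQ : ∀ σ t out, G.IsAnswer (d + j) d k out → (∀ j ≤ out.length, σ.mem 1 j = listArray out j) →
      t ≤ 7 * M + 30 → Q σ t) :
    WP procs (seqs [.ite (.eq 22 0)
      (seqs [.store 14 0 20, .load 28 17 0, .load 29 18 0,
        .loop (.lt 28 29) (seqs [.load 16 2 28, pushCmd 1 14 16, .inc 28])]) .skip,
      .const 16 1, .store 1 16 22, .ite (.eq 22 20) (.store 1 0 16)
        (seqs [.load 16 14 0, .dec 16, .store 1 0 16])]) ⟨r, m'⟩ Q := by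
  have fin : ∀ (a : Mem) (l : List ℕ) (v : ℕ), Seg (a 1) 2 l → ∀ j ≤ (v :: l).length,
      setCell (setCell a 1 1 v) 1 0 (l.length + 1) 1 j = listArray (v :: l) j := by
    intro a l v hl j hj
    have : Seg (setCell (setCell a 1 1 v) 1 0 (l.length + 1) 1) 0 ((v :: l).length :: v :: l) := by
      refine ⟨by simp, by simp, hl.congr fun i hi _ => ?_⟩
      have : i ≠ 0 ∧ i ≠ 1 := by omega
      simp [this]
    simpa [listArray] using seg_iff_getD.1 this j (by simpa [Nat.lt_succ_iff] using hj)
  cases ho with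
  | fail h1 h2 =>
    simp [seqs, wp_ite, h0, h20, h22, h1]
    refine hQ _ _ [2] (.inr (.inr ⟨lt_srbd_of_not_smallDiam h2, rfl⟩)) ?_ (by omega)
    simpa using fin m' [] 2 trivial
  | backdoor B h1 h2 h3 h4 h5 =>
    simp [seqs, wp_ite, h0, h20, h22, h1]
    have := h5.top
    refine hQ _ _ (1 :: B.code) (.inr (.inl ⟨B, ⟨by rw [h2, vset_finRange], h3⟩, ?_, rfl⟩)) ?_
      (by omega)
    · simpa using h4
    · have hs := h5.seg
      rw [htop] at hs
      simpa [this, htop, Nat.add_comm 1] using fin m' B.code 1 hs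
  | tree S₂ T cl h1 h2 h3 h4 h5 h6 =>
    have hlen := length_tree_le h5 hM
    simp [seqs, wp_ite, h0, h20, h22, h1]
    have s₁ : Same [1, 14] m' (setCell m' 14 0 2) := same_setCell _ (by simp) _ _
    have t₁ : setCell m' 14 0 2 14 0 = 2 := by simp
    set m₁ := setCell m' 14 0 2 with hm₁
    refine wp_loop (fun i σ t => Same [1, 14] m' σ.mem ∧ Ext 1 14 m₁ σ.mem (T.code.take i) ∧
      σ.reg 0 = 0 ∧ σ.reg 20 = 2 ∧ σ.reg 22 = 0 ∧ σ.reg 28 = m' 17 0 + i ∧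
      σ.reg 29 = m' 17 0 + T.code.length ∧ t = 7 * i) T.code.length
      ⟨s₁, .of_eq rfl rfl, by simp [h0], by simp [h20], by simp [h22, h1], by simp,
        by simp [h6.code_end], rfl⟩ ?_ ?_
    · rintro i hi ⟨r₁, m₂⟩ t ⟨a1, a2, a3, a4, a5, a6, a7, a8⟩
      simp only at a1 a2 a3 a4 a5 a6 a7
      refine ⟨by simp [a6, a7, hi], WP.hide fun Q hQ => ?_⟩
      have hv : m₂ 2 (m' 17 0 + i) = T.code[i] := by
        have := seg_iff_getD.1 h6.code i hi
        rw [a1 2 (by simp)]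
        simpa [hi] using this
      simp [a3, a6, hv]
      refine hQ _ _ ⟨a1.trans (same_pushMem (by simp) (by simp) _ _), ?_, by simp [a3], by simp [a4],
        by simp [a5], by simp [add_assoc], by simp [a7], by omega⟩
      rw [List.take_add_one, List.getElem?_eq_getElem hi]
      exact a2.push (by simp) _
    · rintro ⟨r₁, m₂⟩ t ⟨a1, a2, a3, a4, a5, a6, a7, a8⟩
      simp only at a1 a2 a3 a4 a5 a6 a7
      rw [List.take_length] at a2
      refine ⟨by simp [a6, a7], ?_⟩
      simp [a3, a4, a5]
      have htop₂ := a2.top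
      have hs := a2.seg
      rw [t₁] at htop₂ hs
      refine hQ _ _ (0 :: T.code) (.inl ⟨T, h5.tree, rfl⟩) ?_ (by omega)
      simpa [htop₂, Nat.add_comm 1] using fin m₂ T.code 0 hs

end Ram

-- The whole program and its time bound.

namespace Ram

open IncGraph

variable {G : IncGraph} {d k j M C f : ℕ}

theorem wp_cons {procs : List Cmd} {a b : Cmd} {l : List Cmd} {σ : State} {Q : State → ℕ → Prop} :
    WP procs (seqs (a :: b :: l)) σ Q ↔
      WP procs a σ (fun σ' t => WP procs (seqs (b :: l)) σ' (fun σ'' t' => Q σ'' (t + t'))) :=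
  wp_seq _ _ _ _

theorem mainProgram_spec (hG : G.InClass (d : ℤ) Set.univ)
    (hM : 2 ^ j * (8 * 2 ^ k + 6) * (d + 1) ≤ M)
    (hC : 1000 * ((4 * 2 ^ k + 1) * ((d + 1) * (M + 1))) ≤ C) (hf : j * (M + 2) < f) :
    WP procedures mainProgram (initState ((d + j) :: d :: k :: G.code)) fun σ t =>
      ∃ out, G.IsAnswer (d + j) d k out ∧ (∀ j ≤ out.length, σ.mem 1 j = listArray out j) ∧
        t ≤ 4 * (C * 8 ^ f) * (G.numCla + 1) := by
  have hover := overhead_le (f := f) hC G.numCla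
  refine WP.hide fun Q hQ => ?_
  have hin := seg_listArray ((d + j) :: d :: k :: G.code)
  rw [initState]
  set m₀ : Mem := fun a => if a = 0 then listArray ((d + j) :: d :: k :: G.code) else fun _ => 0
    with hm₀
  have hz : ∀ a, a ≠ 0 → m₀ a = fun _ => 0 := fun a ha => by simp [m₀, ha]
  have hi : Seg (m₀ 0) 1 ((d + j) :: d :: k :: G.code) := by simpa [m₀] using hin.2
  obtain ⟨v1, v2, v3, v4, v5, v6⟩ := hi
  norm_num at v2 v3 v4 v5 v6
  clear_value m₀
  rw [mainProgram]
  -- Executing one command at a time keeps the terms small; the first twelve read the parameters and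
  -- set up the doubling.
  iterate 12 rw [wp_cons]; simp only [wp_const, wp_load, wp_inc, setReg_mk]
  rw [wp_cons]
  refine wp_double (k := k) (by simp) (by simp [v3]) (by simp) ?_
  intro r₁ t₁ hr2 hr ht₁
  have q0 : r₁ 0 = 0 := by rw [hr 0 (by simp) (by simp)]; simp
  have q1 : r₁ 1 = d := by rw [hr 1 (by simp) (by simp)]; simp [v2]
  have q3 : r₁ 3 = d + j := by rw [hr 3 (by simp) (by simp)]; simp [v1]
  have q4 : r₁ 4 = 0 := by rw [hr 4 (by simp) (by simp)]; simp
  have q5 : r₁ 5 = 0 := by rw [hr 5 (by simp) (by simp)]; simp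
  have q6 : r₁ 6 = 0 := by rw [hr 6 (by simp) (by simp)]; simp
  have q16 : r₁ 16 = 6 := by rw [hr 16 (by simp) (by simp)]; simp
  have q18 : r₁ 18 = G.numCla := by rw [hr 18 (by simp) (by simp)]; simp [v5]
  clear hr
  rw [wp_cons]
  simp only [wp_const, setReg_mk]
  rw [wp_cons]
  refine wp_parse hG (by simp [q0]) (by simp [q16]) (by simp [q18]) (by simp) v6 ?_
  intro r₂ m₂ t₂ hr₂ s₂ a₂ hcode ht₂
  have hr₂' : ∀ x < 16, r₂ x = r₁ x := by
    intro x hx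
    have : x ≠ 19 := by omega
    simp [hr₂ x hx, this]
  have h0 : r₂ 0 = 0 := by rw [hr₂' 0 (by simp), q0]
  iterate 3 rw [wp_cons]; simp only [wp_const, wp_load, wp_store, setReg_mk, setMem_mk]
  have z3 : m₀ 3 0 = 0 := by rw [hz 3 (by simp)]
  have htop := a₂.top
  rw [z3, List.length_range, zero_add] at htop
  simp only [ne_eq, not_false_eq_true, Function.update_of_ne, Function.update_self,
    OfNat.zero_ne_ofNat, h0, htop]
  set m₃ := setCell m₂ 14 0 2 with hm₃
  have e3 : m₃ 3 0 = G.numCla := by simp [m₃, htop]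
  have hargs : Args d k j ∅ [] (List.finRange G.numCla)
      (Function.update (Function.update r₂ 7 G.numCla) 20 2) m₃ := by
    refine ⟨⟨by simp [h0], ⟨fun c => by simpa [m₃] using hcode c, fun x => ?_⟩, ?_, ?_, ?_⟩, ?_, ?_, ?_,
      by simp, ?_, ?_, List.nodup_finRange _, ?_⟩
    · simp [m₃, s₂ 5, hz]
    · have := a₂.seg
      rw [z3] at this
      simpa [m₃, hr₂' 6, q6, List.map_coe_finRange_eq_range] using this
    · simp [hr₂' 6, q6]
    · simp [e3]
    · simp [hr₂' 1, q1]
    · simp [hr₂' 2, hr2]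
    · simp [hr₂' 3, q3]
    · simp [hr₂' 4, hr₂' 5, q4, q5]
    · simp [hr₂' 5, q5]
    · rw [vset_finRange]
      exact red_univ
  rw [wp_cons]
  refine (main_spec (conn_spec hG hC f) hG hC j ∅ [] (List.finRange G.numCla) _ m₃ hargs hM
    (by simpa using hf)).wp ?_
  rintro m₄ t₄ ⟨p1, p2, p3, p4, p5, p6, p7⟩
  rw [wp_cons]
  simp only [wp_load, setReg_mk]
  refine wp_output (by simp [h0]) (by simp) (by simp [h0]) (by simp [m₃]) p6 hM ?_
  intro σ t out ho hcell ht
  refine hQ _ _ ⟨out, ho, hcell, ?_⟩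
  have hC' : C ≤ C * 8 ^ f * (G.numCla + 1) := by
    rw [mul_assoc]
    exact Nat.le_mul_of_pos_right _ (by positivity)
  have b1 : G.numCla * (4 * d + 20) ≤ 20 * ((d + 1) * (G.numCla + 1)) := by
    calc G.numCla * (4 * d + 20) ≤ (G.numCla + 1) * (20 * (d + 1)) := by gcongr <;> omega
      _ = _ := by ring
  have b2 : (d + 1) * (G.numCla + 1) ≤ (4 * 2 ^ k + 1) * ((d + 1) * (G.numCla + 1)) :=
    Nat.le_mul_of_pos_left _ (by omega)
  have b3 : 4 * 2 ^ k + 1 ≤ (4 * 2 ^ k + 1) * ((d + 1) * (G.numCla + 1)) :=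
    Nat.le_mul_of_pos_right _ (by positivity)
  have b4 : k < 2 ^ k := Nat.lt_two_pow_self
  have b5 : M + 1 ≤ (4 * 2 ^ k + 1) * ((d + 1) * (M + 1)) :=
    (Nat.le_mul_of_pos_left _ (by omega)).trans (Nat.le_mul_of_pos_left _ (by omega))
  rw [List.length_finRange, show 3 * (C * 8 ^ f) * (G.numCla + 1) =
    3 * (C * 8 ^ f * (G.numCla + 1)) by ring] at p7
  rw [show 4 * (C * 8 ^ f) * (G.numCla + 1) = 4 * (C * 8 ^ f * (G.numCla + 1)) by ring]
  clear * - hover ht₁ ht₂ p7 ht hC hC' b1 b2 b3 b4 b5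
  generalize C * 8 ^ f * (G.numCla + 1) = Z at *
  linarith

/-- With `N = 2^(k+1)`, which exceeds `k + 1` and hence `d` and `j`, all quantities are polynomial
in `N`: `M ≤ 8 * N^3`, `C ≤ 2^15 * N^5` and `f ≤ 11 * N^4`. The total exponent of two is at most `64
* N^4`, hence at most `N^10`. -/
theorem cost_bound (hdj : d + j ≤ k + 1) (hM : M = 2 ^ j * (8 * 2 ^ k + 6) * (d + 1))
    (hC : C = 1000 * ((4 * 2 ^ k + 1) * ((d + 1) * (M + 1)))) (hf : f = j * (M + 2) + 1) :
    4 * (C * 8 ^ f) ≤ 2 ^ 2 ^ (10 * (k + 1)) := by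
  set N := 2 ^ (k + 1) with hN
  have hk : k + 1 < N := Nat.lt_two_pow_self
  have hN2 : 2 ≤ N := by rw [hN, pow_succ]; have := Nat.one_le_two_pow (n := k); omega
  have hk2 : 2 * 2 ^ k = N := by rw [hN]; ring
  have hM' : M ≤ 8 * N ^ 3 := by
    calc M = 2 ^ j * (8 * 2 ^ k + 6) * (d + 1) := hM
      _ ≤ N * (8 * N) * N := by
        gcongr
        · exact Nat.pow_le_pow_right (by omega) (by omega)
        · omega
        · omega
      _ = _ := by ring
  have hN3 : 1 ≤ N ^ 3 := Nat.one_le_pow _ _ (by omega)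
  have hN4 : 16 ≤ N ^ 4 := by
    calc 16 = 2 ^ 4 := by norm_num
      _ ≤ N ^ 4 := Nat.pow_le_pow_left hN2 4
  have hC' : C ≤ 2 ^ 15 * N ^ 5 := by
    calc C = 1000 * ((4 * 2 ^ k + 1) * ((d + 1) * (M + 1))) := hC
      _ ≤ 1000 * ((3 * N) * (N * (9 * N ^ 3))) := by
        gcongr <;> omega
      _ = 27000 * N ^ 5 := by ring
      _ ≤ 2 ^ 15 * N ^ 5 := Nat.mul_le_mul_right _ (by norm_num)
  have hf' : f ≤ 11 * N ^ 4 := by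
    have : j * (M + 2) ≤ N * (10 * N ^ 3) := by gcongr <;> omega
    have h2 : N * (10 * N ^ 3) = 10 * N ^ 4 := by ring
    omega
  calc 4 * (C * 8 ^ f) ≤ 4 * (2 ^ 15 * N ^ 5 * 8 ^ (11 * N ^ 4)) := by
        gcongr
        norm_num
    _ = 2 ^ (17 + 5 * (k + 1) + 33 * N ^ 4) := by
        rw [hN, show (8 : ℕ) = 2 ^ 3 by norm_num, show (4 : ℕ) = 2 ^ 2 by norm_num]
        simp only [← pow_mul, ← pow_add]
        congr 1
        ring
    _ ≤ 2 ^ 2 ^ (10 * (k + 1)) := by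
        refine Nat.pow_le_pow_right (by omega) ?_
        have h1 : 2 ^ (10 * (k + 1)) = N ^ 4 * N ^ 6 := by
          rw [hN, ← pow_mul, ← pow_mul, ← pow_add]
          congr 1
          ring
        have h2 : 64 ≤ N ^ 6 := by
          calc 64 = 2 ^ 6 := by norm_num
            _ ≤ N ^ 6 := Nat.pow_le_pow_left hN2 6
        have h3 : N ≤ N ^ 4 := Nat.le_self_pow (by omega) _
        have h4 : N ^ 4 * 64 ≤ N ^ 4 * N ^ 6 := Nat.mul_le_mul_left _ h2
        omega

end Ram

/-- There is one program that, for all `d ≤ i ≤ k + 1` and all incidence graphs `G` in `𝒞_d`,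
halts within `2 ^ 2 ^ (a * (k + 1)) * (|G| + 1)` steps with a correct answer. -/
theorem proposition5p9 :
    ∃ (P : Ram.Program) (a : ℕ), ∀ i d k : ℕ, d ≤ i → i ≤ k + 1 →
      ∀ G : IncGraph, G.InClass (d : ℤ) Set.univ →
        ∃ (out : List ℕ) (t : ℕ),
          P.Computes (i :: d :: k :: G.code) out t ∧
          t ≤ 2 ^ 2 ^ (a * (k + 1)) * (G.size + 1) ∧
          G.IsAnswer i d k out := by
  refine ⟨Ram.program, 10, fun i d k hdi hik G hG => ?_⟩
  obtain ⟨j, rfl⟩ := Nat.exists_eq_add_of_le hdi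
  -- The reflexivity arguments fix `M` and `C` as the smallest admissible values, and `f` as the
  -- successor of the initial measure.
  obtain ⟨σ, t, hex, out, hout, hcell, ht⟩ := Ram.mainProgram_spec (k := k) (j := j) hG le_rfl le_rfl
    (Nat.lt_succ_self _)
  refine ⟨out, t, ⟨σ, hex, hcell⟩, ht.trans ?_, hout⟩
  exact Nat.mul_le_mul (Ram.cost_bound hik rfl rfl rfl)
    (by rw [IncGraph.size]; omega)
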